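/- Let $0<p<1$, $\theta\ge 0$, and let $\mathcal M=\{M_n\}_{n\ge 0}$ be a sequence of positive reals with $n\mapsto\log M_n$ convex. Put $\kappa(p,\mathcal M)=\limsup_{n\to\infty}\sum_{j=1}^n(1-p)^j\log M_j$. Assume that $\kappa(p,\mathcal M)=+\infty$ and that $\mathcal M$ is $p$-regular, i.e. that one of the following holds: (i) $\liminf_{n\to\infty}(1-p)^n\log M_n>0$; or (ii) $\log M_n=o((1-p)^{-n})$ and, for some $\delta<1$, $n\log n\le(\delta+o(1))\log M_n$ as $n\to\infty$. For smooth $f$ on $\mathbb R$ (real- or complex-valued) let $\|f\|_{p,\mathcal M}=\sup_{k\ge0}\|f^{(k)}\|_p/M_k$, and let $\mathscr S_{p,\theta,\mathcal M}$ be the linear space of all $f\in C^\infty(\mathbb R)$ with $\|f\|_{p,\mathcal M}<\infty$ and $\limsup_{n\to\infty}(1-p)^n\log\|f^{(n)}\|_\infty\le\theta$. Let $W^{p,\theta}_{\mathcal M}$ be the completion of $\mathscr S_{p,\theta,\mathcal M}$ with respect to the quasinorm $\|\cdot\|_{p,\mathcal M}$. For $k\ge 0$ put $\mathcal M_k=\{M_{n+k}\}_{n\ge0}$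 and $\theta_k=\theta(1-p)^{-k}$. Let $\pi_k:W^{p,\theta}_{\mathcal M}\to L^p(\mathbb R)$ and $\delta^k:W^{p,\theta}_{\mathcal M}\to W^{p,\theta_k}_{\mathcal M_k}$ be the continuous extensions of the map $f\mapsto f^{(k)}$ on $\mathscr S_{p,\theta,\mathcal M}$, and write $\alpha=\pi_0$, $\delta=\delta^1$. Then: 1. $\pi_0$ maps $W^{p,\theta}_{\mathcal M}$ onto $L^p(\mathbb R)$. 2. The map $x\mapsto(\alpha x,\delta x)$ is an isomorphism (a linear homeomorphism) $$W^{p,\theta}_{\mathcal M}\;\cong\;L^p(\mathbb R)\oplus W^{p,\theta/(1-p)}_{\mathcal M_1}.$$ 3. $\mathcal M_1$ is again log-convex and $p$-regular, with $\kappa(p,\mathcal M_1)=+\infty$. 4. Consequently, for every $k\ge0$, the map $x\mapsto(\pi_0x,\dots,\pi_{k-1}x,\delta^kx)$ is an isomorphism $$W^{p,\theta}_{\mathcal M}\;\cong\;\underbrace{L^p(\mathbb R)\oplus\cdots\oplus L^p(\mathbb R)}_{k}\;\oplus\;W^{p,\theta_k}_{\mathcal M_k}.$$ -/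

import Mathlib

open MeasureTheory Filter Topology
open scoped ENNReal NNReal

namespace LpCarleman

/-! ### Weight sequences -/

/-- The shifted sequence `n ↦ M (n + k)`. -/
def shift (k : ℕ) (M : ℕ → ℝ) : ℕ → ℝ := fun n => M (n + k)

/-- A positive sequence `M` such that `n ↦ log (M n)` is convex. -/
def LogConvexSeq (M : ℕ → ℝ) : Prop :=
  (∀ n, 0 < M n) ∧ ∀ n, 2 * Real.log (M (n + 1)) ≤ Real.log (M n) + Real.log (M (n + 2))

/-- The `p`-characteristic `limsup_n ∑_{j=1}^n (1-p)^j log M_j`, an extended real number. -/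
noncomputable def pCharacteristic (p : ℝ) (M : ℕ → ℝ) : EReal :=
  limsup (fun n : ℕ => ((∑ j ∈ Finset.Icc 1 n, (1 - p) ^ j * Real.log (M j) : ℝ) : EReal)) atTop

/-- `p`-regularity: a log-convex sequence with infinite `p`-characteristic for which
(i) `liminf (1-p)^n log M_n > 0`, or (ii) `log M_n = o((1-p)^{-n})` and
`n log n ≤ (δ + o(1)) log M_n` for some `δ < 1`. -/
structure IsPRegular (p : ℝ) (M : ℕ → ℝ) : Prop where
  logConvex : LogConvexSeq M
  infinite_characteristic : pCharacteristic p M = ⊤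
  growth :
    (0 < liminf (fun n : ℕ => (((1 - p) ^ n * Real.log (M n) : ℝ) : EReal)) atTop) ∨
    ((fun n : ℕ => Real.log (M n)) =o[atTop] (fun n : ℕ => ((1 - p) ^ n)⁻¹) ∧
      ∃ δ : ℝ, δ < 1 ∧ ∃ r : ℕ → ℝ, Tendsto r atTop (𝓝 0) ∧
        ∀ᶠ n : ℕ in atTop, (n : ℝ) * Real.log n ≤ (δ + r n) * Real.log (M n))

/-! ### The quasinorm and the test functions -/

section Quasinorm

variable {𝕜 : Type*} [RCLike 𝕜]

/-- The quasinorm `‖f‖_{p,M} = sup_k ‖f^{(k)}‖_p / M_k`, with values in `[0, ∞]`. -/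
noncomputable def carlemanNorm (p : ℝ) (M : ℕ → ℝ) (f : ℝ → 𝕜) : ℝ≥0∞ :=
  ⨆ k : ℕ, eLpNorm (iteratedDeriv k f) (ENNReal.ofReal p) volume / ENNReal.ofReal (M k)

/-- `limsup_n (1-p)^n log ‖f^{(n)}‖_∞ ≤ θ`, where `log 0 = -∞` and `log ∞ = ∞`. -/
def IsTame (p θ : ℝ) (f : ℝ → 𝕜) : Prop :=
  limsup (fun n : ℕ => (((1 - p) ^ n : ℝ) : EReal) *
    ENNReal.log (eLpNorm (iteratedDeriv n f) ⊤ volume)) atTop ≤ (θ : EReal)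

variable {p : ℝ}

theorem eLpNorm_rpow_eq (hp : 0 < p) (f : ℝ → 𝕜) :
    eLpNorm f (ENNReal.ofReal p) volume ^ p = ∫⁻ x, ‖f x‖ₑ ^ p := by
  rw [eLpNorm_eq_lintegral_rpow_enorm_toReal (by simpa using hp) ENNReal.ofReal_ne_top,
    ENNReal.toReal_ofReal hp.le, ← ENNReal.rpow_mul, one_div, inv_mul_cancel₀ hp.ne',
    ENNReal.rpow_one]

theorem eLpNorm_rpow_add_le (hp : 0 < p) (hp1 : p < 1) {f g : ℝ → 𝕜}
    (hf : AEStronglyMeasurable f volume) :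
    eLpNorm (f + g) (ENNReal.ofReal p) volume ^ p ≤
      eLpNorm f (ENNReal.ofReal p) volume ^ p + eLpNorm g (ENNReal.ofReal p) volume ^ p := by
  rw [eLpNorm_rpow_eq hp, eLpNorm_rpow_eq hp, eLpNorm_rpow_eq hp,
    ← lintegral_add_left' (hf.enorm.pow_const p)]
  refine lintegral_mono fun x => ?_
  refine le_trans ?_ (ENNReal.rpow_add_le_add_rpow _ _ hp.le hp1.le)
  exact ENNReal.rpow_le_rpow (enorm_add_le _ _) hp.le

theorem tsum_rpow_le (hp : 0 < p) (hp1 : p < 1) (a : ℕ → ℝ≥0∞) :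
    (∑' i, a i) ^ p ≤ ∑' i, a i ^ p := by
  have fin : ∀ s : Finset ℕ, (∑ i ∈ s, a i) ^ p ≤ ∑ i ∈ s, a i ^ p := by
    intro s
    induction s using Finset.induction_on with
    | empty => simp [hp]
    | insert i s hi ih =>
      rw [Finset.sum_insert hi, Finset.sum_insert hi]
      exact (ENNReal.rpow_add_le_add_rpow _ _ hp.le hp1.le).trans (by gcongr)
  rw [← ENNReal.le_rpow_inv_iff hp, ENNReal.tsum_eq_iSup_sum]
  refine iSup_le fun s => ?_
  rw [ENNReal.le_rpow_inv_iff hp]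
  exact (fin s).trans (ENNReal.sum_le_tsum s)

theorem continuous_iteratedDeriv_of_smooth {f : ℝ → 𝕜} (hf : ContDiff ℝ (⊤ : ℕ∞) f) (k : ℕ) :
    Continuous (iteratedDeriv k f) :=
  hf.continuous_iteratedDeriv k (by exact_mod_cast le_top)

theorem contDiff_iteratedDeriv_of_smooth {f : ℝ → 𝕜} (hf : ContDiff ℝ (⊤ : ℕ∞) f) (k : ℕ) :
    ContDiff ℝ (⊤ : ℕ∞) (iteratedDeriv k f) := by
  rw [iteratedDeriv_eq_iterate]
  exact hf.iterate_deriv k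

theorem iteratedDeriv_add_of_smooth {f g : ℝ → 𝕜} (hf : ContDiff ℝ (⊤ : ℕ∞) f) (hg : ContDiff ℝ (⊤ : ℕ∞) g)
    (k : ℕ) : iteratedDeriv k (f + g) = iteratedDeriv k f + iteratedDeriv k g := by
  funext x
  exact iteratedDeriv_add (hf.contDiffAt.of_le (by exact_mod_cast le_top))
    (hg.contDiffAt.of_le (by exact_mod_cast le_top))

theorem iteratedDeriv_smul_of_smooth (c : 𝕜) (f : ℝ → 𝕜) (k : ℕ) :
    iteratedDeriv k (c • f) = c • iteratedDeriv k f := by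
  funext x
  exact iteratedDeriv_const_smul_field c f

theorem iteratedDeriv_iteratedDeriv (f : ℝ → 𝕜) (k n : ℕ) :
    iteratedDeriv n (iteratedDeriv k f) = iteratedDeriv (n + k) f := by
  simp only [iteratedDeriv_eq_iterate, Function.iterate_add_apply]

theorem carlemanNorm_rpow_add_le (hp : 0 < p) (hp1 : p < 1) (M : ℕ → ℝ) {f g : ℝ → 𝕜}
    (hf : ContDiff ℝ (⊤ : ℕ∞) f) (hg : ContDiff ℝ (⊤ : ℕ∞) g) :
    carlemanNorm p M (f + g) ^ p ≤ carlemanNorm p M f ^ p + carlemanNorm p M g ^ p := by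
  have key : carlemanNorm p M (f + g) ≤
      (carlemanNorm p M f ^ p + carlemanNorm p M g ^ p) ^ p⁻¹ := by
    refine iSup_le fun k => ?_
    rw [ENNReal.le_rpow_inv_iff hp, iteratedDeriv_add_of_smooth hf hg,
      ENNReal.div_rpow_of_nonneg _ _ hp.le]
    calc _ ≤ (eLpNorm (iteratedDeriv k f) (ENNReal.ofReal p) volume ^ p +
          eLpNorm (iteratedDeriv k g) (ENNReal.ofReal p) volume ^ p) /
            ENNReal.ofReal (M k) ^ p := by
          gcongr
          exact eLpNorm_rpow_add_le hp hp1
            (continuous_iteratedDeriv_of_smooth hf k).aestronglyMeasurable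
      _ = (eLpNorm (iteratedDeriv k f) (ENNReal.ofReal p) volume / ENNReal.ofReal (M k)) ^ p +
          (eLpNorm (iteratedDeriv k g) (ENNReal.ofReal p) volume / ENNReal.ofReal (M k)) ^ p := by
          rw [ENNReal.div_rpow_of_nonneg _ _ hp.le, ENNReal.div_rpow_of_nonneg _ _ hp.le,
            ENNReal.add_div]
      _ ≤ _ := by
          gcongr
          · exact le_iSup (fun k : ℕ => eLpNorm (iteratedDeriv k f) (ENNReal.ofReal p) volume /
              ENNReal.ofReal (M k)) k
          · exact le_iSup (fun k : ℕ => eLpNorm (iteratedDeriv k g) (ENNReal.ofReal p) volume /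
              ENNReal.ofReal (M k)) k
  exact (ENNReal.le_rpow_inv_iff hp).1 key

theorem carlemanNorm_smul (M : ℕ → ℝ) (c : 𝕜) (f : ℝ → 𝕜) :
    carlemanNorm p M (c • f) = ‖c‖ₑ * carlemanNorm p M f := by
  unfold carlemanNorm
  rw [ENNReal.mul_iSup]
  refine iSup_congr fun k => ?_
  rw [iteratedDeriv_smul_of_smooth, eLpNorm_const_smul, mul_div_assoc]

theorem carlemanNorm_iteratedDeriv_le (M : ℕ → ℝ) (f : ℝ → 𝕜) (k : ℕ) :
    carlemanNorm p (shift k M) (iteratedDeriv k f) ≤ carlemanNorm p M f := by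
  refine iSup_le fun n => ?_
  rw [iteratedDeriv_iteratedDeriv]
  exact le_iSup (fun k : ℕ => eLpNorm (iteratedDeriv k f) (ENNReal.ofReal p) volume /
    ENNReal.ofReal (M k)) (n + k)

theorem eLpNorm_le_carlemanNorm (M : ℕ → ℝ) (f : ℝ → 𝕜) (k : ℕ) (hf : carlemanNorm p M f ≠ ⊤) :
    eLpNorm (iteratedDeriv k f) (ENNReal.ofReal p) volume ≤
      ENNReal.ofReal (M k) * carlemanNorm p M f := by
  have h : eLpNorm (iteratedDeriv k f) (ENNReal.ofReal p) volume / ENNReal.ofReal (M k) ≤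
      carlemanNorm p M f := le_iSup (fun k : ℕ =>
        eLpNorm (iteratedDeriv k f) (ENNReal.ofReal p) volume / ENNReal.ofReal (M k)) k
  rw [mul_comm]
  exact (ENNReal.div_le_iff_le_mul (Or.inr hf) (Or.inl ENNReal.ofReal_ne_top)).1 h

theorem isTame_iff (hp1 : p < 1) (θ : ℝ) (f : ℝ → 𝕜) :
    IsTame p θ f ↔ ∀ b : ℝ, θ < b → ∀ᶠ n : ℕ in atTop,
      eLpNorm (iteratedDeriv n f) ⊤ volume ≤ ENNReal.ofReal (Real.exp (b / (1 - p) ^ n)) := by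
  have key : ∀ (n : ℕ) (b : ℝ) (x : ℝ≥0∞), (((1 - p) ^ n : ℝ) : EReal) * ENNReal.log x ≤ b ↔
      x ≤ ENNReal.ofReal (Real.exp (b / (1 - p) ^ n)) := by
    intro n b x
    have hq : 0 < (1 - p) ^ n := pow_pos (by linarith) n
    rw [← EReal.exp_coe, ← ENNReal.log_le_log_iff, EReal.log_exp, EReal.coe_div, mul_comm]
    exact (EReal.le_div_iff_mul_le (by exact_mod_cast hq) (EReal.coe_ne_top _)).symm
  unfold IsTame
  constructor
  · intro h b hb
    have := eventually_lt_of_limsup_lt (lt_of_le_of_lt h (EReal.coe_lt_coe_iff.2 hb))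
    filter_upwards [this] with n hn
    exact (key n b _).1 hn.le
  · intro h
    refine EReal.le_of_forall_lt_iff_le.1 fun b hb => ?_
    refine limsup_le_of_le (by isBoundedDefault) ?_
    filter_upwards [h b (EReal.coe_lt_coe_iff.1 hb)] with n hn
    exact (key n b _).2 hn

theorem eventually_mul_exp_le (hp : 0 < p) (hp1 : p < 1) (C : ℝ≥0∞) (hC : C ≠ ⊤) {b b' : ℝ}
    (hb : b < b') :
    ∀ᶠ n : ℕ in atTop, C * ENNReal.ofReal (Real.exp (b / (1 - p) ^ n)) ≤
      ENNReal.ofReal (Real.exp (b' / (1 - p) ^ n)) := by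
  have hq0 : 0 < 1 - p := by linarith
  have h1 : Tendsto (fun n : ℕ => Real.exp ((b' - b) * ((1 - p)⁻¹) ^ n)) atTop atTop :=
    Real.tendsto_exp_atTop.comp ((tendsto_pow_atTop_atTop_of_one_lt
      ((one_lt_inv₀ hq0).2 (by linarith))).const_mul_atTop (by linarith))
  filter_upwards [h1.eventually_ge_atTop C.toReal] with n hn
  rw [← ENNReal.ofReal_toReal hC, ← ENNReal.ofReal_mul ENNReal.toReal_nonneg]
  refine ENNReal.ofReal_le_ofReal ?_
  calc C.toReal * Real.exp (b / (1 - p) ^ n)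
      ≤ Real.exp ((b' - b) * ((1 - p)⁻¹) ^ n) * Real.exp (b / (1 - p) ^ n) := by gcongr
    _ = _ := by
        rw [← Real.exp_add]
        congr 1
        rw [inv_pow]
        ring

theorem IsTame.add (hp : 0 < p) (hp1 : p < 1) {θ : ℝ} {f g : ℝ → 𝕜} (hf : ContDiff ℝ (⊤ : ℕ∞) f)
    (hg : ContDiff ℝ (⊤ : ℕ∞) g) (hf' : IsTame p θ f) (hg' : IsTame p θ g) : IsTame p θ (f + g) := by
  rw [isTame_iff hp1] at *
  intro b hb
  obtain ⟨a, ha, hab⟩ := exists_between hb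
  filter_upwards [hf' a ha, hg' a ha, eventually_mul_exp_le hp hp1 2 (by simp) hab]
    with n h1 h2 h3
  rw [iteratedDeriv_add_of_smooth hf hg]
  refine (eLpNorm_add_le (continuous_iteratedDeriv_of_smooth hf n).aestronglyMeasurable
    (continuous_iteratedDeriv_of_smooth hg n).aestronglyMeasurable le_top).trans ?_
  refine le_trans ?_ h3
  rw [two_mul]
  exact add_le_add h1 h2

theorem IsTame.smul (hp : 0 < p) (hp1 : p < 1) {θ : ℝ} (c : 𝕜) {f : ℝ → 𝕜}
    (hf' : IsTame p θ f) : IsTame p θ (c • f) := by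
  rw [isTame_iff hp1] at *
  intro b hb
  obtain ⟨a, ha, hab⟩ := exists_between hb
  filter_upwards [hf' a ha, eventually_mul_exp_le hp hp1 ‖c‖ₑ (by simp) hab] with n h1 h3
  rw [iteratedDeriv_smul_of_smooth, eLpNorm_const_smul]
  exact le_trans (by gcongr) h3

theorem IsTame.iteratedDeriv (hp1 : p < 1) {θ : ℝ} {f : ℝ → 𝕜} (hf' : IsTame p θ f) (k : ℕ) :
    IsTame p (θ / (1 - p) ^ k) (iteratedDeriv k f) := by
  rw [isTame_iff hp1] at *
  intro b hb
  have hq : 0 < (1 - p) ^ k := pow_pos (by linarith) k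
  rw [div_lt_iff₀ hq] at hb
  filter_upwards [(tendsto_add_atTop_nat k).eventually (hf' _ hb)] with n hn
  rw [iteratedDeriv_iteratedDeriv]
  rwa [pow_add, mul_div_mul_right _ _ hq.ne'] at hn

variable (𝕜) in
/-- The space of test functions: smooth `f : ℝ → 𝕜` with `‖f‖_{p,M} < ∞` and
`limsup_n (1-p)^n log ‖f^{(n)}‖_∞ ≤ θ`. -/
def testSubmodule (p θ : ℝ) (M : ℕ → ℝ) [hp : Fact (p ∈ Set.Ioo (0 : ℝ) 1)] :
    Submodule 𝕜 (ℝ → 𝕜) where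
  carrier := {f | ContDiff ℝ (⊤ : ℕ∞) f ∧ carlemanNorm p M f < ⊤ ∧ IsTame p θ f}
  zero_mem' := by
    have h0 : ∀ k, _root_.iteratedDeriv k (0 : ℝ → 𝕜) = 0 := fun k => by
      funext x
      exact iteratedDeriv_const_zero
    refine ⟨contDiff_const, ?_, ?_⟩
    · simp [carlemanNorm, h0]
    · rw [isTame_iff hp.out.2]
      intro b _
      simp [h0]
  add_mem' := by
    rintro f g ⟨hf, hf1, hf2⟩ ⟨hg, hg1, hg2⟩
    refine ⟨hf.add hg, ?_, hf2.add hp.out.1 hp.out.2 hf hg hg2⟩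
    have h := carlemanNorm_rpow_add_le hp.out.1 hp.out.2 M hf hg
    refine (ENNReal.rpow_lt_top_iff_of_pos hp.out.1).1 (h.trans_lt ?_)
    exact ENNReal.add_lt_top.2 ⟨ENNReal.rpow_lt_top_of_nonneg hp.out.1.le hf1.ne,
      ENNReal.rpow_lt_top_of_nonneg hp.out.1.le hg1.ne⟩
  smul_mem' := by
    rintro c f ⟨hf, hf1, hf2⟩
    refine ⟨contDiff_const.smul hf, ?_, hf2.smul hp.out.1 hp.out.2 c⟩
    rw [carlemanNorm_smul]
    exact ENNReal.mul_lt_top (by simp) hf1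

end Quasinorm

/-! ### The space `L^p(ℝ)` for `0 < p < 1` -/

section Spaces

variable (𝕜 : Type*) [RCLike 𝕜] (p : ℝ) [hp : Fact (p ∈ Set.Ioo (0 : ℝ) 1)]

/-- The space `L^p(ℝ)` of a.e.-classes of `𝕜`-valued functions, as a type of its own; it is
metrized by `d(f, g) = ‖f - g‖_p ^ p` below. -/
def LpR : Type _ := Lp 𝕜 (ENNReal.ofReal p) (volume : Measure ℝ)

noncomputable instance : AddCommGroup (LpR 𝕜 p) :=
  inferInstanceAs (AddCommGroup (Lp 𝕜 (ENNReal.ofReal p) (volume : Measure ℝ)))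

noncomputable instance : Module 𝕜 (LpR 𝕜 p) :=
  inferInstanceAs (Module 𝕜 (Lp 𝕜 (ENNReal.ofReal p) (volume : Measure ℝ)))

/-- A representative of an element of `L^p(ℝ)`. -/
noncomputable def LpR.rep {𝕜 : Type*} [RCLike 𝕜] {p : ℝ} (f : LpR 𝕜 p) : ℝ → 𝕜 :=
  (show Lp 𝕜 (ENNReal.ofReal p) (volume : Measure ℝ) from f)

/-- The `p`-th power `‖f‖_p ^ p` of the `L^p` quasinorm. It is subadditive because `p < 1`, so
it defines a translation invariant metric giving the usual topology of `L^p(ℝ)`. -/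
noncomputable def LpR.groupNorm : AddGroupNorm (LpR 𝕜 p) where
  toFun f := (eLpNorm f.rep (ENNReal.ofReal p) volume).toReal ^ p
  map_zero' := by
    have : eLpNorm (LpR.rep (0 : LpR 𝕜 p)) (ENNReal.ofReal p) volume = 0 := by
      exact (eLpNorm_congr_ae (Lp.coeFn_zero 𝕜 (ENNReal.ofReal p) (volume : Measure ℝ))).trans
        eLpNorm_zero
    rw [this]
    simp [hp.out.1.ne']
  add_le' f g := by
    have hf : eLpNorm f.rep (ENNReal.ofReal p) volume ≠ ⊤ := Lp.eLpNorm_ne_top _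
    have hg : eLpNorm g.rep (ENNReal.ofReal p) volume ≠ ⊤ := Lp.eLpNorm_ne_top _
    have h : eLpNorm (LpR.rep (f + g)) (ENNReal.ofReal p) volume ^ p ≤ _ :=
      (eLpNorm_congr_ae (Lp.coeFn_add _ _)).trans_le le_rfl |> fun h =>
        (ENNReal.rpow_le_rpow h hp.out.1.le).trans
          (eLpNorm_rpow_add_le hp.out.1 hp.out.2 (Lp.aestronglyMeasurable _))
    simp only [ENNReal.toReal_rpow]
    refine (ENNReal.toReal_mono ?_ h).trans_eq (ENNReal.toReal_add ?_ ?_)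
    · exact ENNReal.add_ne_top.2 ⟨ENNReal.rpow_ne_top_of_nonneg hp.out.1.le hf,
        ENNReal.rpow_ne_top_of_nonneg hp.out.1.le hg⟩
    · exact ENNReal.rpow_ne_top_of_nonneg hp.out.1.le hf
    · exact ENNReal.rpow_ne_top_of_nonneg hp.out.1.le hg
  neg' f := by
    have : eLpNorm (LpR.rep (-f)) (ENNReal.ofReal p) volume =
        eLpNorm f.rep (ENNReal.ofReal p) volume := by
      rw [← eLpNorm_neg]
      exact eLpNorm_congr_ae (by
        filter_upwards [Lp.coeFn_neg (show Lp 𝕜 (ENNReal.ofReal p) (volume : Measure ℝ) from f)]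
          with x hx
        change -((-(show Lp 𝕜 (ENNReal.ofReal p) (volume : Measure ℝ) from f) :
          Lp 𝕜 (ENNReal.ofReal p) (volume : Measure ℝ)) : ℝ → 𝕜) x = _
        rw [hx]
        simp [LpR.rep])
    rw [this]
  eq_zero_of_map_eq_zero' f h := by
    have hf : eLpNorm f.rep (ENNReal.ofReal p) volume ≠ ⊤ := Lp.eLpNorm_ne_top _
    have h0 := (Real.rpow_eq_zero ENNReal.toReal_nonneg hp.out.1.ne').1 h
    have h1 : eLpNorm f.rep (ENNReal.ofReal p) volume = 0 :=
      ((ENNReal.toReal_eq_zero_iff _).1 h0).resolve_right hf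
    exact (Lp.eq_zero_iff_ae_eq_zero).2
      ((eLpNorm_eq_zero_iff (Lp.aestronglyMeasurable _) (by simpa using hp.out.1)).1 h1)

noncomputable instance : NormedAddCommGroup (LpR 𝕜 p) :=
  (LpR.groupNorm 𝕜 p).toNormedAddCommGroup

variable (θ : ℝ) (M : ℕ → ℝ)

/-- The test functions as a type of its own, metrized by `d(f, g) = ‖f - g‖_{p,M} ^ p` below. -/
def TestSpace : Type _ := testSubmodule 𝕜 p θ M

noncomputable instance : AddCommGroup (TestSpace 𝕜 p θ M) :=
  inferInstanceAs (AddCommGroup (testSubmodule 𝕜 p θ M))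

noncomputable instance : Module 𝕜 (TestSpace 𝕜 p θ M) :=
  inferInstanceAs (Module 𝕜 (testSubmodule 𝕜 p θ M))

variable {𝕜 p θ M} in
/-- The function underlying a test function. -/
def TestSpace.fn (f : TestSpace 𝕜 p θ M) : ℝ → 𝕜 := f.1

/-- The `p`-th power `‖f‖_{p,M} ^ p` of the quasinorm on test functions. It is subadditive, so
it defines a translation invariant metric with the Cauchy sequences and the convergence
of the quasinorm. -/
noncomputable def TestSpace.groupNorm : AddGroupNorm (TestSpace 𝕜 p θ M) where
  toFun f := (carlemanNorm p M f.fn).toReal ^ p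
  map_zero' := by
    have h : carlemanNorm p M (0 : ℝ → 𝕜) = 0 := by
      have := carlemanNorm_smul (p := p) M (0 : 𝕜) (0 : ℝ → 𝕜)
      simpa using this
    change (carlemanNorm p M (0 : ℝ → 𝕜)).toReal ^ p = 0
    simp [h, hp.out.1.ne']
  add_le' f g := by
    have h := carlemanNorm_rpow_add_le hp.out.1 hp.out.2 M f.2.1 g.2.1
    have hf := ENNReal.rpow_ne_top_of_nonneg hp.out.1.le f.2.2.1.ne
    have hg := ENNReal.rpow_ne_top_of_nonneg hp.out.1.le g.2.2.1.ne
    simp only [ENNReal.toReal_rpow]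
    exact (ENNReal.toReal_mono (ENNReal.add_ne_top.2 ⟨hf, hg⟩) h).trans_eq
      (ENNReal.toReal_add hf hg)
  neg' f := by
    have h := carlemanNorm_smul (p := p) M (-1 : 𝕜) f.fn
    have h2 : TestSpace.fn (-f) = (-1 : 𝕜) • f.fn := by
      rw [neg_one_smul]
      rfl
    rw [h2, h]
    simp
  eq_zero_of_map_eq_zero' f h := by
    have h0 := (Real.rpow_eq_zero ENNReal.toReal_nonneg hp.out.1.ne').1 h
    have h1 : carlemanNorm p M f.fn = 0 :=
      ((ENNReal.toReal_eq_zero_iff _).1 h0).resolve_right f.2.2.1.ne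
    have h2 := eLpNorm_le_carlemanNorm (p := p) M f.fn 0 (by simp [h1])
    rw [h1, mul_zero, nonpos_iff_eq_zero, iteratedDeriv_zero] at h2
    have h3 := (eLpNorm_eq_zero_iff (f := f.fn) f.2.1.continuous.aestronglyMeasurable
      (by simpa using hp.out.1)).1 h2
    exact Subtype.ext (Continuous.ae_eq_iff_eq volume f.2.1.continuous continuous_const |>.1 h3)

noncomputable instance : NormedAddCommGroup (TestSpace 𝕜 p θ M) :=
  (TestSpace.groupNorm 𝕜 p θ M).toNormedAddCommGroup

theorem TestSpace.norm_def (f : TestSpace 𝕜 p θ M) :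
    ‖f‖ = (carlemanNorm p M f.fn).toReal ^ p := rfl

theorem LpR.norm_def (f : LpR 𝕜 p) :
    ‖f‖ = (eLpNorm f.rep (ENNReal.ofReal p) volume).toReal ^ p := rfl

instance : UniformContinuousConstSMul 𝕜 (TestSpace 𝕜 p θ M) where
  uniformContinuous_const_smul c := by
    refine (LipschitzWith.of_dist_le_mul (K := ‖c‖₊ ^ p) fun f g => ?_).uniformContinuous
    rw [dist_eq_norm, dist_eq_norm, ← smul_sub, TestSpace.norm_def, TestSpace.norm_def]
    have h : carlemanNorm p M (TestSpace.fn (c • (f - g))) =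
      ‖c‖ₑ * carlemanNorm p M (TestSpace.fn (f - g)) := carlemanNorm_smul M c _
    rw [h, ENNReal.toReal_mul, Real.mul_rpow ENNReal.toReal_nonneg ENNReal.toReal_nonneg]
    simp

/-- `L^p(ℝ)` is complete. -/
instance : CompleteSpace (LpR 𝕜 p) := by
  have hp0 := hp.out.1
  refine NormedAddCommGroup.completeSpace_of_summable_imp_tendsto fun u hu => ?_
  have hm : ∀ i, AEStronglyMeasurable (u i).rep volume := fun i => Lp.aestronglyMeasurable _
  have hnorm : ∀ f : LpR 𝕜 p, ∫⁻ x, ‖f.rep x‖ₑ ^ p = ENNReal.ofReal ‖f‖ := by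
    intro f
    have hf : eLpNorm f.rep (ENNReal.ofReal p) volume ≠ ⊤ := Lp.eLpNorm_ne_top _
    rw [LpR.norm_def, ENNReal.toReal_rpow, ENNReal.ofReal_toReal
      (ENNReal.rpow_ne_top_of_nonneg hp0.le hf), eLpNorm_rpow_eq hp0]
  have hfin : ∑' i, ENNReal.ofReal ‖u i‖ ≠ ⊤ := by
    rw [← ENNReal.ofReal_tsum_of_nonneg (fun i => norm_nonneg _) hu]
    exact ENNReal.ofReal_ne_top
  have hint : ∀ n, ∫⁻ x, ∑' i, ‖(u (i + n)).rep x‖ₑ ^ p = ∑' i, ENNReal.ofReal ‖u (i + n)‖ := by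
    intro n
    rw [lintegral_tsum fun i => (hm _).enorm.pow_const p]
    exact tsum_congr fun i => hnorm _
  have hae : ∀ᵐ x, Summable fun i => (u i).rep x := by
    have h0 := hint 0
    simp only [add_zero] at h0
    have := ae_lt_top' (AEMeasurable.tsum fun i => (hm i).enorm.pow_const p)
      (h0.trans_ne hfin)
    filter_upwards [this] with x hx
    refine Summable.of_norm (tsum_enorm_ne_top_iff_summable_norm.1 fun h => ?_)
    have h2 := tsum_rpow_le hp0 hp.out.2 fun i => ‖(u i).rep x‖ₑ
    rw [h, ENNReal.top_rpow_of_pos hp0] at h2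
    exact absurd hx (not_lt.2 h2)
  set F : ℝ → 𝕜 := fun x => ∑' i, (u i).rep x with hF
  have hsum : ∀ n, (fun x => ∑ i ∈ Finset.range n, (u i).rep x) =ᵐ[volume]
      (∑ i ∈ Finset.range n, u i : LpR 𝕜 p).rep := by
    intro n
    induction n with
    | zero =>
      simp only [Finset.range_zero, Finset.sum_empty]
      exact (Lp.coeFn_zero 𝕜 (ENNReal.ofReal p) (volume : Measure ℝ)).symm
    | succ n ih =>
      have h : (∑ i ∈ Finset.range n, u i + u n : LpR 𝕜 p).rep =ᵐ[volume]
          (∑ i ∈ Finset.range n, u i : LpR 𝕜 p).rep + (u n).rep := Lp.coeFn_add _ _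
      simp only [Finset.sum_range_succ]
      filter_upwards [ih, h] with x h1 h2
      rw [h2, Pi.add_apply, ← h1]
  have hFm : AEStronglyMeasurable F volume := by
    refine aestronglyMeasurable_of_tendsto_ae atTop
      (f := fun n x => ∑ i ∈ Finset.range n, (u i).rep x)
      (fun n => ((Lp.aestronglyMeasurable _).congr (hsum n).symm)) ?_
    filter_upwards [hae] with x hx
    exact hx.hasSum.tendsto_sum_nat
  have hbound : ∀ n, ∫⁻ x, ‖F x - (∑ i ∈ Finset.range n, u i : LpR 𝕜 p).rep x‖ₑ ^ p ≤
      ∑' i, ENNReal.ofReal ‖u (i + n)‖ := by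
    intro n
    rw [← hint n]
    refine lintegral_mono_ae ?_
    filter_upwards [hae, hsum n] with x hx hs
    have hFx : F x - ∑ i ∈ Finset.range n, (u i).rep x = ∑' i, (u (i + n)).rep x :=
      sub_eq_of_eq_add' (hx.sum_add_tsum_nat_add n).symm
    rw [← hs, hFx]
    exact (ENNReal.rpow_le_rpow enorm_tsum_le_tsum_enorm hp0.le).trans
      (tsum_rpow_le hp0 hp.out.2 _)
  have hFL : MemLp F (ENNReal.ofReal p) volume := by
    refine ⟨hFm, (ENNReal.rpow_lt_top_iff_of_pos hp0).1 ?_⟩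
    rw [eLpNorm_rpow_eq hp0]
    have h0 := hbound 0
    have hz : (∑ i ∈ Finset.range 0, u i : LpR 𝕜 p).rep =ᵐ[volume] 0 :=
      Lp.coeFn_zero 𝕜 (ENNReal.ofReal p) (volume : Measure ℝ)
    refine lt_of_le_of_lt (le_trans (lintegral_mono_ae ?_) h0) ?_
    · filter_upwards [hz] with x hx
      rw [hx, Pi.zero_apply, sub_zero]
    · simpa using hfin.lt_top
  let G : LpR 𝕜 p := hFL.toLp F
  have hG : G.rep =ᵐ[volume] F := MemLp.coeFn_toLp hFL
  refine ⟨G, tendsto_iff_norm_sub_tendsto_zero.2 ?_⟩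
  have hlim := ENNReal.tendsto_sum_nat_add (fun i => ENNReal.ofReal ‖u i‖) hfin
  have hle : ∀ n, ENNReal.ofReal ‖∑ i ∈ Finset.range n, u i - G‖ ≤
      ∑' i, ENNReal.ofReal ‖u (i + n)‖ := by
    intro n
    rw [norm_sub_rev, ← hnorm]
    refine (lintegral_congr_ae ?_).trans_le (hbound n)
    have h : (G - ∑ i ∈ Finset.range n, u i : LpR 𝕜 p).rep =ᵐ[volume]
      G.rep - (∑ i ∈ Finset.range n, u i : LpR 𝕜 p).rep := Lp.coeFn_sub _ _
    filter_upwards [h, hG] with x h1 h2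
    rw [h1, Pi.sub_apply, h2]
  have h3 := tendsto_of_tendsto_of_tendsto_of_le_of_le tendsto_const_nhds hlim
    (fun _ => zero_le) hle
  have h4 := (ENNReal.tendsto_toReal ENNReal.zero_ne_top).comp h3
  simpa [Function.comp_def] using h4

/-- The `L^p`-Carleman space `W^{p,θ}_M`: the completion of the test functions with respect
to the quasinorm `‖·‖_{p,M}`. -/
abbrev CarlemanSpace : Type _ := UniformSpace.Completion (TestSpace 𝕜 p θ M)

variable {𝕜 p θ M}

theorem TestSpace.memLp (f : TestSpace 𝕜 p θ M) (n : ℕ) :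
    MemLp (iteratedDeriv n f.fn) (ENNReal.ofReal p) volume :=
  ⟨(continuous_iteratedDeriv_of_smooth f.2.1 n).aestronglyMeasurable,
    (eLpNorm_le_carlemanNorm M f.fn n f.2.2.1.ne).trans_lt
      (ENNReal.mul_lt_top ENNReal.ofReal_lt_top f.2.2.1)⟩

/-- `f ↦ f^{(n)}`, from test functions to `L^p(ℝ)`. -/
noncomputable def TestSpace.toLpR (n : ℕ) (f : TestSpace 𝕜 p θ M) : LpR 𝕜 p :=
  (f.memLp n).toLp (iteratedDeriv n f.fn)

/-- `f ↦ f^{(k)}`, as a test function for the sequence shifted by `k` and the parameter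
`θ / (1-p)^k`. -/
noncomputable def TestSpace.derivIter (k : ℕ) (f : TestSpace 𝕜 p θ M) :
    TestSpace 𝕜 p (θ / (1 - p) ^ k) (shift k M) :=
  ⟨iteratedDeriv k f.fn, contDiff_iteratedDeriv_of_smooth f.2.1 k,
    (carlemanNorm_iteratedDeriv_le M f.fn k).trans_lt f.2.2.1, f.2.2.2.iteratedDeriv hp.out.2 k⟩

/-- `f ↦ f'`, as a test function for the shifted sequence and the parameter `θ / (1-p)`. -/
noncomputable def TestSpace.deriv (f : TestSpace 𝕜 p θ M) :
    TestSpace 𝕜 p (θ / (1 - p)) (shift 1 M) :=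
  ⟨_root_.deriv f.fn, by
    have h := (f.derivIter 1).2
    simp only [TestSpace.derivIter, iteratedDeriv_one, pow_one] at h
    exact h⟩

theorem TestSpace.fn_sub (f g : TestSpace 𝕜 p θ M) : (f - g).fn = f.fn - g.fn := rfl

theorem iteratedDeriv_sub_fn (f g : TestSpace 𝕜 p θ M) (n : ℕ) :
    iteratedDeriv n (f - g).fn = iteratedDeriv n f.fn - iteratedDeriv n g.fn := by
  funext x
  exact iteratedDeriv_sub (f.2.1.contDiffAt.of_le (by exact_mod_cast le_top))
    (g.2.1.contDiffAt.of_le (by exact_mod_cast le_top))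

theorem TestSpace.uniformContinuous_toLpR (n : ℕ) :
    UniformContinuous (TestSpace.toLpR n : TestSpace 𝕜 p θ M → LpR 𝕜 p) := by
  refine (LipschitzWith.of_dist_le_mul
    (K := (ENNReal.ofReal (M n)).toNNReal ^ p) fun f g => ?_).uniformContinuous
  have h1 : TestSpace.toLpR n f - TestSpace.toLpR n g = TestSpace.toLpR n (f - g) := by
    have : ∀ (u v w : ℝ → 𝕜) (hu : MemLp u (ENNReal.ofReal p) volume)
        (hv : MemLp v (ENNReal.ofReal p) volume) (hw : MemLp w (ENNReal.ofReal p) volume),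
        w = u - v → hu.toLp u - hv.toLp v = hw.toLp w := by
      rintro u v w hu hv hw rfl
      exact (MemLp.toLp_sub hu hv).symm
    exact this _ _ _ _ _ _ (iteratedDeriv_sub_fn f g n)
  rw [dist_eq_norm, dist_eq_norm, h1, LpR.norm_def, TestSpace.norm_def]
  have h2 : eLpNorm (TestSpace.toLpR n (f - g)).rep (ENNReal.ofReal p) volume =
      eLpNorm (iteratedDeriv n (f - g).fn) (ENNReal.ofReal p) volume :=
    eLpNorm_congr_ae (MemLp.coeFn_toLp _)
  rw [h2, NNReal.coe_rpow, ← Real.mul_rpow (NNReal.coe_nonneg _) ENNReal.toReal_nonneg]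
  refine Real.rpow_le_rpow ENNReal.toReal_nonneg ?_ hp.out.1.le
  refine (ENNReal.toReal_mono (ENNReal.mul_ne_top ENNReal.ofReal_ne_top (f - g).2.2.1.ne)
    (eLpNorm_le_carlemanNorm M (f - g).fn n (f - g).2.2.1.ne)).trans_eq ?_
  rw [ENNReal.toReal_mul]
  rfl

theorem TestSpace.uniformContinuous_derivIter (k : ℕ) : UniformContinuous
    (TestSpace.derivIter k : TestSpace 𝕜 p θ M → TestSpace 𝕜 p (θ / (1 - p) ^ k) (shift k M)) := by
  refine (LipschitzWith.of_dist_le_mul (K := 1) fun f g => ?_).uniformContinuous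
  have h1 : (TestSpace.derivIter k f - TestSpace.derivIter k g).fn =
      iteratedDeriv k (f - g).fn := (iteratedDeriv_sub_fn f g k).symm
  rw [dist_eq_norm, dist_eq_norm, TestSpace.norm_def, TestSpace.norm_def, h1, NNReal.coe_one,
    one_mul]
  exact Real.rpow_le_rpow ENNReal.toReal_nonneg (ENNReal.toReal_mono (f - g).2.2.1.ne
    (carlemanNorm_iteratedDeriv_le M _ k)) hp.out.1.le

theorem TestSpace.uniformContinuous_deriv : UniformContinuous
    (TestSpace.deriv : TestSpace 𝕜 p θ M → TestSpace 𝕜 p (θ / (1 - p)) (shift 1 M)) := by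
  refine (LipschitzWith.of_dist_le_mul (K := 1) fun f g => ?_).uniformContinuous
  have h1 : (TestSpace.deriv f - TestSpace.deriv g).fn =
      iteratedDeriv 1 (f - g).fn := by
    rw [iteratedDeriv_sub_fn, iteratedDeriv_one, iteratedDeriv_one]
    rfl
  rw [dist_eq_norm, dist_eq_norm, TestSpace.norm_def, TestSpace.norm_def, h1, NNReal.coe_one,
    one_mul]
  exact Real.rpow_le_rpow ENNReal.toReal_nonneg (ENNReal.toReal_mono (f - g).2.2.1.ne
    (carlemanNorm_iteratedDeriv_le M _ 1)) hp.out.1.le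

variable (𝕜 p θ M)

/-- The `n`-th component `π_n : W^{p,θ}_M → L^p(ℝ)` of the canonical map
`π f = (f, f', f'', …)`, extended by continuity from the test functions. -/
noncomputable def piMap (n : ℕ) : CarlemanSpace 𝕜 p θ M → LpR 𝕜 p :=
  UniformSpace.Completion.extension (TestSpace.toLpR n)

/-- The derivation `δ : W^{p,θ}_M → W^{p,θ/(1-p)}_{M_1}`, extended by continuity from the test
functions. -/
noncomputable def deltaMap :
    CarlemanSpace 𝕜 p θ M → CarlemanSpace 𝕜 p (θ / (1 - p)) (shift 1 M) :=
  UniformSpace.Completion.map TestSpace.deriv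

/-- The `k`-fold derivation `W^{p,θ}_M → W^{p,θ/(1-p)^k}_{M_k}`, extended by continuity from the
test functions. -/
noncomputable def deltaIterMap (k : ℕ) :
    CarlemanSpace 𝕜 p θ M → CarlemanSpace 𝕜 p (θ / (1 - p) ^ k) (shift k M) :=
  UniformSpace.Completion.map (TestSpace.derivIter k)

variable {𝕜 p θ M}

theorem piMap_coe (n : ℕ) (f : TestSpace 𝕜 p θ M) : piMap 𝕜 p θ M n f = f.toLpR n :=
  UniformSpace.Completion.extension_coe (TestSpace.uniformContinuous_toLpR n) f

theorem deltaMap_coe (f : TestSpace 𝕜 p θ M) :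
    deltaMap 𝕜 p θ M f = (f.deriv : CarlemanSpace 𝕜 p (θ / (1 - p)) (shift 1 M)) :=
  UniformSpace.Completion.map_coe TestSpace.uniformContinuous_deriv f

theorem deltaIterMap_coe (k : ℕ) (f : TestSpace 𝕜 p θ M) :
    deltaIterMap 𝕜 p θ M k f =
      (f.derivIter k : CarlemanSpace 𝕜 p (θ / (1 - p) ^ k) (shift k M)) :=
  UniformSpace.Completion.map_coe (TestSpace.uniformContinuous_derivIter k) f

end Spaces

end LpCarleman

/-! The quasinorm of $f$ is the larger of $\|f\|_p/M_0$ and $\|f'\|_{p,\mathcal M_1}$, so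
$f\mapsto(f,f')$ is bounded below on test functions. Its extension to the completion is therefore an
isomorphism once its range is dense (`exists_completion_equiv`). By linearity, density splits into
two approximations with $W=\mathcal M_1$: a test function $g$ is nearly the derivative of a function
small in $L^p$ (`exists_small_primitive`), and an element of $L^p$ is nearly a smooth function whose
derivative is small in the quasinorm (`exists_smooth_approx`). Repeating the step along the shifted
sequences, which stay regular, gives the $k$-fold statement.

Both approximations use one device. Cut the line into short intervals $[a,b]$ and place on each the
multiple $G(b)-G(a)$ of a kernel of integral one. The sum $e$ has a primitive that follows the
continuous function $G$. If the kernel $\Phi$ for intervals of length $2^{-i-1}$ satisfies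
$\int|\Phi^{(n)}|^p\le 2^{-i}W_n^p$ for every $n$, an interval on which $G$ oscillates by $c$ costs
$2^{-i}c^p$, and a unit cell costs $2c^p$. This tends to zero as the mesh is refined.

Such kernels exist because the characteristic is infinite (`exists_kernel`). They are iterated box
averages of widths $e^{-\beta_0},\dots,e^{-\beta_\nu}$ applied to a bump $\psi$. A derivative taken
on a box of width $a$ multiplies $\int|\cdot|^p$ by $2a^{-p}$, and the requirement becomes a
recursion for $\beta$. If $\beta_n$ never fell below the slope of $\log W$, the recursion would
bound $\sum(1-p)^j\log W_j$ from above (`exists_profile`). From the first index $\nu$ where it does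
fall below, $\psi$ can absorb all further derivatives. The growth $n\log n\le\delta\log M_n$ makes
room for a compactly supported $\psi$ of Gevrey type.

The remaining difficulty is to keep $e$ tame with the same $\theta$ on infinitely many cells. There
the scale is adapted to $g$ by bisection. If the patch on an interval can be charged to the local
norms of the derivatives of $g$, stop; the charges are summable over the line. Otherwise $\int|g|$
is so large that the derivatives of $g$ on the interval obey the same recursion from below, and they
dominate those of the kernel up to $e^{E(n+1)^2}$ (`exists_kernel_comparison`). This loss is
negligible against $e^{b(1-p)^{-n}}$, so the next bisection preserves tameness. Finitely many cells
carry all but a small part of the charge, and they may use any scale. -/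

namespace LpCarleman

/-! ### Weight sequences for which functions and derivatives disconnect -/

/-- The increments of `log W`. -/
noncomputable def logSlope (W : ℕ → ℝ) (n : ℕ) : ℝ := Real.log (W (n + 1)) - Real.log (W n)

/-- The consequences of `p`-regularity of `M` for the shifted sequence `W = shift 1 M`. -/
structure IsDisconnecting (p : ℝ) (W : ℕ → ℝ) : Prop where
  pos : ∀ n, 0 < W n
  convex : Monotone (logSlope W)
  growth : ∃ s : ℝ, 1 < s ∧ ∀ᶠ n : ℕ in atTop, s * Real.log (n + 1) ≤ logSlope W n
  diverges : ∀ C : ℝ, ∃ n : ℕ, C ≤ ∑ j ∈ Finset.range n, (1 - p) ^ j * Real.log (W j)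

/-! ### Consequences of regularity, and its stability under shifts. -/

section Regular

variable {p : ℝ} {M : ℕ → ℝ}

theorem LogConvexSeq.monotone_logSlope (h : LogConvexSeq M) : Monotone (logSlope M) := by
  refine monotone_nat_of_le_succ fun n => ?_
  have := h.2 n
  unfold logSlope
  linarith

theorem LogConvexSeq.shift (h : LogConvexSeq M) (k : ℕ) : LogConvexSeq (shift k M) := by
  refine ⟨fun n => h.1 _, fun n => ?_⟩
  have := h.2 (n + k)
  simp only [LpCarleman.shift]
  rw [show n + 1 + k = n + k + 1 by ring, show n + 2 + k = n + k + 2 by ring]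
  exact this

theorem shift_shift (k l : ℕ) (M : ℕ → ℝ) : shift k (shift l M) = shift (k + l) M := by
  funext n
  simp [shift, add_assoc]

theorem shift_zero (M : ℕ → ℝ) : shift 0 M = M := rfl

theorem exists_le_of_pCharacteristic_eq_top (h : pCharacteristic p M = ⊤) (C : ℝ) (N : ℕ) :
    ∃ n, N ≤ n ∧ C ≤ ∑ j ∈ Finset.Icc 1 n, (1 - p) ^ j * Real.log (M j) := by
  have h1 : ((C : ℝ) : EReal) < limsup (fun n : ℕ =>
      ((∑ j ∈ Finset.Icc 1 n, (1 - p) ^ j * Real.log (M j) : ℝ) : EReal)) atTop := by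
    change (C : EReal) < pCharacteristic p M
    rw [h]
    exact EReal.coe_lt_top C
  have h2 := frequently_lt_of_lt_limsup (by isBoundedDefault) h1
  obtain ⟨n, hn, hn'⟩ := (h2.and_eventually (eventually_ge_atTop N)).exists
  exact ⟨n, hn', (EReal.coe_lt_coe_iff.1 hn).le⟩

theorem sum_Icc_eq_shift (p : ℝ) (M : ℕ → ℝ) (n : ℕ) :
    ∑ j ∈ Finset.Icc 1 n, (1 - p) ^ j * Real.log (M j) =
      (1 - p) * ∑ j ∈ Finset.range n, (1 - p) ^ j * Real.log (shift 1 M j) := by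
  induction n with
  | zero => simp
  | succ n ih =>
    rw [Finset.sum_Icc_succ_top (by omega), ih, Finset.sum_range_succ, pow_succ]
    simp only [shift]
    ring

theorem liminf_pos_iff (p : ℝ) (M : ℕ → ℝ) :
    0 < liminf (fun n : ℕ => (((1 - p) ^ n * Real.log (M n) : ℝ) : EReal)) atTop ↔
      ∃ c : ℝ, 0 < c ∧ ∀ᶠ n : ℕ in atTop, c ≤ (1 - p) ^ n * Real.log (M n) := by
  constructor
  · intro h
    obtain ⟨c, hc0, hc⟩ := EReal.lt_iff_exists_real_btwn.1 h
    refine ⟨c, by exact_mod_cast hc0, ?_⟩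
    filter_upwards [eventually_lt_of_lt_liminf hc] with n hn
    exact (EReal.coe_lt_coe_iff.1 hn).le
  · rintro ⟨c, hc0, hc⟩
    refine lt_of_lt_of_le (b := (c : EReal)) (by exact_mod_cast hc0) ?_
    refine le_liminf_of_le (by isBoundedDefault) ?_
    filter_upwards [hc] with n hn
    exact_mod_cast hn

/-- Re-indexing divides the weighted sums by $1-p$ and removes the single term $\log M_1$, so
divergence survives. The growth alternatives move in the favourable direction:
$(1-p)^{n+1}\le(1-p)^n$ and $n\log n\le(n+1)\log(n+1)$. -/
theorem IsPRegular.shift_one (hp : 0 < p) (hp1 : p < 1) (h : IsPRegular p M) :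
    IsPRegular p (shift 1 M) := by
  have hq : 0 < 1 - p := by linarith
  refine ⟨h.logConvex.shift 1, ?_, ?_⟩
  · refine (EReal.eq_top_iff_forall_lt _).2 fun C => ?_
    have hL : ∀ n, ∑ j ∈ Finset.Icc 1 n, (1 - p) ^ j * Real.log (shift 1 M j) =
        (1 - p)⁻¹ * ∑ j ∈ Finset.Icc 1 (n + 1), (1 - p) ^ j * Real.log (M j) -
          Real.log (M 1) := by
      intro n
      rw [sum_Icc_eq_shift p M, Finset.sum_range_succ', inv_mul_cancel_left₀ hq.ne',
        sum_Icc_eq_shift, Finset.mul_sum]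
      simp only [shift, pow_zero, one_mul, zero_add, add_sub_cancel_right]
      refine Finset.sum_congr rfl fun j _ => ?_
      ring
    refine lt_of_lt_of_le (b := ((C + 1 : ℝ) : EReal)) (by exact_mod_cast lt_add_one C) ?_
    refine le_limsup_of_frequently_le ?_ (by isBoundedDefault)
    rw [frequently_atTop]
    intro N
    obtain ⟨n, hn, hC⟩ := exists_le_of_pCharacteristic_eq_top h.infinite_characteristic
      ((1 - p) * (C + 1 + Real.log (M 1))) (N + 1)
    obtain ⟨k, rfl⟩ : ∃ k, n = k + 1 := ⟨n - 1, by omega⟩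
    refine ⟨k, by omega, ?_⟩
    rw [EReal.coe_le_coe_iff, hL, le_sub_iff_add_le, inv_mul_eq_div, le_div_iff₀ hq, mul_comm]
    exact hC
  · rcases h.growth with h1 | ⟨h1, δ, hδ, r, hr, h2⟩
    · left
      rw [liminf_pos_iff] at h1 ⊢
      obtain ⟨c, hc, h1⟩ := h1
      refine ⟨c, hc, ?_⟩
      filter_upwards [(tendsto_add_atTop_nat 1).eventually h1] with n hn
      have h3 : (1 - p) ^ (n + 1) * Real.log (M (n + 1)) =
          (1 - p) * ((1 - p) ^ n * Real.log (M (n + 1))) := by ring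
      rw [h3] at hn
      have h4 : 0 ≤ (1 - p) ^ n * Real.log (M (n + 1)) := by
        by_contra hneg
        push Not at hneg
        nlinarith
      simp only [shift]
      nlinarith
    · right
      refine ⟨?_, δ, hδ, fun n => r (n + 1), (tendsto_add_atTop_iff_nat 1).2 hr, ?_⟩
      · have h3 := h1.comp_tendsto (tendsto_add_atTop_nat 1)
        refine (h3.trans_isBigO ?_)
        refine Asymptotics.IsBigO.of_bound ((1 - p)⁻¹) (Eventually.of_forall fun n => ?_)
        simp only [Function.comp, pow_succ, mul_inv, norm_mul, norm_inv]
        rw [Real.norm_of_nonneg hq.le]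
        linarith
      · filter_upwards [(tendsto_add_atTop_nat 1).eventually h2] with n hn
        refine le_trans ?_ hn
        rcases Nat.eq_zero_or_pos n with rfl | hn0
        · simp
        have h0 : (1 : ℝ) ≤ n := by exact_mod_cast hn0
        have h4 : Real.log n ≤ Real.log ((n + 1 : ℕ) : ℝ) :=
          Real.log_le_log (by linarith) (by push_cast; linarith)
        have h5 := Real.log_nonneg h0
        push_cast at h4 ⊢
        nlinarith

theorem IsPRegular.shift_iterate (hp : 0 < p) (hp1 : p < 1) (h : IsPRegular p M) (k : ℕ) :
    IsPRegular p (shift k M) := by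
  induction k with
  | zero => exact h
  | succ k ih =>
    have := ih.shift_one hp hp1
    rwa [shift_shift, add_comm] at this

theorem log_le_of_logSlope_le {σ : ℝ} (h : ∀ n, logSlope M n ≤ σ) (n : ℕ) :
    Real.log (M n) ≤ Real.log (M 0) + n * σ := by
  induction n with
  | zero => simp
  | succ n ih =>
    have := h n
    unfold logSlope at this
    push_cast
    linarith

theorem le_log_of_le_logSlope {σ : ℝ} {k : ℕ} (h : ∀ n, k ≤ n → σ ≤ logSlope M n) (n : ℕ) :
    Real.log (M k) + n * σ ≤ Real.log (M (k + n)) := by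
  induction n with
  | zero => simp
  | succ n ih =>
    have := h (k + n) (by omega)
    unfold logSlope at this
    push_cast
    rw [← add_assoc]
    linarith

/-- If no slope were positive, $\log M_n\le\log M_0$ and the geometric series would bound the
characteristic. One positive slope persists by convexity and forces linear growth. -/
theorem IsPRegular.tendsto_log (hp : 0 < p) (hp1 : p < 1) (h : IsPRegular p M) :
    Tendsto (fun n => Real.log (M n)) atTop atTop := by
  have hq : 0 < 1 - p := by linarith
  obtain ⟨k, hk⟩ : ∃ k, 0 < logSlope M k := by
    by_contra hcon
    push Not at hcon
    have h1 := log_le_of_logSlope_le hcon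
    obtain ⟨n, -, hn⟩ := exists_le_of_pCharacteristic_eq_top h.infinite_characteristic
      (|Real.log (M 0)| * (1 / p) + 1) 0
    have h2 : ∑ j ∈ Finset.Icc 1 n, (1 - p) ^ j * Real.log (M j) ≤
        ∑ j ∈ Finset.range (n + 1), (1 - p) ^ j * |Real.log (M 0)| := by
      refine (Finset.sum_le_sum (g := fun j => (1 - p) ^ j * |Real.log (M 0)|) fun j _ => ?_).trans
        (Finset.sum_le_sum_of_subset_of_nonneg ?_ fun j _ _ => by positivity)
      · have := (h1 j).trans_eq (by ring)
        have h3 := le_abs_self (Real.log (M 0))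
        gcongr
        linarith
      · intro j hj
        simp only [Finset.mem_Icc, Finset.mem_range] at *
        omega
    rw [← Finset.sum_mul, geom_sum_eq (by linarith)] at h2
    have h3 : ((1 - p) ^ (n + 1) - 1) / (1 - p - 1) ≤ 1 / p := by
      rw [show (1 - p - 1) = -p by ring, div_neg, ← neg_div]
      gcongr
      have := pow_pos hq (n + 1)
      linarith
    have := mul_le_mul_of_nonneg_right h3 (abs_nonneg (Real.log (M 0)))
    linarith
  have hmono := h.logConvex.monotone_logSlope
  rw [← tendsto_add_atTop_iff_nat k]
  refine tendsto_atTop_mono (fun n => ?_) (tendsto_atTop_add_const_left _ (Real.log (M k))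
    (tendsto_natCast_atTop_atTop.atTop_mul_const hk))
  rw [add_comm n k]
  exact le_log_of_le_logSlope (fun n hn => hmono hn) n

/-- This unifies the two alternatives of regularity. In the first, $\log M_n$ grows exponentially
and beats $n^2$. In the second, the $o(1)$ is absorbed by enlarging $\delta$, which is legitimate
because $\log M_n$ is eventually nonnegative. -/
theorem IsPRegular.exists_log_growth (hp : 0 < p) (hp1 : p < 1) (h : IsPRegular p M) :
    ∃ δ : ℝ, 0 < δ ∧ δ < 1 ∧ ∀ᶠ n : ℕ in atTop, (n : ℝ) * Real.log n ≤ δ * Real.log (M n) := by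
  have hq : 0 < 1 - p := by linarith
  rcases h.growth with h1 | ⟨h1, δ, hδ, r, hr, h2⟩
  · rw [liminf_pos_iff] at h1
    obtain ⟨c, hc, h1⟩ := h1
    refine ⟨1 / 2, by norm_num, by norm_num, ?_⟩
    have h3 : Tendsto (fun n : ℕ => (n : ℝ) ^ 2 * (1 - p) ^ n) atTop (𝓝 0) :=
      tendsto_pow_const_mul_const_pow_of_abs_lt_one 2 (by rw [abs_of_pos hq]; linarith)
    filter_upwards [h1, h3.eventually_lt_const (show (0 : ℝ) < c / 2 by positivity)] with n hn hn'
    have hqn := pow_pos hq n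
    have h4 : (n : ℝ) * Real.log n ≤ (n : ℝ) ^ 2 := by
      rw [sq]
      gcongr
      exact Real.log_le_self (Nat.cast_nonneg n)
    refine h4.trans ?_
    rw [← mul_le_mul_iff_left₀ hqn]
    nlinarith
  · have h3 : (max δ 0 : ℝ) < 1 := max_lt hδ one_pos
    refine ⟨(1 + max δ 0) / 2, by positivity, by linarith, ?_⟩
    filter_upwards [h2, (h.tendsto_log hp hp1).eventually_ge_atTop 0,
      hr.eventually_lt_const (show (0 : ℝ) < (1 - max δ 0) / 2 by linarith)] with n h4 h5 h6
    refine h4.trans (mul_le_mul_of_nonneg_right ?_ h5)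
    have := le_max_left δ 0
    linarith

/-- By convexity the last slope is at least the mean slope, and the mean slope is at least
$\delta^{-1}\log n-O(1)$. Any $s$ strictly between $1$ and $\delta^{-1}$ then works. -/
theorem IsPRegular.isDisconnecting_shift (hp : 0 < p) (hp1 : p < 1) (h : IsPRegular p M) :
    IsDisconnecting p (shift 1 M) := by
  have hq : 0 < 1 - p := by linarith
  have hS : ∀ n, logSlope (shift 1 M) n = logSlope M (n + 1) := fun n => rfl
  refine ⟨fun n => h.logConvex.1 _, ?_, ?_, ?_⟩
  · intro m n hmn
    rw [hS, hS]
    exact h.logConvex.monotone_logSlope (by omega)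
  · obtain ⟨δ, hδ0, hδ1, hg⟩ := h.exists_log_growth hp hp1
    obtain ⟨s, hs1, hs⟩ := exists_between ((one_lt_inv₀ hδ0).2 hδ1)
    refine ⟨s, hs1, ?_⟩
    have hmono := h.logConvex.monotone_logSlope
    have hlog : Tendsto (fun n : ℕ => (δ⁻¹ - s) * Real.log n) atTop atTop :=
      (Real.tendsto_log_atTop.comp tendsto_natCast_atTop_atTop).const_mul_atTop (by linarith)
    filter_upwards [hg, eventually_ge_atTop 1,
      hlog.eventually_ge_atTop (|Real.log (M 0)| + s * Real.log 2)] with n hn hn1 hn2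
    have hn0 : (1 : ℝ) ≤ n := by exact_mod_cast hn1
    have h1 : Real.log (M n) ≤ Real.log (M 0) + n * logSlope M n := by
      clear hg hn hn1 hn2 hn0 hlog
      have : ∀ k ≤ n, Real.log (M k) ≤ Real.log (M 0) + k * logSlope M n := by
        intro k
        induction k with
        | zero => simp
        | succ k ih =>
          intro hk
          have h2 := hmono (show k ≤ n by omega)
          have h3 := ih (by omega)
          unfold logSlope at h2 h3 ⊢
          push_cast
          linarith
      exact this n le_rfl
    have h2 : logSlope M n ≤ logSlope M (n + 1) := hmono (by omega)
    have h3 : Real.log ((n : ℝ) + 1) ≤ Real.log n + Real.log 2 := by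
      rw [← Real.log_mul (by linarith) (by norm_num)]
      exact Real.log_le_log (by linarith) (by linarith)
    have h4 : (n : ℝ) * (δ⁻¹ * Real.log n) ≤ n * (|Real.log (M 0)| + logSlope M n) := by
      have h5 : (n : ℝ) * (δ⁻¹ * Real.log n) = δ⁻¹ * (n * Real.log n) := by ring
      have h6 : δ⁻¹ * (n * Real.log n) ≤ Real.log (M n) := by
        rwa [inv_mul_le_iff₀ hδ0]
      have h7 := le_abs_self (Real.log (M 0))
      have h8 := abs_nonneg (Real.log (M 0))
      nlinarith
    have h5 := le_of_mul_le_mul_left h4 (by linarith)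
    rw [hS]
    nlinarith
  · intro C
    obtain ⟨n, -, hn⟩ := exists_le_of_pCharacteristic_eq_top h.infinite_characteristic
      ((1 - p) * C) 0
    rw [sum_Icc_eq_shift] at hn
    exact ⟨n, le_of_mul_le_mul_left hn hq⟩

end Regular


/-! ### The box widths, and where divergence of the characteristic enters. -/

section Profile

variable {p : ℝ} {W : ℕ → ℝ}

/-- The logarithms `β 0, …, β ν` of the inverse widths of the boxes used to build a kernel whose
derivatives satisfy `∫ |Φ^(n)|^p ≤ e^{-m} W_n^p`. -/
structure IsProfile (p : ℝ) (W : ℕ → ℝ) (C C' η K m : ℝ) (β : ℕ → ℝ) (ν : ℕ) : Prop where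
  rec_eq : ∀ n ≤ ν, (1 - p) * β n = p * ∑ i ∈ Finset.range n, β i + m + K +
    (p * C + Real.log 2) * n - p * Real.log (W n)
  step : ∀ n < ν, β n + Real.log 2 ≤ β (n + 1)
  final_le : β ν ≤ logSlope W ν - C
  base : m + C' ≤ β 0
  room : m + C' ≤ η * logSlope W ν

theorem IsDisconnecting.tendsto_logSlope (hW : IsDisconnecting p W) :
    Tendsto (logSlope W) atTop atTop := by
  obtain ⟨s, hs, h⟩ := hW.growth
  refine tendsto_atTop_mono' _ h ?_
  have : Tendsto (fun n : ℕ => Real.log ((n + 1 : ℕ) : ℝ)) atTop atTop :=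
    Real.tendsto_log_atTop.comp
      (tendsto_natCast_atTop_atTop.comp (tendsto_add_atTop_nat 1))
  push_cast at this
  exact this.const_mul_atTop (by linarith)

/-- The weights $(1-p)^n$ and $p(1-p)^l$, $l<n$, add up to one, so the left side is an average of
slopes. Slopes of index at least $l$ are at most the last one and carry weight $(1-p)^l<\eta/2$; the
earlier ones contribute a constant, which is absorbed because slopes tend to infinity. -/
theorem IsDisconnecting.eventually_weighted_sum_le (hW : IsDisconnecting p W) (hp : 0 < p)
    (hp1 : p < 1) {η : ℝ} (hη : 0 < η) :
    ∀ᶠ n : ℕ in atTop, (1 - p) ^ n * logSlope W n +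
      p * ∑ l ∈ Finset.range n, (1 - p) ^ l * logSlope W l ≤ η * logSlope W n := by
  have hq : 0 < 1 - p := by linarith
  obtain ⟨l, hl⟩ := exists_pow_lt_of_lt_one (half_pos hη) (show 1 - p < 1 by linarith)
  have key : ∀ n, l ≤ n → p * ∑ i ∈ Finset.range n, (1 - p) ^ i * logSlope W i ≤
      |logSlope W l| + ((1 - p) ^ l - (1 - p) ^ n) * logSlope W n := by
    intro n hn
    induction n, hn using Nat.le_induction with
    | base =>
      rw [sub_self, zero_mul, add_zero]
      have h1 : ∑ i ∈ Finset.range l, (1 - p) ^ i * logSlope W i ≤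
          ∑ i ∈ Finset.range l, (1 - p) ^ i * |logSlope W l| := by
        refine Finset.sum_le_sum fun i hi => ?_
        have := hW.convex (Finset.mem_range.1 hi).le
        have h3 := le_abs_self (logSlope W l)
        gcongr
        linarith
      rw [← Finset.sum_mul, geom_sum_eq (by linarith)] at h1
      have h2 : p * (((1 - p) ^ l - 1) / (1 - p - 1) * |logSlope W l|) =
          (1 - (1 - p) ^ l) * |logSlope W l| := by
        rw [show (1 - p - 1) = -p by ring]
        field_simp
        ring
      have h3 := mul_le_mul_of_nonneg_left h1 hp.le
      have h4 := mul_nonneg (pow_pos hq l).le (abs_nonneg (logSlope W l))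
      linarith
    | succ n hn ih =>
      rw [Finset.sum_range_succ, mul_add]
      have h1 : logSlope W n ≤ logSlope W (n + 1) := hW.convex (by omega)
      have h2 : 0 ≤ (1 - p) ^ l - (1 - p) ^ (n + 1) :=
        sub_nonneg.2 (pow_le_pow_of_le_one hq.le (by linarith) (by omega))
      have h3 := mul_le_mul_of_nonneg_left h1 h2
      have h4 : p * ((1 - p) ^ n * logSlope W n) = ((1 - p) ^ n - (1 - p) ^ (n + 1)) *
        logSlope W n := by ring
      linarith
  filter_upwards [eventually_ge_atTop l,
    hW.tendsto_logSlope.eventually_ge_atTop (|logSlope W l| / (η / 2)),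
    hW.tendsto_logSlope.eventually_ge_atTop 0] with n hn h1 h2
  have h3 := key n hn
  rw [div_le_iff₀ (half_pos hη)] at h1
  nlinarith

/-- The recursion determines $\beta$. While $\beta_n$ exceeds the slope of $\log W$ minus $C$, the
next value is larger by at least $\log 2$, and $\nu$ is the first index where this fails. If it
never failed, $\beta$ would be nonnegative throughout and the summed recursion would contradict
divergence. -/
theorem IsDisconnecting.exists_profile (hW : IsDisconnecting p W) (hp : 0 < p) (hp1 : p < 1)
    {C η : ℝ} (hC : 0 ≤ C) (C' : ℝ) (hη : 0 < η) (n₀ : ℕ) :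
    ∃ K₀, ∀ K, K₀ ≤ K → ∀ m, 0 ≤ m → ∃ (β : ℕ → ℝ) (ν : ℕ), n₀ ≤ ν ∧
      IsProfile p W C C' η K m β ν := by
  have hq : 0 < 1 - p := by linarith
  have hlog2 : 0 < Real.log 2 := Real.log_pos (by norm_num)
  obtain ⟨n₁, hn₁⟩ := eventually_atTop.1 (hW.eventually_weighted_sum_le hp hp1 hη)
  set N := max n₀ n₁ with hN
  -- The first two summands give $\beta_0\ge m+C'$. The last pushes $\beta_0$ above every slope of
  -- index at most $N$, so that $\nu\ge N$.
  refine ⟨p * Real.log (W 0) + |C'| + (|logSlope W N| + 1), fun K hK m hm => ?_⟩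
  set κ := p * C + Real.log 2 with hκ
  have hκ0 : 0 < κ := by positivity
  -- This is the difference of the desired relation at $n+1$ and at $n$.
  let β : ℕ → ℝ := fun n => Nat.rec ((m + K - p * Real.log (W 0)) / (1 - p))
    (fun n b => b + (p * (b - logSlope W n) + κ) / (1 - p)) n
  have hβ0 : β 0 = (m + K - p * Real.log (W 0)) / (1 - p) := rfl
  have hβs : ∀ n, β (n + 1) = β n + (p * (β n - logSlope W n) + κ) / (1 - p) := fun n => rfl
  have hrec : ∀ n, (1 - p) * β n = p * ∑ i ∈ Finset.range n, β i + m + K +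
      κ * n - p * Real.log (W n) := by
    intro n
    induction n with
    | zero =>
      rw [hβ0, mul_div_cancel₀ _ hq.ne']
      simp
    | succ n ih =>
      rw [hβs, mul_add, mul_div_cancel₀ _ hq.ne', Finset.sum_range_succ, ih]
      simp only [logSlope]
      push_cast
      ring
  have hbase : m + (|C'| + (|logSlope W N| + 1)) ≤ β 0 := by
    rw [hβ0, le_div_iff₀ hq]
    have h1 := abs_nonneg C'
    have h2 := abs_nonneg (logSlope W N)
    nlinarith
  have hstep : ∀ n, logSlope W n - C < β n → β n + Real.log 2 ≤ β (n + 1) := by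
    intro n hn
    rw [hβs, add_le_add_iff_left, le_div_iff₀ hq]
    nlinarith
  have hex : ∃ n, β n ≤ logSlope W n - C := by
    by_contra hcon
    push Not at hcon
    have hnn : ∀ n, 0 ≤ β n := by
      intro n
      induction n with
      | zero =>
        have h1 := abs_nonneg C'
        have h2 := abs_nonneg (logSlope W N)
        linarith
      | succ n ih => linarith [hstep n (hcon n)]
    -- The factor $(1-p)^n$ turns the recursion into a telescoping one. The left side is
    -- nonnegative, the first two sums on the right converge, and the last one is unbounded above.
    have hsum : ∀ n, (1 - p) ^ n * ∑ i ∈ Finset.range n, β i =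
        (m + K) * ∑ j ∈ Finset.range n, (1 - p) ^ j +
          κ * ∑ j ∈ Finset.range n, (j : ℝ) * (1 - p) ^ j -
          p * ∑ j ∈ Finset.range n, (1 - p) ^ j * Real.log (W j) := by
      intro n
      induction n with
      | zero => simp
      | succ n ih =>
        have h1 := hrec n
        rw [Finset.sum_range_succ, Finset.sum_range_succ, Finset.sum_range_succ,
          Finset.sum_range_succ]
        have h2 : (1 - p) ^ (n + 1) * (∑ i ∈ Finset.range n, β i + β n) =
            (1 - p) ^ n * ∑ i ∈ Finset.range n, β i - p * (1 - p) ^ n * ∑ i ∈ Finset.range n, β i +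
            (1 - p) ^ n * ((1 - p) * β n) := by ring
        rw [h2, h1, ih]
        ring
    have hs1 : Summable fun j : ℕ => (1 - p) ^ j :=
      summable_geometric_of_lt_one hq.le (by linarith)
    have hs2 : Summable fun j : ℕ => (j : ℝ) * (1 - p) ^ j := by
      have := summable_pow_mul_geometric_of_norm_lt_one 1
        (show ‖1 - p‖ < 1 by rw [Real.norm_of_nonneg hq.le]; linarith)
      simpa using this
    have hmK : 0 ≤ m + K ∨ m + K ≤ 0 := le_total _ _
    obtain ⟨n, hn⟩ := hW.diverges
      ((|m + K| * (∑' j : ℕ, (1 - p) ^ j) + κ * (∑' j : ℕ, (j : ℝ) * (1 - p) ^ j) + 1) / p)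
    have h1 := hsum n
    have h2 : 0 ≤ (1 - p) ^ n * ∑ i ∈ Finset.range n, β i :=
      mul_nonneg (pow_pos hq n).le (Finset.sum_nonneg fun i _ => hnn i)
    have h3 : (m + K) * ∑ j ∈ Finset.range n, (1 - p) ^ j ≤
        |m + K| * (∑' j : ℕ, (1 - p) ^ j) := by
      refine mul_le_mul (le_abs_self _) (hs1.sum_le_tsum _ fun j _ => by positivity) ?_
        (abs_nonneg _)
      exact Finset.sum_nonneg fun j _ => by positivity
    have h4 : κ * ∑ j ∈ Finset.range n, (j : ℝ) * (1 - p) ^ j ≤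
        κ * (∑' j : ℕ, (j : ℝ) * (1 - p) ^ j) :=
      mul_le_mul_of_nonneg_left (hs2.sum_le_tsum _ fun j _ => by positivity) hκ0.le
    rw [div_le_iff₀ hp] at hn
    linarith
  obtain ⟨ν, hfinal, hmin⟩ : ∃ ν, β ν ≤ logSlope W ν - C ∧ ∀ n < ν, ¬ β n ≤ logSlope W n - C := by
    classical
    exact ⟨Nat.find hex, Nat.find_spec hex, fun n hn => Nat.find_min hex hn⟩
  have hlt : ∀ n < ν, β n + Real.log 2 ≤ β (n + 1) := fun n hn => hstep n (not_le.1 (hmin n hn))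
  have hmono : ∀ n ≤ ν, β 0 ≤ β n := by
    intro n
    induction n with
    | zero => intro _; exact le_rfl
    | succ n ih =>
      intro hn
      linarith [hlt n (by omega), ih (by omega)]
  have hNν : N ≤ ν := by
    by_contra hcon
    push Not at hcon
    have h1 := hmono ν le_rfl
    have h2 := hW.convex hcon.le
    have h3 := le_abs_self (logSlope W N)
    have h4 := abs_nonneg C'
    linarith
  refine ⟨β, ν, (le_max_left _ _).trans hNν, fun n _ => hrec n, hlt, hfinal, ?_, ?_⟩
  · have h2 := le_abs_self C'
    have h3 := abs_nonneg (logSlope W N)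
    linarith
  -- Solving the recursion backwards writes $\beta_0$ as an average of $\beta_\nu$ and earlier
  -- slopes minus a nonnegative term. With $\beta_\nu$ below the slope at $\nu$, the preceding lemma
  -- gives $\beta_0\le\eta$ times that slope.
  · have hid : ∀ n, β 0 = (1 - p) ^ n * β n +
        p * ∑ l ∈ Finset.range n, (1 - p) ^ l * logSlope W l -
        κ * ∑ l ∈ Finset.range n, (1 - p) ^ l := by
      intro n
      induction n with
      | zero => simp
      | succ n ih =>
        have h5 : (1 - p) * β (n + 1) = β n - p * logSlope W n + κ := by
          rw [hβs, mul_add, mul_div_cancel₀ _ hq.ne']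
          ring
        rw [Finset.sum_range_succ, Finset.sum_range_succ, pow_succ, mul_assoc, h5, ih]
        ring
    have h1 := hid ν
    have h2 := hn₁ ν ((le_max_right _ _).trans hNν)
    have h3 : 0 ≤ κ * ∑ l ∈ Finset.range ν, (1 - p) ^ l :=
      mul_nonneg hκ0.le (Finset.sum_nonneg fun j _ => by positivity)
    have h4 := mul_le_mul_of_nonneg_left (show β ν ≤ logSlope W ν by linarith) (pow_pos hq ν).le
    have h5 := le_abs_self C'
    have h6 := abs_nonneg (logSlope W N)
    linarith

end Profile


/-! ### Averages over one-sided windows: smoothing, support and derivative bounds. -/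

section BoxAverage

/-- The average of `g` over the interval `[x - a, x]`. -/
noncomputable def boxAvg (a : ℝ) (g : ℝ → ℝ) (x : ℝ) : ℝ := a⁻¹ * ∫ t in (x - a)..x, g t

variable {a b : ℝ} {g : ℝ → ℝ}

theorem boxAvg_eq_sub (hg : Continuous g) (c x : ℝ) :
    boxAvg a g x = a⁻¹ * ((∫ t in c..x, g t) - ∫ t in c..(x - a), g t) := by
  rw [boxAvg, intervalIntegral.integral_interval_sub_left] <;>
    exact hg.intervalIntegrable _ _

theorem hasDerivAt_boxAvg (hg : Continuous g) (a x : ℝ) :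
    HasDerivAt (boxAvg a g) (a⁻¹ * (g x - g (x - a))) x := by
  have h : boxAvg a g = fun x => a⁻¹ * ((∫ t in 0..x, g t) - ∫ t in 0..(x - a), g t) :=
    funext fun x => boxAvg_eq_sub hg 0 x
  have h1 : ∀ y, HasDerivAt (fun x => ∫ t in 0..x, g t) (g y) y := fun y =>
    intervalIntegral.integral_hasDerivAt_right (hg.intervalIntegrable _ _)
      (hg.stronglyMeasurableAtFilter _ _) hg.continuousAt
  rw [h]
  refine HasDerivAt.const_mul _ ((h1 x).sub ?_)
  have := (h1 (x - a)).comp x ((hasDerivAt_id x).sub_const a)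
  simpa [Function.comp_def] using this

theorem deriv_boxAvg (hg : Continuous g) (a : ℝ) :
    deriv (boxAvg a g) = fun x => a⁻¹ * (g x - g (x - a)) :=
  funext fun x => (hasDerivAt_boxAvg hg a x).deriv

theorem contDiff_succ_boxAvg {n : ℕ} (hg : ContDiff ℝ n g) (a : ℝ) :
    ContDiff ℝ (n + 1 : ℕ) (boxAvg a g) := by
  push_cast
  refine contDiff_succ_iff_deriv.2 ⟨fun x => (hasDerivAt_boxAvg hg.continuous a x).differentiableAt,
    fun h => by simp at h, ?_⟩
  rw [deriv_boxAvg hg.continuous]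
  exact contDiff_const.mul (hg.sub (hg.comp (contDiff_id.sub contDiff_const)))

theorem contDiff_boxAvg (hg : ContDiff ℝ (⊤ : ℕ∞) g) (a : ℝ) :
    ContDiff ℝ (⊤ : ℕ∞) (boxAvg a g) :=
  contDiff_infty.2 fun n => (contDiff_succ_boxAvg (contDiff_infty.1 hg n) a).of_le
    (by exact_mod_cast n.le_succ)

theorem iteratedDeriv_succ_boxAvg {n : ℕ} (hg : ContDiff ℝ n g) (a x : ℝ) :
    iteratedDeriv (n + 1) (boxAvg a g) x =
      a⁻¹ * (iteratedDeriv n g x - iteratedDeriv n g (x - a)) := by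
  rw [iteratedDeriv_succ', deriv_boxAvg hg.continuous, iteratedDeriv_const_mul_field]
  have h2 : ContDiff ℝ n fun x => g (x - a) := hg.comp (contDiff_id.sub contDiff_const)
  have h3 := iteratedDeriv_sub (x := x) hg.contDiffAt h2.contDiffAt
  have h4 : iteratedDeriv n (fun x => g (x - a)) x = iteratedDeriv n g (x - a) := by
    rw [iteratedDeriv_comp_sub_const]
  rw [h4] at h3
  rw [← h3]
  rfl

theorem boxAvg_le (ha : 0 < a) (hg : Continuous g) {x B : ℝ}
    (h : ∀ y ∈ Set.Icc (x - a) x, g y ≤ B) : boxAvg a g x ≤ B := by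
  have h1 := intervalIntegral.integral_mono_on (show x - a ≤ x by linarith)
    (hg.intervalIntegrable (μ := volume) _ _) (intervalIntegrable_const (μ := volume)) h
  rw [intervalIntegral.integral_const, sub_sub_cancel, smul_eq_mul] at h1
  rw [boxAvg, inv_mul_le_iff₀ ha]
  exact h1

theorem le_boxAvg (ha : 0 < a) (hg : Continuous g) {x B : ℝ}
    (h : ∀ y ∈ Set.Icc (x - a) x, B ≤ g y) : B ≤ boxAvg a g x := by
  have h1 := intervalIntegral.integral_mono_on (show x - a ≤ x by linarith)
    (intervalIntegrable_const (μ := volume)) (hg.intervalIntegrable (μ := volume) _ _) h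
  rw [intervalIntegral.integral_const, sub_sub_cancel, smul_eq_mul] at h1
  rw [boxAvg, le_inv_mul_iff₀ ha]
  exact h1

theorem abs_boxAvg_sub_le (ha : 0 < a) (hg : Continuous g) {x c B : ℝ}
    (h : ∀ y ∈ Set.Icc (x - a) x, |g y - c| ≤ B) : |boxAvg a g x - c| ≤ B := by
  rw [abs_le]
  constructor
  · have := le_boxAvg ha hg (B := c - B) fun y hy => by linarith [(abs_le.1 (h y hy)).1]
    linarith
  · have := boxAvg_le ha hg (B := c + B) fun y hy => by linarith [(abs_le.1 (h y hy)).2]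
    linarith

theorem abs_boxAvg_le (ha : 0 < a) (hg : Continuous g) {x B : ℝ}
    (h : ∀ y ∈ Set.Icc (x - a) x, |g y| ≤ B) : |boxAvg a g x| ≤ B := by
  have := abs_boxAvg_sub_le ha hg (c := 0) (B := B) (x := x) (by simpa using h)
  simpa using this

theorem boxAvg_eq_zero (ha : 0 < a) (hg : Continuous g) {x : ℝ}
    (h : ∀ y ∈ Set.Icc (x - a) x, g y = 0) : boxAvg a g x = 0 := by
  have := abs_boxAvg_le ha hg (B := 0) (x := x) (fun y hy => by simp [h y hy])
  simpa using this

theorem boxAvg_eq_zero_of_notMem (ha : 0 < a) (hg : Continuous g)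
    (h : ∀ x ∉ Set.Ioo 0 b, g x = 0) : ∀ x ∉ Set.Ioo 0 (b + a), boxAvg a g x = 0 := by
  intro x hx
  refine boxAvg_eq_zero ha hg fun y hy => h y fun hy' => hx ⟨?_, ?_⟩
  · exact hy'.1.trans_le hy.2
  · linarith [hy'.2, hy.1]

/-- A continuous nonnegative function of integral one vanishing outside `(0, b)`. -/
structure IsUnitBump (b : ℝ) (g : ℝ → ℝ) : Prop where
  continuous : Continuous g
  nonneg : ∀ x, 0 ≤ g x
  eq_zero : ∀ x ∉ Set.Ioo 0 b, g x = 0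
  integral_eq : ∫ t in 0..b, g t = 1

theorem integral_eq_zero_of_eq_zero {x y : ℝ} (hxy : x ≤ y)
    (h : ∀ t ∈ Set.Icc x y, g t = 0) : ∫ t in x..y, g t = 0 := by
  rw [intervalIntegral.integral_congr (g := fun _ => (0 : ℝ)), intervalIntegral.integral_zero]
  rw [Set.uIcc_of_le hxy]
  exact h

theorem IsUnitBump.integral_of_le (h : IsUnitBump b g) {x : ℝ} (hx : b ≤ x) :
    ∫ t in 0..x, g t = 1 := by
  rw [← intervalIntegral.integral_add_adjacent_intervals (h.continuous.intervalIntegrable 0 b)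
    (h.continuous.intervalIntegrable b x), h.integral_eq,
    integral_eq_zero_of_eq_zero hx fun t ht => h.eq_zero t fun ht' => by linarith [ht.1, ht'.2],
    add_zero]

theorem IsUnitBump.integral_of_nonpos (h : IsUnitBump b g) {x : ℝ} (hx : x ≤ 0) :
    ∫ t in 0..x, g t = 0 := by
  rw [intervalIntegral.integral_symm,
    integral_eq_zero_of_eq_zero hx fun t ht => h.eq_zero t fun ht' => by linarith [ht.2, ht'.1],
    neg_zero]

theorem IsUnitBump.mono (h : IsUnitBump b g) {b' : ℝ} (hb : b ≤ b') : IsUnitBump b' g where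
  continuous := h.continuous
  nonneg := h.nonneg
  eq_zero x hx := h.eq_zero x fun h' => hx ⟨h'.1, h'.2.trans_le hb⟩
  integral_eq := h.integral_of_le hb

/-- The primitive based at $0$ is monotone, vanishes on the left and equals one on the right. The
endpoints need not be ordered. -/
theorem IsUnitBump.intervalIntegral_le_one (h : IsUnitBump b g) (x y : ℝ) :
    ∫ t in x..y, g t ≤ 1 := by
  set G : ℝ → ℝ := fun x => ∫ t in 0..x, g t with hG
  have hmono : Monotone G := by
    intro x y hxy
    have h2 := intervalIntegral.integral_interval_sub_left (a := (0 : ℝ)) (b := y) (c := x) (μ := volume)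
      (h.continuous.intervalIntegrable _ _) (h.continuous.intervalIntegrable _ _)
    have h3 := intervalIntegral.integral_nonneg (μ := volume) hxy fun t _ => h.nonneg t
    simp only [hG]
    linarith
  have h2 := intervalIntegral.integral_interval_sub_left (a := (0 : ℝ)) (b := y) (c := x) (μ := volume)
      (h.continuous.intervalIntegrable _ _) (h.continuous.intervalIntegrable _ _)
  rw [← h2]
  have h3 : G y ≤ G (max y b) := hmono (le_max_left _ _)
  have h4 : G (min x 0) ≤ G x := hmono (min_le_left _ _)
  simp only [hG] at h3 h4
  rw [h.integral_of_le (le_max_right y b)] at h3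
  rw [h.integral_of_nonpos (min_le_right x 0)] at h4
  linarith

theorem IsUnitBump.boxAvg_le_inv (h : IsUnitBump b g) (ha : 0 < a) (x : ℝ) :
    boxAvg a g x ≤ a⁻¹ := by
  have := mul_le_mul_of_nonneg_left (h.intervalIntegral_le_one (x - a) x) (inv_pos.2 ha).le
  rwa [mul_one] at this

theorem IsUnitBump.boxAvg (h : IsUnitBump b g) (ha : 0 < a) : IsUnitBump (b + a) (boxAvg a g) where
  continuous := continuous_iff_continuousAt.2 fun x =>
    (hasDerivAt_boxAvg h.continuous a x).continuousAt
  nonneg x := le_boxAvg ha h.continuous fun y _ => h.nonneg y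
  eq_zero := boxAvg_eq_zero_of_notMem ha h.continuous h.eq_zero
  integral_eq := by
    -- In terms of the primitive $G$, the integral of the average is
    -- $a^{-1}\bigl(\int_b^{b+a}G-\int_{-a}^0G\bigr)$, with $G=1$ on the first interval and $G=0$ on
    -- the second.
    set G : ℝ → ℝ := fun x => ∫ t in 0..x, g t with hG
    have hGc : Continuous G :=
      continuous_iff_continuousAt.2 fun x => HasDerivAt.continuousAt
        (intervalIntegral.integral_hasDerivAt_right (h.continuous.intervalIntegrable _ _)
          (h.continuous.stronglyMeasurableAtFilter _ _) h.continuous.continuousAt)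
    have hi : ∀ x y, IntervalIntegrable G volume x y := fun x y => hGc.intervalIntegrable x y
    have h1 : ∀ x, LpCarleman.boxAvg a g x = a⁻¹ * (G x - G (x - a)) := fun x =>
      boxAvg_eq_sub h.continuous 0 x
    have h2 : ∫ t in b..(b + a), G t = a := by
      rw [intervalIntegral.integral_congr (g := fun _ => (1 : ℝ))]
      · simp
      · rw [Set.uIcc_of_le (by linarith)]
        exact fun x hx => h.integral_of_le hx.1
    have h3 : ∫ t in (-a)..0, G t = 0 := by
      refine integral_eq_zero_of_eq_zero (by linarith) fun x hx => h.integral_of_nonpos hx.2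
    simp only [h1]
    have hc : Continuous fun x => G (x - a) := hGc.comp (continuous_id.sub continuous_const)
    rw [intervalIntegral.integral_const_mul, intervalIntegral.integral_sub (hi _ _)
      (hc.intervalIntegrable _ _),
      intervalIntegral.integral_comp_sub_right G a, add_sub_cancel_right, zero_sub]
    rw [← intervalIntegral.integral_add_adjacent_intervals (hi 0 b) (hi b (b + a)),
      ← intervalIntegral.integral_add_adjacent_intervals (hi (-a) 0) (hi 0 b), h2, h3]
    field_simp
    ring

/-! ### Iterated box averages -/

/-- `boxAvg (a k) (boxAvg (a (k + 1)) ⋯ (boxAvg (a (k + j - 1)) g))`. -/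
noncomputable def boxes (a : ℕ → ℝ) : ℕ → ℕ → (ℝ → ℝ) → ℝ → ℝ
  | _, 0, g => g
  | k, j + 1, g => boxAvg (a k) (boxes a (k + 1) j g)

variable {a : ℕ → ℝ}

theorem contDiff_boxes (hg : ContDiff ℝ (⊤ : ℕ∞) g) (j : ℕ) :
    ∀ k, ContDiff ℝ (⊤ : ℕ∞) (boxes a k j g) := by
  induction j with
  | zero => exact fun _ => hg
  | succ j ih => exact fun k => contDiff_boxAvg (ih _) _

theorem IsUnitBump.boxes (h : IsUnitBump b g) (ha : ∀ k, 0 < a k) (j : ℕ) :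
    ∀ k, IsUnitBump (b + ∑ i ∈ Finset.range j, a (k + i)) (boxes a k j g) := by
  induction j with
  | zero => exact fun _ => by simpa [LpCarleman.boxes] using h
  | succ j ih =>
    intro k
    have := (ih (k + 1)).boxAvg (ha k)
    rw [Finset.sum_range_succ']
    simpa [LpCarleman.boxes, add_assoc, add_comm, add_left_comm] using this

/-- An iterated average at $x$ sees $g$ only on the window to the left of $x$ whose length is the
sum of the widths. Continuity is carried through the same induction because averaging a pointwise
bound requires it. -/
theorem boxes_le (hg : Continuous g) (ha : ∀ k, 0 < a k) (j : ℕ) : ∀ (k : ℕ) {x B : ℝ},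
    (∀ y ∈ Set.Icc (x - ∑ i ∈ Finset.range j, a (k + i)) x, g y ≤ B) →
    boxes a k j g x ≤ B ∧ Continuous (boxes a k j g) := by
  induction j with
  | zero =>
    intro k x B h
    exact ⟨h x (by simp), hg⟩
  | succ j ih =>
    intro k x B h
    -- The point $0$ and the supremum are dummy arguments: only the continuity half of the induction
    -- hypothesis is used.
    have hc : Continuous (boxes a (k + 1) j g) := (ih (k + 1) (x := 0)
      (B := sSup (g '' Set.Icc (0 - ∑ i ∈ Finset.range j, a (k + 1 + i)) 0))
      (fun y hy => le_csSup (isCompact_Icc.image hg).bddAbove ⟨y, hy, rfl⟩)).2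
    refine ⟨boxAvg_le (ha k) hc fun y hy => (ih (k + 1) fun z hz => h z ⟨?_, ?_⟩).1,
      continuous_iff_continuousAt.2 fun x => (hasDerivAt_boxAvg hc _ x).continuousAt⟩
    · rw [Finset.sum_range_succ']
      have h1 : ∑ i ∈ Finset.range j, a (k + (i + 1)) = ∑ i ∈ Finset.range j, a (k + 1 + i) :=
        Finset.sum_congr rfl fun i _ => by congr 1; omega
      rw [h1, add_zero]
      linarith [hz.1, hy.1]
    · exact hz.2.trans hy.2

/-- The first $n$ derivatives are spent on the first $n$ boxes, each turning into a difference
quotient that costs $2/a$. The other $r$ are left to the inner function. -/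
theorem abs_iteratedDeriv_boxes_le (hg : ContDiff ℝ (⊤ : ℕ∞) g) (ha : ∀ k, 0 < a k) (r j : ℕ)
    {A : ℝ} (n : ℕ) : ∀ k, (∀ x, |iteratedDeriv r (boxes a (k + n) j g) x| ≤ A) →
      ∀ x, |iteratedDeriv (n + r) (boxes a k (n + j) g) x| ≤
        (∏ i ∈ Finset.range n, 2 / a (k + i)) * A := by
  induction n with
  | zero =>
    intro k h x
    simpa using h x
  | succ n ih =>
    intro k h x
    have h1 := ih (k + 1) (by rwa [show k + 1 + n = k + (n + 1) by ring])
    rw [show n + 1 + r = n + r + 1 by ring, show n + 1 + j = n + j + 1 by ring, boxes,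
      iteratedDeriv_succ_boxAvg ((contDiff_boxes hg _ _).of_le (by exact_mod_cast le_top)),
      Finset.prod_range_succ', abs_mul, abs_of_pos (inv_pos.2 (ha k))]
    have h2 : ∏ i ∈ Finset.range n, 2 / a (k + (i + 1)) = ∏ i ∈ Finset.range n, 2 / a (k + 1 + i) :=
      Finset.prod_congr rfl fun i _ => by rw [show k + (i + 1) = k + 1 + i by ring]
    rw [h2, add_zero]
    have h3 := (abs_sub (iteratedDeriv (n + r) (boxes a (k + 1) (n + j) g) x)
      (iteratedDeriv (n + r) (boxes a (k + 1) (n + j) g) (x - a k))).trans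
      (add_le_add (h1 x) (h1 (x - a k)))
    refine (mul_le_mul_of_nonneg_left h3 (inv_pos.2 (ha k)).le).trans_eq ?_
    rw [div_eq_mul_inv]
    ring

/-- The $L^p$ counterpart: by subadditivity of $t^p$ and translation invariance a difference
quotient costs $2a^{-p}$. For $p<1$ this is cheaper than the gain in height $a^{-1}$, which is what
makes the kernels possible. -/
theorem lintegral_iteratedDeriv_boxes_le {p : ℝ} (hp : 0 < p) (hp1 : p < 1)
    (hg : ContDiff ℝ (⊤ : ℕ∞) g) (ha : ∀ k, 0 < a k)
    (r j : ℕ) {A : ℝ≥0∞} (n : ℕ) :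
    ∀ k, (∫⁻ x, ‖iteratedDeriv r (boxes a (k + n) j g) x‖ₑ ^ p ≤ A) →
      ∫⁻ x, ‖iteratedDeriv (n + r) (boxes a k (n + j) g) x‖ₑ ^ p ≤
        ENNReal.ofReal (∏ i ∈ Finset.range n, 2 * a (k + i) ^ (-p)) * A := by
  induction n with
  | zero =>
    intro k h
    simpa using h
  | succ n ih =>
    intro k h
    have h1 := ih (k + 1) (by rwa [show k + 1 + n = k + (n + 1) by ring])
    set u := iteratedDeriv (n + r) (boxes a (k + 1) (n + j) g) with hu
    have hum : Measurable u := (continuous_iteratedDeriv_of_smooth (contDiff_boxes hg _ _) _).measurable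
    have h2 : ∏ i ∈ Finset.range n, 2 * a (k + (i + 1)) ^ (-p) =
        ∏ i ∈ Finset.range n, 2 * a (k + 1 + i) ^ (-p) :=
      Finset.prod_congr rfl fun i _ => by rw [show k + (i + 1) = k + 1 + i by ring]
    rw [show n + 1 + r = n + r + 1 by ring, show n + 1 + j = n + j + 1 by ring, boxes,
      Finset.prod_range_succ', h2, add_zero]
    have h3 : ∀ x, ‖iteratedDeriv (n + r + 1) (boxAvg (a k) (boxes a (k + 1) (n + j) g)) x‖ₑ ^ p ≤
        ENNReal.ofReal (a k ^ (-p)) * (‖u x‖ₑ ^ p + ‖u (x - a k)‖ₑ ^ p) := by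
      intro x
      rw [iteratedDeriv_succ_boxAvg ((contDiff_boxes hg _ _).of_le (by exact_mod_cast le_top)),
        enorm_mul, ENNReal.mul_rpow_of_nonneg _ _ hp.le]
      gcongr
      · rw [Real.enorm_of_nonneg (inv_pos.2 (ha k)).le, ENNReal.ofReal_rpow_of_pos (inv_pos.2 (ha k)),
          Real.inv_rpow (ha k).le, Real.rpow_neg (ha k).le]
      · exact (ENNReal.rpow_le_rpow (enorm_sub_le) hp.le).trans
          (ENNReal.rpow_add_le_add_rpow _ _ hp.le hp1.le)
    refine (lintegral_mono h3).trans ?_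
    rw [lintegral_const_mul' _ _ ENNReal.ofReal_ne_top,
      lintegral_add_left (hum.enorm.pow_const p),
      lintegral_sub_right_eq_self (fun x => ‖u x‖ₑ ^ p) (a k), ← two_mul,
      ENNReal.ofReal_mul (by
        refine Finset.prod_nonneg fun i _ => ?_
        have := Real.rpow_nonneg (ha (k + 1 + i)).le (-p)
        positivity),
      ENNReal.ofReal_mul zero_le_two, ENNReal.ofReal_ofNat]
    calc _ ≤ ENNReal.ofReal (a k ^ (-p)) * (2 *
          (ENNReal.ofReal (∏ i ∈ Finset.range n, 2 * a (k + 1 + i) ^ (-p)) * A)) := by gcongr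
      _ = _ := by ring

end BoxAverage


/-! ### A Gevrey cutoff as an infinite composition of box averages. -/

section Cutoff

/-- The element $U_n$ is the limit of $T_nT_{n+1}\cdots T_{n+j-1}H$ as $j\to\infty$. Appending one
more map moves the innermost argument by at most $d_{n+j}$, and the outer maps do not enlarge this.
-/
theorem exists_infinite_composition {X : Type*} [MetricSpace X] [CompleteSpace X] {T : ℕ → X → X}
    (hT : ∀ n, LipschitzWith 1 (T n)) {H : X} {d : ℕ → ℝ} (hd : Summable d)
    (h : ∀ n, dist H (T n H) ≤ d n) {S : ℕ → Set X} (hS : ∀ n, IsClosed (S n))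
    (hST : ∀ n, Set.MapsTo (T n) (S (n + 1)) (S n)) (hH : ∀ n, H ∈ S n) :
    ∃ U : ℕ → X, (∀ n, U n = T n (U (n + 1))) ∧ (∀ n, U n ∈ S n) ∧ dist H (U 0) ≤ ∑' n, d n := by
  let f : ℕ → ℕ → X := fun j => Nat.rec (fun _ => H) (fun _ g n => T n (g (n + 1))) j
  have f0 : ∀ n, f 0 n = H := fun n => rfl
  have fs : ∀ j n, f (j + 1) n = T n (f j (n + 1)) := fun j n => rfl
  have hdist : ∀ j n, dist (f j n) (f (j + 1) n) ≤ d (n + j) := by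
    intro j
    induction j with
    | zero => exact h
    | succ j ih =>
      intro n
      rw [fs, fs (j + 1)]
      have := (hT n).dist_le_mul (f j (n + 1)) (f (j + 1) (n + 1))
      rw [NNReal.coe_one, one_mul] at this
      exact (this.trans (ih (n + 1))).trans_eq (by congr 1; omega)
  have hd' : ∀ n, Summable fun j => d (n + j) := fun n => by
    simpa [add_comm] using (summable_nat_add_iff n).2 hd
  have hlim : ∀ n, ∃ u, Tendsto (fun j => f j n) atTop (𝓝 u) := fun n =>
    cauchySeq_tendsto_of_complete
      (cauchySeq_of_dist_le_of_summable (fun j => d (n + j)) (fun j => hdist j n) (hd' n))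
  choose U hU using hlim
  refine ⟨U, fun n => ?_, fun n => ?_, ?_⟩
  · refine tendsto_nhds_unique ((tendsto_add_atTop_iff_nat 1).2 (hU n)) ?_
    exact ((hT n).continuous.tendsto _).comp (hU (n + 1))
  · refine (hS n).mem_of_tendsto (hU n) (Eventually.of_forall fun j => ?_)
    induction j generalizing n with
    | zero => exact hH n
    | succ j ih => exact hST n (ih (n + 1))
  · have := dist_le_tsum_of_dist_le_of_tendsto₀ (fun j => d (0 + j)) (fun j => hdist j 0) (hd' 0)
      (hU 0)
    simpa [f0] using this

open BoundedContinuousFunction in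
theorem exists_iterated_boxAvg {a : ℕ → ℝ} (ha : ∀ n, 0 < a n) (hs : Summable a)
    (hsum : ∑' n, a n ≤ 1 / 16) :
    ∃ U : ℕ → ℝ → ℝ, (∀ n, U n = boxAvg (a n) (U (n + 1))) ∧ (∀ n, Continuous (U n)) ∧
      (∀ n x, 0 ≤ U n x) ∧ (∀ n x, U n x ≤ 1) ∧ (∀ x ∉ Set.Ioo 0 1, U 0 x = 0) ∧
      ∀ x, |x - 1 / 2| ≤ 1 / 16 → 1 / 8 ≤ U 0 x := by
  have hbc : ∀ (n : ℕ) (g : ℝ →ᵇ ℝ), Continuous (boxAvg (a n) g) := fun n g =>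
    continuous_iff_continuousAt.2 fun x => (hasDerivAt_boxAvg g.continuous _ x).continuousAt
  let T : ℕ → (ℝ →ᵇ ℝ) → (ℝ →ᵇ ℝ) := fun n g =>
    BoundedContinuousFunction.ofNormedAddCommGroup (boxAvg (a n) g) (hbc n g) ‖g‖ fun x =>
      abs_boxAvg_le (ha n) g.continuous fun y _ => g.norm_coe_le_norm y
  have hTa : ∀ n g x, T n g x = boxAvg (a n) g x := fun n g x => rfl
  have hTl : ∀ n, LipschitzWith 1 (T n) := by
    refine fun n => LipschitzWith.of_dist_le_mul fun g g' => ?_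
    rw [NNReal.coe_one, one_mul, BoundedContinuousFunction.dist_le dist_nonneg]
    intro x
    have h1 : boxAvg (a n) (fun y => g y - g' y) x = boxAvg (a n) g x - boxAvg (a n) g' x := by
      unfold boxAvg
      rw [intervalIntegral.integral_sub (g.continuous.intervalIntegrable _ _)
        (g'.continuous.intervalIntegrable _ _)]
      ring
    rw [hTa, hTa, Real.dist_eq, ← h1]
    exact abs_boxAvg_le (ha n) (g.continuous.sub g'.continuous)
      fun y _ => g.dist_coe_le_dist (g := g') y
  -- The tent is 1-Lipschitz, so averaging over width $a_n$ moves it by at most $a_n$ in supremum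
  -- norm. Near the centre, $1/4-1/16-1/16=1/8$ remains.
  let H : ℝ →ᵇ ℝ := BoundedContinuousFunction.ofNormedAddCommGroup
    (fun x => max 0 (1 / 4 - |x - 1 / 2|)) (by fun_prop) 1 fun x => by
      rw [Real.norm_of_nonneg (le_max_left _ _)]
      have := abs_nonneg (x - 1 / 2)
      exact max_le zero_le_one (by linarith)
  have hHa : ∀ x, H x = max 0 (1 / 4 - |x - 1 / 2|) := fun x => rfl
  have hHT : ∀ n, dist H (T n H) ≤ a n := by
    intro n
    rw [dist_comm, BoundedContinuousFunction.dist_le (ha n).le]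
    intro x
    rw [hTa, Real.dist_eq]
    refine abs_boxAvg_sub_le (ha n) H.continuous fun y hy => ?_
    rw [hHa, hHa]
    refine (abs_max_sub_max_le_max _ _ _ _).trans (max_le (by simpa using (ha n).le) ?_)
    rw [sub_sub_sub_cancel_left]
    refine (abs_abs_sub_abs_le _ _).trans ?_
    rw [abs_le]
    constructor <;> linarith [hy.1, hy.2, ha n]
  -- Averages push supports to the right, so the $n$-th function must leave room for the $n$ boxes
  -- still to be applied to it.
  let S : ℕ → Set (ℝ →ᵇ ℝ) := fun n => {g | (∀ x, 0 ≤ g x) ∧ (∀ x, g x ≤ 1) ∧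
    (∀ x, x ≤ 0 → g x = 0) ∧ ∀ x, 1 - ∑ i ∈ Finset.range n, a i ≤ x → g x = 0}
  have hev : ∀ x, Continuous fun g : ℝ →ᵇ ℝ => g x := fun x =>
    (BoundedContinuousFunction.lipschitz_eval_const x).continuous
  have hS : ∀ n, IsClosed (S n) := by
    intro n
    refine IsClosed.and ?_ (IsClosed.and ?_ (IsClosed.and ?_ ?_))
    · simp only [Set.ofPred_forall]
      exact isClosed_iInter fun x => isClosed_le continuous_const (hev x)
    · simp only [Set.ofPred_forall]
      exact isClosed_iInter fun x => isClosed_le (hev x) continuous_const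
    · simp only [Set.ofPred_forall]
      exact isClosed_iInter fun x => isClosed_iInter fun _ => isClosed_eq (hev x) continuous_const
    · simp only [Set.ofPred_forall]
      exact isClosed_iInter fun x => isClosed_iInter fun _ => isClosed_eq (hev x) continuous_const
  have hST : ∀ n, Set.MapsTo (T n) (S (n + 1)) (S n) := by
    rintro n g ⟨h1, h2, h3, h4⟩
    refine ⟨fun x => le_boxAvg (ha n) g.continuous fun y _ => h1 y,
      fun x => boxAvg_le (ha n) g.continuous fun y _ => h2 y,
      fun x hx => boxAvg_eq_zero (ha n) g.continuous fun y hy => h3 y (hy.2.trans hx),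
      fun x hx => boxAvg_eq_zero (ha n) g.continuous fun y hy => h4 y ?_⟩
    rw [Finset.sum_range_succ]
    linarith [hy.1]
  have hpart : ∀ n, ∑ i ∈ Finset.range n, a i ≤ 1 / 16 := fun n =>
    (hs.sum_le_tsum _ fun i _ => (ha i).le).trans hsum
  have hHS : ∀ n, H ∈ S n := by
    intro n
    refine ⟨fun x => le_max_left _ _, fun x => ?_, fun x hx => ?_, fun x hx => ?_⟩
    · rw [hHa]
      have := abs_nonneg (x - 1 / 2)
      exact max_le zero_le_one (by linarith)
    · rw [hHa, max_eq_left]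
      have := neg_abs_le (x - 1 / 2)
      linarith
    · rw [hHa, max_eq_left]
      have := le_abs_self (x - 1 / 2)
      linarith [hpart n]
  obtain ⟨U, hU, hUS, hUd⟩ := exists_infinite_composition hTl hs hHT hS hST hHS
  refine ⟨fun n => U n, fun n => funext fun x => ?_, fun n => (U n).continuous,
    fun n => (hUS n).1, fun n => (hUS n).2.1, fun x hx => ?_, fun x hx => ?_⟩
  · exact (congrArg (fun g : ℝ →ᵇ ℝ => g x) (hU n)).trans (hTa n _ x)
  · rcases le_or_gt x 0 with h0 | h0
    · exact (hUS 0).2.2.1 x h0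
    · refine (hUS 0).2.2.2 x ?_
      rw [Finset.range_zero, Finset.sum_empty, sub_zero]
      exact not_lt.1 fun h1 => hx ⟨h0, h1⟩
  · have h1 := (BoundedContinuousFunction.dist_coe_le_dist (f := H) (g := U 0) x).trans hUd
    have h2 := le_max_right 0 (1 / 4 - |x - 1 / 2|)
    rw [← hHa, ] at h2
    rw [Real.dist_eq] at h1
    linarith [(abs_le.1 h1).2]

/-- Boxes of width $c(n+1)^{-s}$ have finite total width because $s>1$, and the derivative spent on
the $n$-th box costs $(2/c)(n+1)^s$. -/
theorem exists_gevrey_cutoff {s : ℝ} (hs : 1 < s) : ∃ (χ : ℝ → ℝ) (A : ℝ), 1 ≤ A ∧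
    ContDiff ℝ (⊤ : ℕ∞) χ ∧ (∀ x, 0 ≤ χ x) ∧ (∀ x ∉ Set.Ioo 0 1, χ x = 0) ∧
    (∀ x, |x - 1 / 2| ≤ 1 / 16 → 1 / 8 ≤ χ x) ∧
    ∀ (i : ℕ) (x : ℝ), |iteratedDeriv i χ x| ≤
      ∏ l ∈ Finset.range i, A * ((l : ℝ) + 1) ^ s := by
  have hsum : Summable fun n : ℕ => ((n : ℝ) + 1) ^ (-s) := by
    have := (summable_nat_add_iff 1).2 (Real.summable_nat_rpow.2 (show -s < -1 by linarith))
    simpa using this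
  set Z := ∑' n : ℕ, ((n : ℝ) + 1) ^ (-s) with hZ
  have hZ0 : 0 ≤ Z := tsum_nonneg fun n => by positivity
  set c := 1 / (16 * (Z + 1)) with hc
  have hc0 : 0 < c := by positivity
  obtain ⟨U, hU, hUc, hU0, hU1, hUs, hUl⟩ := exists_iterated_boxAvg
    (a := fun n => c * ((n : ℝ) + 1) ^ (-s)) (fun n => by positivity) (hsum.mul_left c) (by
      rw [tsum_mul_left, ← hZ, hc, div_mul_eq_mul_div, div_le_div_iff₀ (by positivity) (by norm_num)]
      linarith)
  -- Each function is an average of the next, so regularity of order $k$ for all indices at once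
  -- improves to order $k+1$.
  have hsm : ∀ k : ℕ, ∀ n, ContDiff ℝ k (U n) := by
    intro k
    induction k with
    | zero => exact fun n => contDiff_zero.2 (hUc n)
    | succ k ih =>
      intro n
      rw [hU]
      exact contDiff_succ_boxAvg (ih (n + 1)) _
  have hbd : ∀ k n x, |iteratedDeriv k (U n) x| ≤
      ∏ l ∈ Finset.range k, 2 / c * (((n + l : ℕ) : ℝ) + 1) ^ s := by
    intro k
    induction k with
    | zero =>
      intro n x
      rw [iteratedDeriv_zero, abs_of_nonneg (hU0 n x)]
      simpa using hU1 n x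
    | succ k ih =>
      intro n x
      have h2 : ∏ l ∈ Finset.range k, 2 / c * (((n + (l + 1) : ℕ) : ℝ) + 1) ^ s =
          ∏ l ∈ Finset.range k, 2 / c * (((n + 1 + l : ℕ) : ℝ) + 1) ^ s :=
        Finset.prod_congr rfl fun i _ => by rw [show n + (i + 1) = n + 1 + i by ring]
      rw [hU, iteratedDeriv_succ_boxAvg (hsm k _), Finset.prod_range_succ', h2, abs_mul, add_zero,
        abs_of_pos (by positivity), mul_inv, Real.rpow_neg (by positivity), inv_inv]
      have h3 := (abs_sub (iteratedDeriv k (U (n + 1)) x)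
        (iteratedDeriv k (U (n + 1)) (x - c * ((n : ℝ) + 1) ^ (-s)))).trans
          (add_le_add (ih (n + 1) _) (ih (n + 1) _))
      rw [Real.rpow_neg (by positivity)] at h3
      refine (mul_le_mul_of_nonneg_left h3 (by positivity)).trans_eq ?_
      ring
  refine ⟨U 0, max 1 (2 / c), le_max_left _ _, contDiff_infty.2 fun k => hsm k 0, hU0 0, hUs, hUl,
    fun i x => (hbd i 0 x).trans ?_⟩
  refine Finset.prod_le_prod (fun l _ => by positivity) fun l _ => ?_
  rw [zero_add]
  gcongr
  exact le_max_right _ _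

end Cutoff

/-! ### Derivative bounds for products. -/

section Leibniz

/-- Asking each $\rho_l$ to be twice what either factor needs gains $2^{-r}$ in every Leibniz term,
which pays for the sum of the binomial coefficients. -/
theorem abs_iteratedDeriv_mul_le {f g : ℝ → ℝ} (hf : ContDiff ℝ (⊤ : ℕ∞) f)
    (hg : ContDiff ℝ (⊤ : ℕ∞) g) {x F G a : ℝ} {b ρ : ℕ → ℝ} (ha : 0 ≤ a) (hb : ∀ l, 0 ≤ b l)
    (hfx : ∀ i, |iteratedDeriv i f x| ≤ F * a ^ i)
    (hgx : ∀ i, |iteratedDeriv i g x| ≤ G * ∏ l ∈ Finset.range i, b l) (r : ℕ)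
    (haρ : ∀ l, 2 * a ≤ ρ l) (hbρ : ∀ l, 2 * b l ≤ ρ l) :
    |iteratedDeriv r (f * g) x| ≤ F * G * ∏ l ∈ Finset.range r, ρ l := by
  have hF : 0 ≤ F := (abs_nonneg _).trans (by simpa using hfx 0)
  have hG : 0 ≤ G := (abs_nonneg _).trans (by simpa using hgx 0)
  rw [iteratedDeriv_mul (hf.contDiffAt.of_le (by exact_mod_cast le_top))
    (hg.contDiffAt.of_le (by exact_mod_cast le_top))]
  have hterm : ∀ i ∈ Finset.range (r + 1),
      |(r.choose i : ℝ) * iteratedDeriv i f x * iteratedDeriv (r - i) g x| ≤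
        (r.choose i : ℝ) * (F * G * ∏ l ∈ Finset.range r, ρ l / 2) := by
    intro i hi
    rw [abs_mul, abs_mul, Nat.abs_cast, mul_assoc]
    refine mul_le_mul_of_nonneg_left ?_ (Nat.cast_nonneg _)
    have hi' : r - i + i = r := Nat.sub_add_cancel (Nat.lt_succ_iff.1 (Finset.mem_range.1 hi))
    have h1 : (∏ l ∈ Finset.range (r - i), b l) * a ^ i ≤ ∏ l ∈ Finset.range r, ρ l / 2 := by
      conv_rhs => rw [← hi', Finset.prod_range_add]
      refine mul_le_mul (Finset.prod_le_prod (fun l _ => hb l) fun l _ => by linarith [hbρ l]) ?_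
        (pow_nonneg ha i) (Finset.prod_nonneg fun l _ => by linarith [haρ l])
      calc a ^ i = ∏ l ∈ Finset.range i, a := by simp
        _ ≤ _ := Finset.prod_le_prod (fun _ _ => ha) fun l _ => by linarith [haρ (r - i + l)]
    calc _ ≤ (F * a ^ i) * (G * ∏ l ∈ Finset.range (r - i), b l) :=
          mul_le_mul (hfx i) (hgx _) (abs_nonneg _) (by positivity)
      _ = F * G * ((∏ l ∈ Finset.range (r - i), b l) * a ^ i) := by ring
      _ ≤ _ := mul_le_mul_of_nonneg_left h1 (by positivity)
  refine ((Finset.abs_sum_le_sum_abs _ _).trans (Finset.sum_le_sum hterm)).trans_eq ?_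
  rw [← Finset.sum_mul, ← Nat.cast_sum, Nat.sum_range_choose, Finset.prod_div_distrib,
    Finset.prod_const, Finset.card_range]
  push_cast
  field_simp

end Leibniz

/-! ### Kernels of exponential type, from powers of $\sin x/x$. -/

section ExponentialType

/-- The derivatives of `x ↦ ∫₀¹ cos (t x) dt`. -/
noncomputable def sincDeriv (r : ℕ) (x : ℝ) : ℝ :=
  ∫ t in (0 : ℝ)..1, t ^ r * Real.cos (t * x + r * (Real.pi / 2))

theorem hasDerivAt_sincDeriv (r : ℕ) (x : ℝ) :
    HasDerivAt (sincDeriv r) (sincDeriv (r + 1) x) x := by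
  refine (intervalIntegral.hasDerivAt_integral_of_dominated_loc_of_deriv_le
    (F := fun x t => t ^ r * Real.cos (t * x + r * (Real.pi / 2)))
    (F' := fun x t => t ^ (r + 1) * Real.cos (t * x + (r + 1 : ℕ) * (Real.pi / 2)))
    (s := Set.univ) (bound := fun _ => 1) univ_mem ?_ ?_ ?_ ?_ ?_ ?_).2
  · exact Eventually.of_forall fun y => by fun_prop
  · exact Continuous.intervalIntegrable (by fun_prop) _ _
  · fun_prop
  · refine Eventually.of_forall fun t ht y _ => ?_
    rw [Set.uIoc_of_le zero_le_one] at ht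
    rw [norm_mul, norm_pow, Real.norm_of_nonneg ht.1.le]
    exact mul_le_one₀ (pow_le_one₀ ht.1.le ht.2) (norm_nonneg _) (Real.abs_cos_le_one _)
  · exact intervalIntegrable_const
  · refine Eventually.of_forall fun t _ y _ => ?_
    have h := (((hasDerivAt_id y).const_mul t).add_const (r * (Real.pi / 2))).cos.const_mul (t ^ r)
    refine h.congr_deriv ?_
    rw [show (t * y + (r + 1 : ℕ) * (Real.pi / 2)) = t * y + r * (Real.pi / 2) + Real.pi / 2 by
      push_cast; ring, Real.cos_add_pi_div_two]
    simp only [id]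
    ring

theorem iteratedDeriv_sincDeriv (r : ℕ) : iteratedDeriv r (sincDeriv 0) = sincDeriv r := by
  induction r with
  | zero => rfl
  | succ r ih =>
    rw [iteratedDeriv_succ, ih]
    exact funext fun x => (hasDerivAt_sincDeriv r x).deriv

theorem contDiff_sincDeriv : ContDiff ℝ (⊤ : ℕ∞) (sincDeriv 0) := by
  refine contDiff_of_differentiable_iteratedDeriv fun m _ => ?_
  rw [iteratedDeriv_sincDeriv]
  exact fun x => (hasDerivAt_sincDeriv m x).differentiableAt

/-- One integration by parts gives the decay, uniformly in $r$ because $\int_0^1rt^{r-1}\,dt\le1$.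
-/
theorem abs_sincDeriv_le (r : ℕ) (x : ℝ) : |sincDeriv r x| ≤ 4 / (1 + |x|) := by
  have h1 : |sincDeriv r x| ≤ 1 := by
    have := intervalIntegral.norm_integral_le_of_norm_le_const (a := (0 : ℝ)) (b := 1) (C := 1)
      (f := fun t => t ^ r * Real.cos (t * x + r * (Real.pi / 2))) (fun t ht => by
        rw [Set.uIoc_of_le zero_le_one] at ht
        rw [norm_mul, norm_pow, Real.norm_of_nonneg ht.1.le]
        exact mul_le_one₀ (pow_le_one₀ ht.1.le ht.2) (norm_nonneg _) (Real.abs_cos_le_one _))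
    simpa [sincDeriv] using this
  have h2 : |sincDeriv r x * x| ≤ 3 := by
    set c : ℝ := r * (Real.pi / 2) with hc
    have hd : ∀ t ∈ Set.uIcc (0 : ℝ) 1, HasDerivAt (fun t => Real.sin (t * x + c))
        (Real.cos (t * x + c) * x) t := fun t _ => by
      simpa using (((hasDerivAt_id t).mul_const x).add_const c).sin
    have hd' : ∀ t ∈ Set.uIcc (0 : ℝ) 1, HasDerivAt (fun t : ℝ => t ^ r) (r * t ^ (r - 1)) t :=
      fun t _ => hasDerivAt_pow r t
    have hip := intervalIntegral.integral_mul_deriv_eq_deriv_mul hd' hd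
      (Continuous.intervalIntegrable (by fun_prop) _ _)
      (Continuous.intervalIntegrable (by fun_prop) _ _)
    have h3 : sincDeriv r x * x = ∫ t in (0 : ℝ)..1, t ^ r * (Real.cos (t * x + c) * x) := by
      rw [sincDeriv, ← intervalIntegral.integral_mul_const]
      simp only [mul_assoc, hc]
    have h4 : |∫ t in (0 : ℝ)..1, r * t ^ (r - 1) * Real.sin (t * x + c)| ≤ 1 := by
      have h5 : ∫ t in (0 : ℝ)..1, (r * t ^ (r - 1) : ℝ) ≤ 1 := by
        rw [intervalIntegral.integral_eq_sub_of_hasDerivAt hd'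
          (Continuous.intervalIntegrable (by fun_prop) _ _), one_pow]
        have : (0 : ℝ) ≤ 0 ^ r := pow_nonneg le_rfl r
        linarith
      refine le_trans ?_ h5
      rw [← Real.norm_eq_abs]
      have hi : IntervalIntegrable (fun t : ℝ => (r * t ^ (r - 1) : ℝ)) volume 0 1 :=
        Continuous.intervalIntegrable (by fun_prop) _ _
      refine intervalIntegral.norm_integral_le_of_norm_le zero_le_one
        (Eventually.of_forall fun t ht => ?_) hi
      have h6 : (0 : ℝ) ≤ r * t ^ (r - 1) := mul_nonneg (Nat.cast_nonneg _) (pow_nonneg ht.1.le _)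
      rw [norm_mul, Real.norm_of_nonneg h6]
      exact mul_le_of_le_one_right h6 (Real.abs_sin_le_one _)
    rw [h3, hip, one_pow]
    have h7 : |(0 : ℝ) ^ r * Real.sin (0 * x + c)| ≤ 1 := by
      rw [abs_mul, abs_of_nonneg (pow_nonneg le_rfl r)]
      exact mul_le_one₀ (pow_le_one₀ le_rfl zero_le_one) (abs_nonneg _) (Real.abs_sin_le_one _)
    have h8 : |1 * Real.sin (1 * x + c)| ≤ 1 := by
      rw [one_mul]
      exact Real.abs_sin_le_one _
    calc _ ≤ |1 * Real.sin (1 * x + c)| + |(0 : ℝ) ^ r * Real.sin (0 * x + c)| +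
          |∫ t in (0 : ℝ)..1, r * t ^ (r - 1) * Real.sin (t * x + c)| :=
          (abs_sub _ _).trans (add_le_add (abs_sub _ _) le_rfl)
      _ ≤ 3 := by linarith
  rw [le_div_iff₀ (by positivity)]
  rw [abs_mul] at h2
  linarith

/-- A nonnegative function of exponential type decaying like `|x| ^ (-2 * N)`. -/
theorem exists_exponential_kernel (N : ℕ) : ∃ (φ : ℝ → ℝ) (A C ρ : ℝ), 1 ≤ A ∧ 1 ≤ C ∧ 0 < ρ ∧
    ContDiff ℝ (⊤ : ℕ∞) φ ∧ (∀ x, 0 ≤ φ x) ∧ (∀ x, |x| ≤ ρ → 1 / 2 ≤ φ x) ∧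
    ∀ (i : ℕ) (x : ℝ), |iteratedDeriv i φ x| ≤ C / (1 + |x|) ^ (2 * N) * A ^ i := by
  have key : ∀ n : ℕ, ContDiff ℝ (⊤ : ℕ∞) (sincDeriv 0 ^ n) ∧ ∀ (i : ℕ) (x : ℝ),
      |iteratedDeriv i (sincDeriv 0 ^ n) x| ≤ (4 / (1 + |x|)) ^ n * (2 ^ n) ^ i := by
    intro n
    induction n with
    | zero =>
      refine ⟨by rw [pow_zero]; exact contDiff_const, fun i x => ?_⟩
      rw [pow_zero, pow_zero]
      rcases i with _ | i
      · simp
      · have : iteratedDeriv (i + 1) (1 : ℝ → ℝ) x = 0 := by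
          have h := iteratedDeriv_const (n := i + 1) (c := (1 : ℝ)) (x := x)
          rw [if_neg i.succ_ne_zero] at h
          exact h
        rw [this]
        simp
    | succ n ih =>
      rw [pow_succ']
      refine ⟨contDiff_sincDeriv.mul ih.1, fun i x => ?_⟩
      have := abs_iteratedDeriv_mul_le contDiff_sincDeriv ih.1 (x := x) (F := 4 / (1 + |x|))
        (G := (4 / (1 + |x|)) ^ n) (a := 1) (b := fun _ => 2 ^ n) (ρ := fun _ => 2 ^ (n + 1))
        zero_le_one (fun _ => by positivity)
        (fun i => by
          rw [iteratedDeriv_sincDeriv, one_pow, mul_one]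
          exact abs_sincDeriv_le i x)
        (fun i => by
          rw [Finset.prod_const, Finset.card_range]
          exact ih.2 i x) i
        (fun _ => by rw [mul_one, pow_succ']; nlinarith [one_le_pow₀ (n := n) (one_le_two (α := ℝ))])
        (fun _ => by rw [pow_succ'])
      rw [Finset.prod_const, Finset.card_range] at this
      rwa [pow_succ' (4 / (1 + |x|))]
  obtain ⟨hsm, hbd⟩ := key (2 * N)
  have h0 : (sincDeriv 0 ^ (2 * N)) 0 = 1 := by simp [sincDeriv]
  have hev := hsm.continuous.continuousAt.eventually (lt_mem_nhds (show 1 / 2 < (sincDeriv 0 ^ (2 * N)) 0 by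
    rw [h0]; norm_num))
  obtain ⟨ρ, hρ, hball⟩ := Metric.eventually_nhds_iff_ball.1 hev
  refine ⟨sincDeriv 0 ^ (2 * N), 2 ^ (2 * N), 4 ^ (2 * N), ρ / 2, one_le_pow₀ one_le_two,
    one_le_pow₀ (by norm_num), half_pos hρ, hsm, fun x => ?_, fun x hx => ?_, fun i x => ?_⟩
  · rw [pow_mul]
    exact pow_nonneg (sq_nonneg _) _
  · refine (hball x ?_).le
    rw [mem_ball_zero_iff, Real.norm_eq_abs]
    linarith
  · have := hbd i x
    rwa [div_pow] at this

end ExponentialType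


/-! ### The innermost bump, with two length scales. -/

section Bump

/-- The bump is a normalized product of the exponential-type kernel at scale $l$, which concentrates
the mass, and the Gevrey cutoff at scale $w$, which gives compact support. A derivative falls on one
factor or the other, hence the two conditions on $\rho$. -/
theorem exists_scaled_bump {s : ℝ} (hs : 1 < s) (N : ℕ) : ∃ A B : ℝ, 1 ≤ A ∧ 1 ≤ B ∧
    ∀ l w : ℝ, 0 < l → l ≤ w → ∃ ψ : ℝ → ℝ, ContDiff ℝ (⊤ : ℕ∞) ψ ∧ IsUnitBump w ψ ∧
      ∀ ρ : ℕ → ℝ, (∀ i, A / l ≤ ρ i) → (∀ i : ℕ, A / w * ((i : ℝ) + 1) ^ s ≤ ρ i) →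
        ∀ r x, |iteratedDeriv r ψ x| ≤
          B / l / (1 + |x - w / 2| / l) ^ (2 * N) * ∏ i ∈ Finset.range r, ρ i := by
  obtain ⟨χ, Aχ, hAχ, hχ, hχ0, hχs, hχl, hχd⟩ := exists_gevrey_cutoff hs
  obtain ⟨φ, Aφ, Cφ, ρ, hAφ, hCφ, hρ, hφ, hφ0, hφl, hφd⟩ := exists_exponential_kernel N
  -- Since $l\le w$, the interval of radius $\rho'l$ about $w/2$ lies where both factors are bounded
  -- below, by $1/2$ and $1/8$. The mass before normalization is thus at least $2\rho'l/16$.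
  set ρ' := min ρ (1 / 16) with hρ'
  have hρ'0 : 0 < ρ' := lt_min hρ (by norm_num)
  have hρ'1 : ρ' ≤ 1 / 16 := min_le_right _ _
  refine ⟨2 * max Aφ Aχ, 8 / ρ' * Cφ, ?_, ?_, fun l w hl hlw => ?_⟩
  · linarith [le_max_left Aφ Aχ]
  · have : 1 ≤ 8 / ρ' := by
      rw [le_div_iff₀ hρ'0]
      linarith
    exact one_le_mul_of_one_le_of_one_le this hCφ
  have hw : 0 < w := hl.trans_le hlw
  set f : ℝ → ℝ := fun x => φ (l⁻¹ * (x - w / 2)) with hf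
  set g : ℝ → ℝ := fun x => χ (w⁻¹ * x) with hg
  have hfc : ContDiff ℝ (⊤ : ℕ∞) f :=
    hφ.comp (contDiff_const.mul (contDiff_id.sub contDiff_const))
  have hgc : ContDiff ℝ (⊤ : ℕ∞) g := hχ.comp (contDiff_const.mul contDiff_id)
  have hfd : ∀ i x, iteratedDeriv i f x = (l⁻¹) ^ i * iteratedDeriv i φ (l⁻¹ * (x - w / 2)) := by
    intro i x
    have h1 := iteratedDeriv_comp_const_mul (n := i) (hφ.of_le (by exact_mod_cast le_top)) l⁻¹
    have h2 := iteratedDeriv_comp_sub_const i (fun y => φ (l⁻¹ * y)) (w / 2)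
    rw [h1] at h2
    exact congrFun h2 x
  have hgd : ∀ i x, iteratedDeriv i g x = (w⁻¹) ^ i * iteratedDeriv i χ (w⁻¹ * x) := fun i x =>
    congrFun (iteratedDeriv_comp_const_mul (n := i) (hχ.of_le (by exact_mod_cast le_top)) w⁻¹) x
  have hfg0 : ∀ x, 0 ≤ (f * g) x := fun x => mul_nonneg (hφ0 _) (hχ0 _)
  have hfgc : ContDiff ℝ (⊤ : ℕ∞) (f * g) := hfc.mul hgc
  have hmass : ρ' * l / 8 ≤ ∫ t in 0..w, (f * g) t := by
    have h1 : ρ' * l ≤ w / 16 := by nlinarith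
    have h0 : 0 < ρ' * l := by positivity
    have hle : w / 2 - ρ' * l ≤ w / 2 + ρ' * l := by linarith
    have h2 := intervalIntegral.integral_mono_interval (μ := volume) (f := f * g)
      (c := 0) (d := w) (a := w / 2 - ρ' * l) (b := w / 2 + ρ' * l) (by linarith) hle (by linarith)
      (Eventually.of_forall hfg0) (hfgc.continuous.intervalIntegrable _ _)
    refine le_trans ?_ h2
    have h3 := intervalIntegral.integral_mono_on (μ := volume) (f := fun _ => (1 / 16 : ℝ))
      (g := f * g) hle intervalIntegrable_const (hfgc.continuous.intervalIntegrable _ _) (by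
        intro x hx
        have hx' : |x - w / 2| ≤ ρ' * l := by
          rw [abs_le]
          constructor <;> linarith [hx.1, hx.2]
        have e1 : 1 / 2 ≤ f x := by
          refine hφl _ ?_
          rw [abs_mul, abs_of_pos (inv_pos.2 hl), inv_mul_le_iff₀ hl, mul_comm]
          exact hx'.trans (mul_le_mul_of_nonneg_right (min_le_left _ _) hl.le)
        have e2 : 1 / 8 ≤ g x := by
          refine hχl _ ?_
          have : w⁻¹ * x - 1 / 2 = w⁻¹ * (x - w / 2) := by field_simp
          rw [this, abs_mul, abs_of_pos (inv_pos.2 hw), inv_mul_le_iff₀ hw]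
          linarith
        have e3 := mul_le_mul e1 e2 (by norm_num) (hφ0 _)
        calc (1 / 16 : ℝ) = 1 / 2 * (1 / 8) := by norm_num
          _ ≤ _ := e3)
    rw [intervalIntegral.integral_const, smul_eq_mul] at h3
    linarith
  set I := ∫ t in 0..w, (f * g) t with hI
  have hI0 : 0 < I := lt_of_lt_of_le (by positivity) hmass
  have hIinv : I⁻¹ ≤ 8 / ρ' / l := by
    rw [div_div, inv_le_comm₀ hI0 (by positivity), inv_div]
    exact hmass
  refine ⟨I⁻¹ • (f * g), contDiff_const.smul hfgc, ⟨?_, ?_, ?_, ?_⟩, fun R hR1 hR2 r x => ?_⟩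
  · exact (contDiff_const.smul hfgc).continuous
  · exact fun x => mul_nonneg (inv_pos.2 hI0).le (hfg0 x)
  · intro x hx
    have : g x = 0 := hχs _ fun h => hx ⟨?_, ?_⟩
    · simp [this]
    · exact pos_of_mul_pos_right h.1 (inv_pos.2 hw).le
    · have := h.2
      rwa [inv_mul_lt_iff₀ hw, mul_one] at this
  · simp only [Pi.smul_apply, smul_eq_mul]
    rw [intervalIntegral.integral_const_mul, ← hI, inv_mul_cancel₀ hI0.ne']
  · have hb := abs_iteratedDeriv_mul_le hfc hgc (x := x)
      (F := Cφ / (1 + |x - w / 2| / l) ^ (2 * N)) (G := 1) (a := Aφ / l)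
      (b := fun i : ℕ => Aχ / w * ((i : ℝ) + 1) ^ s) (ρ := R) (by positivity)
      (fun i => by positivity) (fun i => by
        rw [hfd, abs_mul, abs_of_nonneg (by positivity), div_pow]
        refine (mul_le_mul_of_nonneg_left (hφd i _) (by positivity)).trans_eq ?_
        rw [abs_mul, abs_of_pos (inv_pos.2 hl), inv_pow]
        ring) (fun i => by
        rw [hgd, abs_mul, abs_of_nonneg (by positivity), one_mul]
        refine (mul_le_mul_of_nonneg_left (hχd i _) (by positivity)).trans_eq ?_
        simp only [Finset.prod_mul_distrib, Finset.prod_const, Finset.card_range]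
        rw [inv_pow, div_pow]
        ring) r (fun i => by
        refine le_trans ?_ (hR1 i)
        rw [← mul_div_assoc]
        gcongr
        exact le_max_left _ _) (fun i => by
        refine le_trans ?_ (hR2 i)
        rw [← mul_assoc, ← mul_div_assoc]
        gcongr
        exact le_max_right _ _)
    have hs : iteratedDeriv r (I⁻¹ • (f * g)) x = I⁻¹ * iteratedDeriv r (f * g) x :=
      congrFun (iteratedDeriv_smul_of_smooth I⁻¹ (f * g) r) x
    rw [hs, abs_mul, abs_of_pos (inv_pos.2 hI0)]
    have hR0 : 0 ≤ ∏ i ∈ Finset.range r, R i := Finset.prod_nonneg fun i _ =>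
      le_trans (by have := le_max_left Aφ Aχ; positivity) (hR1 i)
    refine (mul_le_mul hIinv hb (abs_nonneg _) (by positivity)).trans_eq ?_
    ring

/-- Scaling: height $B/a$ on width $a$ contributes $B^pa^{1-p}$. The power $2N$ is needed because
for $p<1$ the tails must decay fast to be in $L^p$. -/
theorem lintegral_decay_le {p : ℝ} (hp : 0 < p) {N : ℕ} (hN : 1 < p * (2 * N : ℕ)) :
    ∃ I : ℝ, 0 ≤ I ∧ ∀ (a x₀ B : ℝ) (f : ℝ → ℝ), 0 < a → 0 ≤ B →
      (∀ x, |f x| ≤ B / a / (1 + |x - x₀| / a) ^ (2 * N)) →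
      ∫⁻ x, ‖f x‖ₑ ^ p ≤ ENNReal.ofReal (I * B ^ p * a ^ (1 - p)) := by
  have hint : Integrable (fun x : ℝ => (1 + ‖x‖) ^ (-(p * (2 * N : ℕ)))) volume :=
    integrable_one_add_norm (by simpa using hN)
  set h : ℝ → ℝ := fun x => (1 + ‖x‖) ^ (-(p * (2 * N : ℕ))) with hh
  have h0 : ∀ x, 0 ≤ h x := fun x => by positivity
  refine ⟨∫ x, h x, integral_nonneg h0, fun a x₀ B f ha hB hf => ?_⟩
  have h1 : ∀ x, ‖f x‖ₑ ^ p ≤ ENNReal.ofReal ((B / a) ^ p * h ((x - x₀) / a)) := by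
    intro x
    rw [← ofReal_norm, ENNReal.ofReal_rpow_of_nonneg (norm_nonneg _) hp.le]
    refine ENNReal.ofReal_le_ofReal ?_
    refine (Real.rpow_le_rpow (norm_nonneg _) (hf x) hp.le).trans_eq ?_
    rw [Real.div_rpow (by positivity) (by positivity)]
    simp only [hh]
    rw [Real.rpow_neg (by positivity), norm_div, Real.norm_eq_abs, Real.norm_of_nonneg ha.le,
      mul_comm p, Real.rpow_mul (by positivity), Real.rpow_natCast]
    rfl
  have hI : Integrable (fun x => (B / a) ^ p * h ((x - x₀) / a)) volume :=
    ((hint.comp_div ha.ne').comp_sub_right x₀).const_mul _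
  refine (lintegral_mono h1).trans ?_
  rw [← ofReal_integral_eq_lintegral_ofReal hI
    (Eventually.of_forall fun x => mul_nonneg (by positivity) (h0 _)), integral_const_mul,
    integral_sub_right_eq_self (fun x => h (x / a)) x₀, Measure.integral_comp_div, smul_eq_mul,
    abs_of_pos ha, Real.div_rpow hB ha.le, Real.rpow_sub ha, Real.rpow_one]
  refine ENNReal.ofReal_le_ofReal (le_of_eq ?_)
  ring

/-- Away from the centre, decay at the fine scale $l$ is stronger than decay at the coarse scale
$a$. The factor 5 allows the point of evaluation to be displaced by an averaging window. -/
theorem decay_rescale_le {l a d e : ℝ} (hl : 0 < l) (hla : l ≤ a) (hd : 0 ≤ d) (he : 0 ≤ e)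
    (hde : a + e ≤ 5 * d) (n : ℕ) :
    1 / l / (1 + d / l) ^ (n + 1) ≤ 5 ^ (n + 1) / a / (1 + e / a) ^ (n + 1) := by
  have ha : 0 < a := hl.trans_le hla
  rw [div_div, div_div, div_le_div_iff₀ (by positivity) (by positivity), one_mul]
  have h1 : a * (1 + e / a) ^ (n + 1) ≤ a * (5 * (d / a)) ^ (n + 1) := by
    gcongr
    rw [← mul_div_assoc, le_div_iff₀ ha, add_mul, div_mul_cancel₀ _ ha.ne', one_mul]
    exact hde
  have h2 : a * (d / a) ^ (n + 1) ≤ l * (d / l) ^ (n + 1) := by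
    rw [pow_succ, pow_succ, ← mul_assoc, ← mul_assoc, mul_right_comm, mul_right_comm l,
      mul_div_cancel₀ _ ha.ne', mul_div_cancel₀ _ hl.ne']
    gcongr
  calc _ ≤ _ := h1
    _ = 5 ^ (n + 1) * (a * (d / a) ^ (n + 1)) := by rw [mul_pow]; ring
    _ ≤ 5 ^ (n + 1) * (l * (d / l) ^ (n + 1)) := by gcongr
    _ ≤ 5 ^ (n + 1) * (l * (1 + d / l) ^ (n + 1)) := by gcongr; linarith

end Bump

/-! ### Summability of the box widths of a profile. -/

section Kernel

variable {p : ℝ} {W : ℕ → ℝ} {C C' η K m : ℝ} {β : ℕ → ℝ} {ν : ℕ}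

/-- Increments of at least $\log2$ mean that each width is at most half the preceding one. -/
theorem IsProfile.sum_exp_neg_le (h : IsProfile p W C C' η K m β ν) (j : ℕ) :
    ∀ k, k + j ≤ ν + 1 → ∑ i ∈ Finset.range j, Real.exp (-β (k + i)) ≤ 2 * Real.exp (-β k) := by
  induction j with
  | zero =>
    intro k _
    rw [Finset.sum_range_zero]
    positivity
  | succ j ih =>
    intro k hk
    rw [Finset.sum_range_succ', add_zero]
    have h1 : ∑ i ∈ Finset.range j, Real.exp (-β (k + (i + 1))) =
        ∑ i ∈ Finset.range j, Real.exp (-β (k + 1 + i)) :=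
      Finset.sum_congr rfl fun i _ => by rw [show k + (i + 1) = k + 1 + i by ring]
    rw [h1]
    rcases j with _ | j
    · rw [Finset.sum_range_zero]
      linarith [Real.exp_pos (-β k)]
    · have h2 := ih (k + 1) (by omega)
      have h3 : 2 * Real.exp (-β (k + 1)) ≤ Real.exp (-β k) := by
        nth_rewrite 1 [← Real.exp_log (show (0 : ℝ) < 2 by norm_num)]
        rw [← Real.exp_add, Real.exp_le_exp]
        linarith [h.step k (by omega)]
      linarith

theorem IsProfile.mono (h : IsProfile p W C C' η K m β ν) {i j : ℕ} (hij : i ≤ j) (hj : j ≤ ν) :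
    β i ≤ β j := by
  induction j, hij using Nat.le_induction with
  | base => exact le_rfl
  | succ j hij ih => linarith [ih (by omega), h.step j (by omega), Real.log_pos one_lt_two]

end Kernel


/-! ### Kernels cheap in every derivative at a prescribed scale. -/

section Kernel

/-- A unit bump on `(0, e^{-m} / 2)` with derivatives satisfying `∫ |Φ^(n)|^p ≤ e^{-m} W_n^p`,
together with uniform bounds for its derivatives. -/
structure IsKernel (p : ℝ) (W : ℕ → ℝ) (C C' η K D m : ℝ) (β : ℕ → ℝ) (ν : ℕ) (Φ : ℝ → ℝ) :
    Prop where
  profile : IsProfile p W C C' η K m β ν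
  one_le : 1 ≤ ν
  contDiff : ContDiff ℝ (⊤ : ℕ∞) Φ
  bump : IsUnitBump (Real.exp (-m) / 2) Φ
  lintegral_le : ∀ n, ∫⁻ x, ‖iteratedDeriv n Φ x‖ₑ ^ p ≤
    ENNReal.ofReal (Real.exp (-m + p * Real.log (W n)))
  abs_le : ∀ n ≤ ν, ∀ x, |iteratedDeriv n Φ x| ≤
    2 ^ n * Real.exp (∑ i ∈ Finset.range (n + 1), β i)
  abs_tail_le : ∀ r x, |iteratedDeriv (ν + 1 + r) Φ x| ≤
    2 ^ (ν + 1) * Real.exp (∑ i ∈ Finset.range (ν + 1), β i + (r + 1) * β ν + D * (r + 1) ^ 2)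

theorem sum_range_add_one_le (r : ℕ) : ∑ i ∈ Finset.range r, ((i : ℝ) + 1) ≤ ((r : ℝ) + 1) ^ 2 := by
  induction r with
  | zero => simp
  | succ r ih =>
    rw [Finset.sum_range_succ]
    push_cast
    nlinarith [(Nat.cast_nonneg r : (0 : ℝ) ≤ r)]

variable {p : ℝ} {W : ℕ → ℝ}

theorem prod_exp_logSlope (k r : ℕ) : ∏ i ∈ Finset.range r, Real.exp (logSlope W (k + i)) =
    Real.exp (Real.log (W (k + r)) - Real.log (W k)) := by
  rw [← Real.exp_sum]
  congr 1
  exact Finset.sum_range_sub (fun i => Real.log (W (k + i))) r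

-- The kernel is the iterated average, over widths $e^{-\beta_0},\dots,e^{-\beta_\nu}$, of a bump
-- concentrated at scale $e^{-\beta_\nu}$. For $n\le\nu$, the first $n$ boxes absorb the derivatives
-- and what remains is concentrated at scale $e^{-\beta_n}$; the recursion for $\beta$ is exactly
-- the resulting estimate. Beyond $\nu$, further derivatives fall on the bump and each costs at most
-- the exponential of the current slope of $\log W$, so the cost telescopes.
set_option maxHeartbeats 800000 in
theorem IsDisconnecting.exists_kernel (hW : IsDisconnecting p W) (hp : 0 < p) (hp1 : p < 1)
    (C₀ : ℝ) : ∃ C C' η K D, 0 ≤ C ∧ C₀ ≤ C' ∧ 0 ≤ D ∧ ∀ m, 0 ≤ m →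
      ∃ β ν Φ, IsKernel p W C C' η K D m β ν Φ := by
  obtain ⟨s, hs, hgrowth⟩ := hW.growth
  obtain ⟨n₀, hn₀⟩ := eventually_atTop.1 hgrowth
  obtain ⟨s', hs'1, hs's⟩ := exists_between hs
  obtain ⟨N', hN'⟩ := exists_nat_gt (1 / p)
  set N := N' + 1 with hN
  have hpN : 1 < p * (2 * N : ℕ) := by
    rw [div_lt_iff₀' hp] at hN'
    rw [hN]
    push_cast
    nlinarith [(Nat.cast_nonneg N' : (0 : ℝ) ≤ N')]
  obtain ⟨A, B, hA, hB, hbump⟩ := exists_scaled_bump hs'1 N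
  obtain ⟨I, hI0, hI⟩ := lintegral_decay_le hp hpN
  set B' := B * 5 ^ (2 * N) with hB'
  have hB'1 : 1 ≤ B' := one_le_mul_of_one_le_of_one_le hB (one_le_pow₀ (by norm_num))
  -- The share $s'/s$ of a slope pays for the Gevrey factor $(i+1)^{s'}$. The remaining share $\eta$
  -- pays for $A/w$, which is of size $e^m$.
  set η := 1 - s' / s with hη
  have hη0 : 0 < η := sub_pos.2 ((div_lt_one (by linarith)).2 hs's)
  set C := Real.log A with hC
  have hC0 : 0 ≤ C := Real.log_nonneg hA
  set C' := max C₀ (max (Real.log (4 * A)) (Real.log 8)) with hC'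
  have hC'1 : Real.log (4 * A) ≤ C' := (le_max_left _ _).trans (le_max_right _ _)
  have hC'2 : Real.log 8 ≤ C' := (le_max_right _ _).trans (le_max_right _ _)
  obtain ⟨K₀, hK₀⟩ := hW.exists_profile hp hp1 hC0 C' hη0 (max n₀ 1)
  -- Besides the decay constant, $K$ pays for one extra factor 2: beyond $\nu$ there are $\nu+1$
  -- boxes to differentiate, but the recursion at $\nu$ covers only $\nu$ factors.
  set K := max K₀ (Real.log (I * B' ^ p + 1) + Real.log 2) with hK
  have hKI : Real.log (I * B' ^ p + 1) + Real.log 2 ≤ K := le_max_right _ _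
  have hlB : 0 ≤ Real.log B := Real.log_nonneg hB
  set D := Real.log A + s' + Real.log B with hD
  have hD0 : 0 ≤ D := by linarith
  have hlog2 : 0 < Real.log 2 := Real.log_pos one_lt_two
  refine ⟨C, C', η, K, D, hC0, le_max_left _ _, hD0, fun m hm => ?_⟩
  obtain ⟨β, ν, hν, hβ⟩ := hK₀ K (le_max_left _ _) m hm
  have hmβ : m + Real.log 8 ≤ β ν := by
    linarith [hβ.base, hβ.mono (Nat.zero_le ν) le_rfl]
  set a : ℕ → ℝ := fun i => Real.exp (-β i) with ha
  have ha0 : ∀ i, 0 < a i := fun i => Real.exp_pos _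
  set w := Real.exp (-m) / 4 with hw
  have hw0 : 0 < w := by positivity
  have hexp8 : Real.exp (Real.log 8) = 8 := Real.exp_log (by norm_num)
  have haw : ∀ i ≤ ν, a i ≤ w / 2 := by
    intro i hi
    have h1 : m + Real.log 8 ≤ β i := by
      linarith [hβ.base, hβ.mono (Nat.zero_le i) hi]
    rw [hw, div_div, le_div_iff₀ (by norm_num), show (4 : ℝ) * 2 = 8 by norm_num, ← hexp8,
      ← Real.exp_add, Real.exp_le_exp]
    linarith
  have hAw : A / w = Real.exp (Real.log (4 * A) + m) := by
    rw [Real.exp_add, Real.exp_log (by linarith), hw, Real.exp_neg]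
    field_simp
  have hAl : A / a ν = Real.exp (Real.log A + β ν) := by
    simp only [ha]
    rw [Real.exp_add, Real.exp_log (by linarith), Real.exp_neg, div_inv_eq_mul]
  have hpow : ∀ i : ℕ, ((i : ℝ) + 1) ^ s' = Real.exp (s' * Real.log (i + 1)) := fun i => by
    rw [Real.rpow_def_of_pos (by positivity), mul_comm]
  obtain ⟨ψ, hψ, hψb, hψd⟩ := hbump (a ν) w (ha0 ν) (by linarith [haw ν le_rfl])
  -- The tail of boxes starting at $k$ behaves like a bump at scale $a_k$. Within $4a_k$ of the
  -- centre its outermost average bounds the height. Farther out, the averaging window has length at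
  -- most $2a_k$ and the decay of the bump transfers.
  have hdecay : ∀ k j, k + (j + 1) = ν + 1 → ∀ x, |boxes a k (j + 1) ψ x| ≤
      B' / a k / (1 + |x - w / 2| / a k) ^ (2 * N) := by
    intro k j hkj x
    have hb := hψb.boxes ha0 (j + 1) k
    rw [abs_of_nonneg (hb.nonneg x)]
    have hak := ha0 k
    rcases le_or_gt |x - w / 2| (4 * a k) with hx | hx
    · refine ((hψb.boxes ha0 j (k + 1)).boxAvg_le_inv (ha0 k) x).trans ?_
      rw [inv_eq_one_div, div_right_comm]
      refine div_le_div_of_nonneg_right ?_ hak.le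
      rw [le_div_iff₀ (by positivity), one_mul]
      have h5 : 1 + |x - w / 2| / a k ≤ 5 := by
        have := (div_le_iff₀ hak).2 hx
        linarith
      calc _ ≤ (5 : ℝ) ^ (2 * N) := by gcongr
        _ ≤ B' := le_mul_of_one_le_left (by positivity) hB
    · refine (boxes_le hψ.continuous ha0 (j + 1) k fun y hy => ?_).1
      have hsum := hβ.sum_exp_neg_le (j + 1) k hkj.le
      have hlk : a ν ≤ a k := Real.exp_le_exp.2 (neg_le_neg (hβ.mono (by omega) le_rfl))
      have hy1 := hψd (fun i => max (A / a ν) (A / w * ((i : ℝ) + 1) ^ s'))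
        (fun i => le_max_left _ _) (fun i => le_max_right _ _) 0 y
      rw [Finset.range_zero, Finset.prod_empty, mul_one, iteratedDeriv_zero] at hy1
      refine (le_abs_self _).trans (hy1.trans ?_)
      have hd : a k + |x - w / 2| ≤ 5 * |y - w / 2| := by
        have h1 : |x - w / 2| ≤ |y - w / 2| + 2 * a k := by
          have h2 := abs_sub_le x y (w / 2)
          have h3 : |x - y| ≤ 2 * a k := by
            rw [abs_of_nonneg (by linarith [hy.2])]
            linarith [hy.1]
          linarith
        linarith
      have h2 := decay_rescale_le (ha0 ν) hlk (abs_nonneg (y - w / 2)) (abs_nonneg (x - w / 2)) hd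
        (2 * N' + 1)
      rw [show 2 * N' + 1 + 1 = 2 * N by rw [hN]; ring] at h2
      calc B / a ν / (1 + |y - w / 2| / a ν) ^ (2 * N)
          = B * (1 / a ν / (1 + |y - w / 2| / a ν) ^ (2 * N)) := by ring
        _ ≤ B * (5 ^ (2 * N) / a k / (1 + |x - w / 2| / a k) ^ (2 * N)) := by gcongr
        _ = _ := by rw [hB']; ring
  have hprod : ∀ n, ∏ i ∈ Finset.range n, 2 / a (0 + i) =
      2 ^ n * Real.exp (∑ i ∈ Finset.range n, β i) := by
    intro n
    rw [Real.exp_sum, ← Finset.card_range n, ← Finset.prod_const, Finset.card_range,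
      ← Finset.prod_mul_distrib]
    refine Finset.prod_congr rfl fun i _ => ?_
    simp only [ha]
    rw [zero_add, Real.exp_neg, div_inv_eq_mul]
  have hprodp : ∀ n, ∏ i ∈ Finset.range n, 2 * a (0 + i) ^ (-p) =
      Real.exp (n * Real.log 2 + p * ∑ i ∈ Finset.range n, β i) := by
    intro n
    rw [Real.exp_add, Real.exp_nat_mul, Real.exp_log two_pos, Finset.mul_sum, Real.exp_sum,
      ← Finset.card_range n, ← Finset.prod_const, Finset.card_range, ← Finset.prod_mul_distrib]
    refine Finset.prod_congr rfl fun i _ => ?_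
    simp only [ha]
    rw [zero_add, ← Real.exp_mul]
    congr 2
    ring
  have hIB : I * B' ^ p ≤ Real.exp (K - Real.log 2) := by
    have h1 : 0 ≤ I * B' ^ p := by positivity
    have h2 : Real.exp (Real.log (I * B' ^ p + 1)) ≤ Real.exp (K - Real.log 2) :=
      Real.exp_le_exp.2 (by linarith)
    rw [Real.exp_log (by linarith)] at h2
    linarith
  have hν1 := (le_max_right _ _).trans hν
  replace hν := (le_max_left _ _).trans hν
  refine ⟨β, ν, boxes a 0 (ν + 1) ψ, hβ, hν1, contDiff_boxes hψ _ _, ?_, ?_, ?_, ?_⟩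
  · refine (hψb.boxes ha0 (ν + 1) 0).mono ?_
    have h1 := hβ.sum_exp_neg_le (ν + 1) 0 (by omega)
    have h3 := haw 0 (Nat.zero_le _)
    have h4 : ∑ i ∈ Finset.range (ν + 1), a (0 + i) ≤ 2 * a 0 := h1
    linarith
  · intro n
    rcases le_or_gt n ν with hn | hn
    · obtain ⟨j, rfl⟩ := Nat.exists_eq_add_of_le hn
      have h1 := hI (a n) (w / 2) B' (boxes a n (j + 1) ψ) (ha0 n) (by linarith)
        (hdecay n j (by ring))
      have h2 := lintegral_iteratedDeriv_boxes_le hp hp1 hψ ha0 0 (j + 1) n 0 (by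
        simpa only [iteratedDeriv_zero, zero_add] using h1)
      rw [add_zero, ← add_assoc] at h2
      refine h2.trans ?_
      rw [← ENNReal.ofReal_mul (Finset.prod_nonneg fun i _ => by
        have := Real.rpow_nonneg (ha0 (0 + i)).le (-p); positivity), hprodp]
      refine ENNReal.ofReal_le_ofReal ?_
      have h3 : a n ^ (1 - p) = Real.exp (-β n * (1 - p)) := by rw [ha, ← Real.exp_mul]
      rw [h3]
      refine (mul_le_mul_of_nonneg_left (mul_le_mul_of_nonneg_right hIB (Real.exp_pos _).le)
        (Real.exp_pos _).le).trans ?_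
      rw [← Real.exp_add, ← Real.exp_add, Real.exp_le_exp]
      have h4 := hβ.rec_eq n hn
      have h5 : 0 ≤ p * C * n := by positivity
      linarith
    · obtain ⟨r, rfl⟩ := Nat.exists_eq_add_of_le (show ν + 1 ≤ n from hn)
      have hψr := hψd (fun i => Real.exp (logSlope W (ν + 1 + i))) (fun i => by
          rw [hAl, Real.exp_le_exp]
          have h1 : logSlope W ν ≤ logSlope W (ν + 1 + i) := hW.convex (by omega)
          linarith [hβ.final_le]) (fun i => by
          rw [hAw, hpow, ← Real.exp_add, Real.exp_le_exp]
          have h1 : logSlope W ν ≤ logSlope W (ν + 1 + i) := hW.convex (by omega)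
          have h2 := hn₀ (ν + 1 + i) (by omega)
          have h3 : Real.log ((i : ℝ) + 1) ≤ Real.log (((ν + 1 + i : ℕ) : ℝ) + 1) := by
            refine Real.log_le_log (by positivity) ?_
            push_cast
            linarith [(Nat.cast_nonneg ν : (0 : ℝ) ≤ ν)]
          have h4 : s' * Real.log ((i : ℝ) + 1) ≤ s' / s * logSlope W (ν + 1 + i) := by
            calc _ ≤ s' * Real.log (((ν + 1 + i : ℕ) : ℝ) + 1) := by gcongr
              _ = s' / s * (s * Real.log (((ν + 1 + i : ℕ) : ℝ) + 1)) := by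
                field_simp
              _ ≤ _ := by gcongr
          have h5 := hβ.room
          have h6 := mul_le_mul_of_nonneg_left h1 hη0.le
          have h7 : η * logSlope W (ν + 1 + i) + s' / s * logSlope W (ν + 1 + i) =
            logSlope W (ν + 1 + i) := by rw [hη]; ring
          linarith) r
      rw [prod_exp_logSlope] at hψr
      set P := Real.exp (Real.log (W (ν + 1 + r)) - Real.log (W (ν + 1))) with hP
      have hP0 : 0 < P := Real.exp_pos _
      have h1 := hI (a ν) (w / 2) (B' * P) (iteratedDeriv r ψ) (ha0 ν) (by positivity) (fun x => by
        refine (hψr x).trans ?_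
        rw [div_mul_eq_mul_div, div_mul_eq_mul_div]
        have hν0 := ha0 ν
        gcongr
        exact le_mul_of_one_le_right (by linarith) (one_le_pow₀ (by norm_num)))
      have h2 := lintegral_iteratedDeriv_boxes_le hp hp1 hψ ha0 r 0 (ν + 1) 0 h1
      rw [add_zero] at h2
      refine h2.trans ?_
      rw [← ENNReal.ofReal_mul (Finset.prod_nonneg fun i _ => by
        have := Real.rpow_nonneg (ha0 (0 + i)).le (-p); positivity), hprodp]
      refine ENNReal.ofReal_le_ofReal ?_
      have h3 : a ν ^ (1 - p) = Real.exp (-β ν * (1 - p)) := by rw [ha, ← Real.exp_mul]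
      have h3' : P ^ p = Real.exp (p * Real.log (W (ν + 1 + r)) - p * Real.log (W (ν + 1))) := by
        rw [hP, ← Real.exp_mul]
        congr 1
        ring
      rw [h3, Real.mul_rpow (by linarith) hP0.le, h3', ← mul_assoc I]
      refine (mul_le_mul_of_nonneg_left (mul_le_mul_of_nonneg_right (mul_le_mul_of_nonneg_right hIB
        (Real.exp_pos _).le) (Real.exp_pos _).le) (Real.exp_pos _).le).trans ?_
      rw [← Real.exp_add, ← Real.exp_add, ← Real.exp_add, Real.exp_le_exp,
        Finset.sum_range_succ]
      have h4 := hβ.rec_eq ν le_rfl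
      have h5 : 0 ≤ p * C * ν := by positivity
      have h6 := mul_le_mul_of_nonneg_left hβ.final_le hp.le
      have h7 : 0 ≤ p * C := by positivity
      simp only [logSlope] at h6
      push_cast
      linarith
  · intro n hn x
    obtain ⟨j, rfl⟩ := Nat.exists_eq_add_of_le hn
    have h2 := abs_iteratedDeriv_boxes_le hψ ha0 0 (j + 1) (A := (a n)⁻¹) n 0 (fun x => by
      rw [iteratedDeriv_zero, zero_add, abs_of_nonneg ((hψb.boxes ha0 (j + 1) n).nonneg x)]
      exact (hψb.boxes ha0 j (n + 1)).boxAvg_le_inv (ha0 n) x) x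
    rw [add_zero, ← add_assoc, hprod] at h2
    refine h2.trans_eq ?_
    simp only [ha]
    rw [Real.exp_neg, inv_inv, mul_assoc, ← Real.exp_add, Finset.sum_range_succ]
  · intro r x
    -- For the uniform bounds the cost is expressed through $\beta_\nu$ instead of slopes of $\log
    -- W$, since the comparison argument controls only $\beta$. Replacing $\log(i+1)$ by $i+1$ loses
    -- just a quadratic exponent.
    have hψr := hψd (fun i => Real.exp (β ν + Real.log A + s' * ((i : ℝ) + 1))) (fun i => by
        rw [hAl, Real.exp_le_exp]
        have : 0 ≤ s' * ((i : ℝ) + 1) := by positivity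
        linarith) (fun i => by
        rw [hAw, hpow, ← Real.exp_add, Real.exp_le_exp, Real.log_mul (by norm_num) (by linarith)]
        have h8 : Real.log 4 ≤ Real.log 8 := Real.log_le_log (by norm_num) (by norm_num)
        have h1 : Real.log ((i : ℝ) + 1) ≤ (i : ℝ) + 1 := Real.log_le_self (by positivity)
        have h2 := mul_le_mul_of_nonneg_left h1 (show 0 ≤ s' by linarith)
        linarith) r
    have h1 : ∀ y, |iteratedDeriv r ψ y| ≤
        Real.exp ((r + 1) * β ν + D * (r + 1) ^ 2) := by
      intro y
      refine (hψr y).trans ?_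
      rw [← Real.exp_sum]
      have h3 : B / a ν / (1 + |y - w / 2| / a ν) ^ (2 * N) ≤ Real.exp (Real.log B + β ν) := by
        have := ha0 ν
        refine (div_le_self (by positivity) (one_le_pow₀ ?_)).trans_eq ?_
        · have : 0 ≤ |y - w / 2| / a ν := by positivity
          linarith
        · simp only [ha]
          rw [Real.exp_neg, div_inv_eq_mul, Real.exp_add, Real.exp_log (by linarith)]
      refine (mul_le_mul_of_nonneg_right h3 (Real.exp_pos _).le).trans ?_
      rw [← Real.exp_add, Real.exp_le_exp, Finset.sum_add_distrib, Finset.sum_const,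
        Finset.card_range, nsmul_eq_mul, ← Finset.mul_sum]
      have h4 := mul_le_mul_of_nonneg_left (sum_range_add_one_le r) (show 0 ≤ s' by linarith)
      have hr0 : (0 : ℝ) ≤ r := Nat.cast_nonneg r
      have h5 : (r : ℝ) ≤ (r + 1) ^ 2 := by nlinarith
      have h6 : (1 : ℝ) ≤ (r + 1) ^ 2 := by nlinarith
      have h7 := mul_le_mul_of_nonneg_right h5 hC0
      have h8 := mul_le_mul_of_nonneg_right h6 hlB
      rw [hD, ← hC]
      linarith
    have h2 := abs_iteratedDeriv_boxes_le hψ ha0 r 0 (ν + 1) 0 h1 x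
    rw [add_zero, hprod] at h2
    refine h2.trans_eq ?_
    rw [mul_assoc, ← Real.exp_add, add_assoc]

end Kernel


/-! ### Comparing the derivatives of a function with those of a kernel. -/

section Comparison

variable {p : ℝ} {W : ℕ → ℝ} {C C' η K D : ℝ}

/-- A crude bound with a constant depending on the kernel, adequate when only finitely many scales
occur. -/
theorem IsKernel.exists_abs_le {m : ℝ} {β : ℕ → ℝ} {ν : ℕ} {Φ : ℝ → ℝ}
    (h : IsKernel p W C C' η K D m β ν Φ) (hD : 0 ≤ D) :
    ∃ E, 0 ≤ E ∧ ∀ n x, |iteratedDeriv n Φ x| ≤ Real.exp (E * (n + 1) ^ 2) := by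
  set S := ∑ i ∈ Finset.range (ν + 1), |β i| with hS
  have hS0 : 0 ≤ S := Finset.sum_nonneg fun i _ => abs_nonneg _
  have hpart : ∀ n ≤ ν + 1, ∑ i ∈ Finset.range n, β i ≤ S := fun n hn =>
    (Finset.sum_le_sum fun i _ => le_abs_self _).trans
      (Finset.sum_le_sum_of_subset_of_nonneg (Finset.range_mono hn) fun i _ _ => abs_nonneg _)
  have hβν : β ν ≤ S := (le_abs_self _).trans (Finset.single_le_sum (f := fun i => |β i|)
    (fun i _ => abs_nonneg _) (Finset.self_mem_range_succ ν))
  have h2 : ∀ n : ℕ, (2 : ℝ) ^ n = Real.exp (n * Real.log 2) := fun n => by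
    rw [Real.exp_nat_mul, Real.exp_log two_pos]
  have hl : Real.log 2 ≤ 1 := by
    have := Real.log_le_sub_one_of_pos (show (0 : ℝ) < 2 by norm_num)
    linarith
  refine ⟨2 * S + D + 1, by linarith, fun n x => ?_⟩
  have hn0 : (0 : ℝ) ≤ n := Nat.cast_nonneg n
  have hn1 : (1 : ℝ) ≤ (n + 1) ^ 2 := by nlinarith
  have hn2 : (n : ℝ) + 1 ≤ (n + 1) ^ 2 := by nlinarith
  rcases le_or_gt n ν with hn | hn
  · refine (h.abs_le n hn x).trans ?_
    rw [h2, ← Real.exp_add, Real.exp_le_exp]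
    have h3 := hpart (n + 1) (by omega)
    nlinarith
  · obtain ⟨r, rfl⟩ := Nat.exists_eq_add_of_le (show ν + 1 ≤ n from hn)
    refine (h.abs_tail_le r x).trans ?_
    rw [h2, ← Real.exp_add, Real.exp_le_exp]
    have h3 := hpart (ν + 1) le_rfl
    push_cast at hn0 hn1 hn2 ⊢
    have hr : (0 : ℝ) ≤ r := Nat.cast_nonneg r
    have hν : (0 : ℝ) ≤ ν := Nat.cast_nonneg ν
    have h4 : ((r : ℝ) + 1) ^ 2 ≤ (ν + 1 + r + 1) ^ 2 := by gcongr; linarith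
    have h5 := mul_le_mul_of_nonneg_left h4 hD
    have h6 : ((r : ℝ) + 1) * β ν ≤ (ν + 1 + r + 1) ^ 2 * S := by
      calc ((r : ℝ) + 1) * β ν ≤ (r + 1) * S := by gcongr
        _ ≤ _ := by gcongr; linarith
    have h7 := mul_le_mul_of_nonneg_right hn1 hS0
    have h8 : ((ν : ℝ) + 1) * Real.log 2 ≤ ν + 1 := by nlinarith
    linarith

/-- The sequence of inequalities satisfied by the suprema of the derivatives of a function on an
interval of length `e^{-m}`, with `Y 0` the integral of its absolute value. -/
structure IsDerivBounds (p m : ℝ) (Y μ : ℕ → ℝ) : Prop where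
  nonneg : ∀ n, 0 ≤ Y n
  nonneg' : ∀ n, 0 ≤ μ n
  zero_le : Y 0 ≤ μ 0 * Y 1 ^ (1 - p)
  succ_le : ∀ n, Y (n + 1) ≤ 2 * Real.exp m * Y n + μ (n + 1) * Y (n + 2) ^ (1 - p)
  landau : ∀ n, 0 < Y (n + 1) → 8 * Real.exp m * Y (n + 1) < Y (n + 2) →
    Y (n + 2) ^ 2 ≤ 8 * Y (n + 1) * Y (n + 3)

/-- The inequality $Y_n\le2\mu_nY_{n+1}^{1-p}$, in logarithms and with $\mu_n$ bounded by $W_n^pN$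
up to weights, is the recursion for $\beta$ read as a lower bound. Largeness of $Y_0$ starts the
induction with a surplus. -/
theorem IsProfile.growth_of_derivBounds (hp : 0 < p) (hp1 : p < 1) (hC : 0 ≤ C)
    (hC' : Real.log 8 ≤ C') {m N : ℝ} {β : ℕ → ℝ} {ν : ℕ}
    (h : IsProfile p W C C' η K m β ν) {Y μ : ℕ → ℝ} (hY : IsDerivBounds p m Y μ)
    (hμ : ∀ n, (1 - p) ^ n * μ n ≤ Real.exp (p * Real.log (W n)) * N) (hc : 0 < Y 0)
    (hN : Real.exp (Real.log 2 + K + (p * C + Real.log 2 + Real.log (1 - p)⁻¹) / p) * N <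
      Real.exp (-m) * Y 0 ^ p) :
    (∀ n ≤ ν + 1, Y 0 * Real.exp (∑ i ∈ Finset.range n, β i) ≤ Y n) ∧
      ∀ n ≤ ν, Real.exp (β n) * Y n ≤ Y (n + 1) := by
  have hq : 0 < 1 - p := by linarith
  -- The last term pays for the weights $(1-p)^n$. The surplus $(\kappa/p)n$ carried in the
  -- induction reproduces itself after division by $1-p$.
  set κ := p * C + Real.log 2 + Real.log (1 - p)⁻¹ with hκ
  have hl2 : 0 < Real.log 2 := Real.log_pos one_lt_two
  have hlq : 0 < Real.log (1 - p)⁻¹ := Real.log_pos ((one_lt_inv₀ hq).2 (by linarith))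
  have hκ0 : 0 < κ := by positivity
  have hκp : 0 < κ / p := by positivity
  have hl8 : Real.log 8 = 2 * Real.log 2 + Real.log 2 := by
    rw [show (8 : ℝ) = 2 ^ 3 by norm_num, Real.log_pow]
    push_cast
    ring
  have key : ∀ n ≤ ν + 1, 0 < Y n ∧
      Real.log (Y 0) + ∑ i ∈ Finset.range n, β i + κ / p * n ≤ Real.log (Y n) ∧
      ∀ k < n, β k + Real.log (Y k) ≤ Real.log (Y (k + 1)) := by
    intro n
    induction n with
    | zero => exact fun _ => ⟨hc, by simp, fun k hk => absurd hk (Nat.not_lt_zero k)⟩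
    | succ n ih =>
      intro hn
      obtain ⟨hYn, hd, hsl⟩ := ih (by omega)
      have h2 : Y n ≤ 2 * (μ n * Y (n + 1) ^ (1 - p)) := by
        rcases n with _ | n
        · have := hY.zero_le
          linarith
        · have h3 := hY.succ_le n
          have h4 := hsl n (Nat.lt_succ_self n)
          have h5 := h.mono (Nat.zero_le n) (by omega)
          -- The previous step gave a ratio of at least $e^{\beta_n}\ge8e^m$, so the boundary term
          -- is at most half of $Y_{n+1}$ and can be moved to the left.
          have h6 : 4 * Real.exp m * Y n ≤ Y (n + 1) := by
            rcases (hY.nonneg n).eq_or_lt with h0 | h0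
            · rw [← h0, mul_zero]
              exact hYn.le
            rw [← Real.log_le_log_iff (by positivity) hYn, Real.log_mul (by positivity) h0.ne',
              Real.log_mul (by norm_num) (Real.exp_pos _).ne', Real.log_exp,
              show (4 : ℝ) = 2 ^ 2 by norm_num, Real.log_pow]
            push_cast
            linarith [h.base]
          linarith
      have hprod : 0 < μ n * Y (n + 1) ^ (1 - p) := by linarith
      have hμn : 0 < μ n := (hY.nonneg' n).lt_of_ne fun h0 => by simp [← h0] at hprod
      have hYq : 0 < Y (n + 1) ^ (1 - p) := pos_of_mul_pos_right hprod hμn.le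
      have hYs : 0 < Y (n + 1) := (hY.nonneg _).lt_of_ne fun h0 => by
        rw [← h0, Real.zero_rpow hq.ne'] at hYq
        exact lt_irrefl _ hYq
      have hN0 : 0 < N := pos_of_mul_pos_right ((mul_pos (pow_pos hq n) hμn).trans_le (hμ n))
        (Real.exp_pos _).le
      have e1 := Real.log_le_log hYn h2
      rw [Real.log_mul two_ne_zero hprod.ne', Real.log_mul hμn.ne' hYq.ne', Real.log_rpow hYs] at e1
      have e2 := Real.log_le_log (mul_pos (pow_pos hq n) hμn) (hμ n)
      rw [Real.log_mul (pow_pos hq n).ne' hμn.ne', Real.log_mul (Real.exp_pos _).ne' hN0.ne',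
        Real.log_exp, Real.log_pow] at e2
      have e3 := Real.log_lt_log (by positivity) hN
      rw [Real.log_mul (Real.exp_pos _).ne' hN0.ne', Real.log_exp,
        Real.log_mul (Real.exp_pos _).ne' (Real.rpow_pos_of_pos hc _).ne', Real.log_exp,
        Real.log_rpow hc] at e3
      have e4 := h.rec_eq n (by omega)
      have e5 : Real.log (1 - p) = -Real.log (1 - p)⁻¹ := by rw [Real.log_inv, neg_neg]
      rw [e5] at e2
      have hn0 : (0 : ℝ) ≤ n := Nat.cast_nonneg n
      set Bn := ∑ i ∈ Finset.range n, β i with hBn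
      have e6 : Real.log (Y n) - Real.log (Y 0) - Bn + κ / p - κ * n ≤
          (1 - p) * (Real.log (Y (n + 1)) - Real.log (Y 0) - Bn - β n) := by
        have e7 : κ * n = (p * C + Real.log 2) * n + n * Real.log (1 - p)⁻¹ := by rw [hκ]; ring
        rw [e7]
        linarith
      have e8 : p * (κ / p) = κ := mul_div_cancel₀ _ hp.ne'
      have e9 : κ / p * n ≤ Real.log (Y n) - Real.log (Y 0) - Bn := by linarith
      have e10 : κ * n ≤ p * (Real.log (Y n) - Real.log (Y 0) - Bn) := by
        have := mul_le_mul_of_nonneg_left e9 hp.le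
        rwa [← mul_assoc, e8] at this
      have hstep : β n + Real.log (Y n) ≤ Real.log (Y (n + 1)) := by
        have : (1 - p) * (Real.log (Y n) - Real.log (Y 0) - Bn) ≤
          (1 - p) * (Real.log (Y (n + 1)) - Real.log (Y 0) - Bn - β n) := by linarith
        have := le_of_mul_le_mul_left this hq
        linarith
      refine ⟨hYs, ?_, fun k hk => ?_⟩
      · rw [Finset.sum_range_succ, ← hBn]
        push_cast
        have : (1 - p) * (κ / p * (n + 1)) ≤
          (1 - p) * (Real.log (Y (n + 1)) - Real.log (Y 0) - Bn - β n) := by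
          have e11 : (1 - p) * (κ / p * (n + 1)) = κ / p * n - κ * n + κ / p - κ := by
            linear_combination (-((n : ℝ) + 1)) * e8
          rw [e11]
          linarith
        have := le_of_mul_le_mul_left this hq
        linarith
      · rcases Nat.lt_succ_iff_lt_or_eq.1 hk with hk | rfl
        · exact hsl k hk
        · exact hstep
  constructor
  · intro n hn
    obtain ⟨h1, h2, -⟩ := key n hn
    have h3 : 0 ≤ κ / p * n := by positivity
    have h4 := Real.exp_le_exp.2 (show Real.log (Y 0) + ∑ i ∈ Finset.range n, β i ≤
      Real.log (Y n) by linarith)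
    rwa [Real.exp_add, Real.exp_log hc, Real.exp_log h1] at h4
  · intro n hn
    obtain ⟨h1, -, h2⟩ := key (n + 1) (by omega)
    have h3 := Real.exp_le_exp.2 (h2 n (Nat.lt_succ_self n))
    rwa [Real.exp_add, Real.exp_log (key n (by omega)).1, Real.exp_log h1] at h3

/-- Landau's inequality says that the ratio of consecutive suprema drops by at most a factor 8 per
step, as long as it exceeds $8e^m$. Multiplying the ratios leaves only a quadratic loss in the
exponent. -/
theorem IsDerivBounds.landau_growth {m b : ℝ} {Y μ : ℕ → ℝ} (hY : IsDerivBounds p m Y μ) {k : ℕ}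
    (hk : 0 < Y (k + 1)) (hb : Real.exp b * Y (k + 1) ≤ Y (k + 2)) (r : ℕ)
    (hr : m + (r + 2) * Real.log 8 ≤ b) :
    0 < Y (k + 1 + r) ∧ Real.exp (b - r * Real.log 8) * Y (k + 1 + r) ≤ Y (k + 2 + r) ∧
      Real.exp (r * b - Real.log 8 * r ^ 2) * Y (k + 2) ≤ Y (k + 2 + r) := by
  have hl8 : 0 < Real.log 8 := Real.log_pos (by norm_num)
  have he8 : Real.exp (Real.log 8) = 8 := Real.exp_log (by norm_num)
  induction r with
  | zero => simpa using ⟨hk, hb⟩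
  | succ r ih =>
    push_cast at hr ⊢
    have hr0 : (0 : ℝ) ≤ r := Nat.cast_nonneg r
    obtain ⟨h1, h2, h3⟩ := ih (by nlinarith)
    have h4 : 0 < Y (k + 2 + r) := (mul_pos (Real.exp_pos _) h1).trans_le h2
    have h5 : 8 * Real.exp m * Y (k + 1 + r) < Y (k + 2 + r) := by
      refine lt_of_lt_of_le ?_ h2
      refine mul_lt_mul_of_pos_right ?_ h1
      have e1 : 8 * Real.exp m = Real.exp (Real.log 8 + m) := by rw [Real.exp_add, he8]
      rw [e1, Real.exp_lt_exp]
      nlinarith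
    have h6 := hY.landau (k + r) (by rwa [add_right_comm] at h1) (by
      rwa [show k + r + 1 = k + 1 + r by ring, show k + r + 2 = k + 2 + r by ring])
    rw [show k + r + 1 = k + 1 + r by ring, show k + r + 2 = k + 2 + r by ring,
      show k + r + 3 = k + 2 + (r + 1) by ring] at h6
    have h7 : Real.exp (b - (r + 1) * Real.log 8) * Y (k + 2 + r) ≤ Y (k + 2 + (r + 1)) := by
      have e1 : Real.exp (b - r * Real.log 8) = Real.exp (b - (r + 1) * Real.log 8) * 8 := by
        have e2 : Real.exp (b - r * Real.log 8) =
            Real.exp (b - (r + 1) * Real.log 8) * Real.exp (Real.log 8) := by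
          rw [← Real.exp_add]
          congr 1
          ring
        rwa [he8] at e2
      rw [e1] at h2
      have h8 : 8 * Y (k + 1 + r) * (Real.exp (b - (r + 1) * Real.log 8) * Y (k + 2 + r)) ≤
          8 * Y (k + 1 + r) * Y (k + 2 + (r + 1)) := by
        refine le_trans ?_ h6
        nlinarith
      exact le_of_mul_le_mul_left h8 (by positivity)
    refine ⟨by rwa [show k + 1 + (r + 1) = k + 2 + r by ring],
      by rwa [show k + 1 + (r + 1) = k + 2 + r by ring], ?_⟩
    refine le_trans ?_ h7
    refine le_trans ?_ (mul_le_mul_of_nonneg_left h3 (Real.exp_pos _).le)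
    rw [← mul_assoc, ← Real.exp_add]
    refine mul_le_mul_of_nonneg_right (Real.exp_le_exp.2 ?_) (hY.nonneg _)
    nlinarith

/-- If a function on an interval of length `e^{-m}` has too large an integral to be charged to
the norms of its derivatives, then its derivatives dominate those of the kernel. -/
theorem exists_kernel_comparison (hp : 0 < p) (hp1 : p < 1) (hC : 0 ≤ C) (hC' : Real.log 8 ≤ C')
    (hD : 0 ≤ D) : ∃ C₀ E, 0 < C₀ ∧ 0 ≤ E ∧ ∀ m β ν Φ, IsKernel p W C C' η K D m β ν Φ → ∀ Y μ N,
      IsDerivBounds p m Y μ → (∀ n, (1 - p) ^ n * μ n ≤ Real.exp (p * Real.log (W n)) * N) →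
      C₀ * N < Real.exp (-m) * Y 0 ^ p → ∀ n x, Y 0 * |iteratedDeriv n Φ x| ≤
        (1 + ∑ i ∈ Finset.range (n + 1), Y (i + 1)) * Real.exp (E * (n + 1) ^ 2) := by
  have hl8 : 0 < Real.log 8 := Real.log_pos (by norm_num)
  set F := (|K| + |p * Real.log (W 0)| + Real.log 8) / p with hF
  have hF0 : 0 ≤ F := by positivity
  have hl : Real.log 2 ≤ 1 := by
    have := Real.log_le_sub_one_of_pos (show (0 : ℝ) < 2 by norm_num)
    linarith
  have hl20 : 0 < Real.log 2 := Real.log_pos one_lt_two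
  set E := 1 + D + Real.log 8 + 3 * F with hE
  refine ⟨Real.exp (Real.log 2 + K + (p * C + Real.log 2 + Real.log (1 - p)⁻¹) / p), E,
    Real.exp_pos _, by positivity, fun m β ν Φ hΦ Y μ N hY hμ hN n x => ?_⟩
  have hsum0 : 0 ≤ ∑ i ∈ Finset.range (n + 1), Y (i + 1) := Finset.sum_nonneg fun i _ => hY.nonneg _
  rcases (hY.nonneg 0).eq_or_lt with h0 | hc
  · rw [← h0, zero_mul]
    positivity
  have h2 : ∀ n : ℕ, (2 : ℝ) ^ n = Real.exp (n * Real.log 2) := fun n => by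
    rw [Real.exp_nat_mul, Real.exp_log two_pos]
  obtain ⟨hg1, hg2⟩ := hΦ.profile.growth_of_derivBounds hp hp1 hC hC' hY hμ hc hN
  have hle : ∀ k ≤ n, Y (k + 1) ≤ 1 + ∑ i ∈ Finset.range (n + 1), Y (i + 1) := by
    intro k hk
    have := Finset.single_le_sum (f := fun i => Y (i + 1)) (fun i _ => hY.nonneg (i + 1))
      (Finset.mem_range.2 (Nat.lt_succ_of_le hk))
    linarith
  have hn0 : (0 : ℝ) ≤ n := Nat.cast_nonneg n
  rcases le_or_gt n ν with hn | hn
  · calc Y 0 * |iteratedDeriv n Φ x|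
        ≤ Y 0 * (2 ^ n * Real.exp (∑ i ∈ Finset.range (n + 1), β i)) := by
          gcongr
          exact hΦ.abs_le n hn x
      _ = (Y 0 * Real.exp (∑ i ∈ Finset.range (n + 1), β i)) * 2 ^ n := by ring
      _ ≤ (1 + ∑ i ∈ Finset.range (n + 1), Y (i + 1)) * Real.exp (E * (n + 1) ^ 2) := by
          refine mul_le_mul ((hg1 (n + 1) (by omega)).trans (hle n le_rfl)) ?_ (by positivity)
            (by positivity)
          rw [h2, Real.exp_le_exp]
          have h3 : (n : ℝ) * Real.log 2 ≤ (n + 1) ^ 2 := by nlinarith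
          have h4 : (1 : ℝ) * (n + 1) ^ 2 ≤ E * (n + 1) ^ 2 := by
            gcongr
            rw [hE]
            linarith
          linarith
  · obtain ⟨r, rfl⟩ := Nat.exists_eq_add_of_le (show ν + 1 ≤ n from hn)
    have hr0 : (0 : ℝ) ≤ r := Nat.cast_nonneg r
    have hν0 : (0 : ℝ) ≤ ν := Nat.cast_nonneg ν
    have hsq : ((r : ℝ) + 1) ^ 2 ≤ (ν + 1 + r + 1) ^ 2 := by gcongr; linarith
    have hνsq : ((ν : ℝ) + 1) * Real.log 2 ≤ (ν + 1 + r + 1) ^ 2 := by nlinarith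
    have hmain : ∀ X G : ℝ, 0 ≤ G → G ≤ Real.log 8 + 3 * F →
        Y 0 * Real.exp (∑ i ∈ Finset.range (ν + 1), β i) * Real.exp ((r + 1) * β ν) ≤
          X * Real.exp (G * (r + 1) ^ 2) →
        0 ≤ X → X ≤ 1 + ∑ i ∈ Finset.range (ν + 1 + r + 1), Y (i + 1) →
        Y 0 * |iteratedDeriv (ν + 1 + r) Φ x| ≤
          (1 + ∑ i ∈ Finset.range (ν + 1 + r + 1), Y (i + 1)) *
            Real.exp (E * ((ν + 1 + r : ℕ) + 1) ^ 2) := by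
      intro X G hG0 hG hX1 hX0 hX
      calc Y 0 * |iteratedDeriv (ν + 1 + r) Φ x| ≤ Y 0 * (2 ^ (ν + 1) *
            Real.exp (∑ i ∈ Finset.range (ν + 1), β i + (r + 1) * β ν + D * (r + 1) ^ 2)) := by
            gcongr
            exact hΦ.abs_tail_le r x
        _ = (Y 0 * Real.exp (∑ i ∈ Finset.range (ν + 1), β i) * Real.exp ((r + 1) * β ν)) *
            (2 ^ (ν + 1) * Real.exp (D * (r + 1) ^ 2)) := by
            rw [Real.exp_add, Real.exp_add]; ring
        _ ≤ X * Real.exp (G * (r + 1) ^ 2) * (2 ^ (ν + 1) * Real.exp (D * (r + 1) ^ 2)) := by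
            gcongr
        _ = X * Real.exp (G * (r + 1) ^ 2 + (ν + 1) * Real.log 2 + D * (r + 1) ^ 2) := by
            rw [Real.exp_add, Real.exp_add, h2]
            push_cast
            ring
        _ ≤ _ := by
            refine mul_le_mul hX (Real.exp_le_exp.2 ?_) (Real.exp_pos _).le (by positivity)
            push_cast
            have h3 : (G + D) * ((r : ℝ) + 1) ^ 2 ≤ (Real.log 8 + 3 * F + D) * (ν + 1 + r + 1) ^ 2 :=
              mul_le_mul (by linarith) hsq (by positivity) (by positivity)
            rw [hE]
            linarith
    obtain ⟨k, hk⟩ := Nat.exists_eq_add_of_le hΦ.one_le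
    have hYν : Y 0 * Real.exp (∑ i ∈ Finset.range (ν + 1), β i) ≤ Y (ν + 1) := hg1 (ν + 1) le_rfl
    -- Beyond $\nu$, either $\beta_\nu$ is large enough for Landau growth to supply the factor
    -- $e^{(r+1)\beta_\nu}$, or $\beta_\nu=O(r+1)$ and this factor is itself within
    -- $e^{O((r+1)^2)}$.
    rcases le_or_gt (m + (((r + 1 : ℕ) : ℝ) + 2) * Real.log 8) (β ν) with hb | hb
    · have hpos : 0 < Y (k + 1) := by
        refine (mul_pos hc (Real.exp_pos _)).trans_le (hg1 (k + 1) (by omega))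
      have h3 := (hY.landau_growth hpos (b := β ν) (by
        have := hg2 ν le_rfl
        rw [show k + 1 = ν by omega, show k + 2 = ν + 1 by omega]
        exact this) (r + 1) hb).2.2
      rw [show k + 2 + (r + 1) = ν + 1 + r + 1 by omega, show k + 2 = ν + 1 by omega] at h3
      push_cast at h3
      refine hmain (Y (ν + 1 + r + 1)) (Real.log 8) hl8.le (by linarith) ?_ (hY.nonneg _)
        (hle _ le_rfl)
      calc _ ≤ Y (ν + 1) * Real.exp ((r + 1) * β ν) := by gcongr
        _ = (Real.exp ((r + 1) * β ν - Real.log 8 * (r + 1) ^ 2) * Y (ν + 1)) *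
            Real.exp (Real.log 8 * (r + 1) ^ 2) := by
            rw [mul_right_comm, ← Real.exp_add, sub_add_cancel, mul_comm]
        _ ≤ _ := by gcongr
    · push_cast at hb
      -- The recursion at $0$ gives $m\le(1-p)\beta_\nu+O(1)$. Inserted into $\beta_\nu<m+O(r+1)$,
      -- it leaves $p\beta_\nu=O(r+1)$ with constants independent of $m$.
      have h3 : β ν ≤ F * (r + 3) := by
        have e1 := hΦ.profile.rec_eq 0 (Nat.zero_le _)
        have e2 := hΦ.profile.mono (Nat.zero_le ν) le_rfl
        rw [Finset.range_zero, Finset.sum_empty] at e1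
        push_cast at e1
        have e3 := neg_abs_le K
        have e4 := neg_abs_le (p * Real.log (W 0))
        have e4' := le_abs_self (p * Real.log (W 0))
        have e5 : (1 - p) * β 0 ≤ (1 - p) * β ν := mul_le_mul_of_nonneg_left e2 (by linarith)
        have e6 : p * β ν ≤ |K| + |p * Real.log (W 0)| + (r + 3) * Real.log 8 := by linarith
        rw [hF, div_mul_eq_mul_div, le_div_iff₀ hp]
        have e7 : 0 ≤ (|K| + |p * Real.log (W 0)|) * (r + 2) := by positivity
        linarith
      refine hmain (Y (ν + 1)) (3 * F) (by positivity) (by linarith) ?_ (hY.nonneg _)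
        (hle ν (by omega))
      refine mul_le_mul hYν (Real.exp_le_exp.2 ?_) (Real.exp_pos _).le (hY.nonneg _)
      have h4 : ((r : ℝ) + 1) * β ν ≤ (r + 1) * (F * (r + 3)) := by gcongr
      nlinarith [mul_nonneg hF0 hr0, mul_nonneg (mul_nonneg hF0 hr0) hr0]

end Comparison


/-! ### Derivative inequalities on an interval. -/

section Intervals

variable {𝕜 : Type*} [RCLike 𝕜] {a h : ℝ}

/-- Compare $u$ with its tangent over a step $t$: $t\|u'(x)\|\le2S_0+S_2t^2$. The choice
$t=4S_0/\|u'(x)\|$ makes the left side $4S_0$, and the lower bound on $\|u'(x)\|$ makes $t<h/2$, so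
that one of $x\pm t$ lies in the interval. -/
theorem landau_inequality {u u' : ℝ → 𝕜} (hu : ∀ x, HasDerivAt u (u' x) x) {u'' : ℝ → 𝕜}
    (hu' : ∀ x, HasDerivAt u' (u'' x) x) (hh : 0 < h) {x S₀ S₂ : ℝ}
    (hx : x ∈ Set.Icc a (a + h)) (hS₀ : 0 < S₀) (h₀ : ∀ y ∈ Set.Icc a (a + h), ‖u y‖ ≤ S₀)
    (h₂ : ∀ y ∈ Set.Icc a (a + h), ‖u'' y‖ ≤ S₂) (hlt : 8 * h⁻¹ * S₀ < ‖u' x‖) :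
    ‖u' x‖ ^ 2 ≤ 8 * S₀ * S₂ := by
  set S₁ := ‖u' x‖ with hS₁
  have hS₁0 : 0 < S₁ := lt_of_le_of_lt (by positivity) hlt
  have hS₂ : 0 ≤ S₂ := (norm_nonneg _).trans (h₂ x hx)
  set t := 4 * S₀ / S₁ with ht
  have ht0 : 0 < t := by positivity
  have hth : t < h / 2 := by
    rw [ht, div_lt_iff₀ hS₁0]
    have := mul_lt_mul_of_pos_left hlt hh
    rw [show h * (8 * h⁻¹ * S₀) = 8 * S₀ * (h * h⁻¹) by ring, mul_inv_cancel₀ hh.ne'] at this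
    linarith
  obtain ⟨y, hy, hyt⟩ : ∃ y ∈ Set.Icc a (a + h), |y - x| = t := by
    rcases le_or_gt x (a + h / 2) with h1 | h1
    · exact ⟨x + t, ⟨by linarith [hx.1], by linarith⟩, by rw [add_sub_cancel_left, abs_of_pos ht0]⟩
    · exact ⟨x - t, ⟨by linarith, by linarith [hx.2]⟩, by
        rw [sub_sub_cancel_left, abs_neg, abs_of_pos ht0]⟩
  have hconv : Convex ℝ (Set.Icc a (a + h) ∩ Set.Icc (x - t) (x + t)) :=
    (convex_Icc _ _).inter (convex_Icc _ _)
  have hmem : ∀ z, |z - x| ≤ t → z ∈ Set.Icc (x - t) (x + t) := fun z hz => by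
    rw [abs_le] at hz
    constructor <;> linarith
  have h3 := hconv.norm_image_sub_le_of_norm_hasDerivWithin_le
    (f := fun z => u z - (z : ℝ) • u' x) (f' := fun z => u' z - u' x) (C := S₂ * t) (x := x) (y := y)
    (fun z _ => ((hu z).sub (by simpa using (hasDerivAt_id z).smul_const (u' x))).hasDerivWithinAt)
    (fun z hz => by
      have h4 := (convex_Icc a (a + h)).norm_image_sub_le_of_norm_hasDerivWithin_le
        (fun w _ => (hu' w).hasDerivWithinAt) h₂ hx hz.1
      refine h4.trans (mul_le_mul_of_nonneg_left ?_ hS₂)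
      rw [Real.norm_eq_abs, abs_le]
      constructor <;> linarith [hz.2.1, hz.2.2])
    ⟨hx, hmem x (by simpa using ht0.le)⟩ ⟨hy, hmem y hyt.le⟩
  have h5 : t * S₁ ≤ 2 * S₀ + S₂ * t * t := by
    have e1 : (y - x) • u' x = (u y - u x) - ((u y - y • u' x) - (u x - x • u' x)) := by
      rw [sub_smul]
      abel
    have e2 : ‖(y - x) • u' x‖ = t * S₁ := by rw [norm_smul, Real.norm_eq_abs, hyt]
    rw [← e2, e1]
    refine (norm_sub_le _ _).trans (add_le_add ?_ ?_)
    · refine (norm_sub_le _ _).trans ?_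
      linarith [h₀ y hy, h₀ x hx]
    · refine h3.trans_eq ?_
      rw [Real.norm_eq_abs, hyt]
  have h6 : t * S₁ = 4 * S₀ := by rw [ht]; field_simp
  have h7 : 2 * S₀ ≤ S₂ * t * t := by linarith
  have h8 : 2 * S₀ * S₁ ^ 2 ≤ S₂ * (t * S₁) ^ 2 := by nlinarith [sq_nonneg S₁]
  rw [h6] at h8
  have h9 : 2 * S₀ * S₁ ^ 2 ≤ 2 * S₀ * (8 * S₀ * S₂) := by linarith
  exact le_of_mul_le_mul_left h9 (by positivity)

theorem norm_sub_le_integral_norm_deriv {v v' : ℝ → 𝕜} (hv : ∀ x, HasDerivAt v (v' x) x)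
    (hv' : Continuous v') {b x y : ℝ} (hab : a ≤ b) (hx : x ∈ Set.Icc a b) (hy : y ∈ Set.Icc a b) :
    ‖v x - v y‖ ≤ ∫ t in a..b, ‖v' t‖ := by
  rw [← intervalIntegral.integral_eq_sub_of_hasDerivAt (fun t _ => hv t)
    (hv'.intervalIntegrable _ _)]
  refine intervalIntegral.norm_integral_le_integral_norm_uIoc.trans ?_
  rw [intervalIntegral.integral_of_le hab]
  refine setIntegral_mono_set (hv'.norm.integrableOn_Ioc) (Eventually.of_forall fun t => norm_nonneg _)
    (LE.le.eventuallyLE ?_)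
  exact Set.Ioc_subset_Ioc (le_min hy.1 hx.1) (max_le hy.2 hx.2)

theorem norm_mul_length_le {v v' : ℝ → 𝕜} (hv : ∀ x, HasDerivAt v (v' x) x)
    (hv' : Continuous v') (hh : 0 < h) {x : ℝ} (hx : x ∈ Set.Icc a (a + h)) :
    ‖v x‖ ≤ h⁻¹ * ‖∫ t in a..(a + h), v t‖ + ∫ t in a..(a + h), ‖v' t‖ := by
  have hvc : Continuous v := continuous_iff_continuousAt.2 fun x => (hv x).continuousAt
  have h1 : (h : 𝕜) * v x = (∫ t in a..(a + h), v t) + ∫ t in a..(a + h), (v x - v t) := by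
    rw [intervalIntegral.integral_sub intervalIntegrable_const (hvc.intervalIntegrable _ _),
      intervalIntegral.integral_const, add_sub_cancel_left, RCLike.real_smul_eq_coe_mul]
    ring
  have h2 : ‖∫ t in a..(a + h), (v x - v t)‖ ≤ (∫ t in a..(a + h), ‖v' t‖) * |a + h - a| := by
    refine intervalIntegral.norm_integral_le_of_norm_le_const fun t ht => ?_
    rw [Set.uIoc_of_le (by linarith)] at ht
    exact norm_sub_le_integral_norm_deriv hv hv' (by linarith) hx ⟨ht.1.le, ht.2⟩
  rw [add_sub_cancel_left, abs_of_pos hh] at h2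
  have h3 : h * ‖v x‖ ≤ ‖∫ t in a..(a + h), v t‖ + (∫ t in a..(a + h), ‖v' t‖) * h := by
    have : ‖(h : 𝕜) * v x‖ = h * ‖v x‖ := by rw [norm_mul, RCLike.norm_of_nonneg hh.le]
    rw [← this, h1]
    exact (norm_add_le _ _).trans (add_le_add le_rfl h2)
  have h4 := mul_le_mul_of_nonneg_left h3 (inv_pos.2 hh).le
  rw [inv_mul_cancel_left₀ hh.ne'] at h4
  refine h4.trans_eq ?_
  field_simp

theorem integral_norm_le_rpow {p : ℝ} (hp : 0 < p) (hp1 : p < 1) {v : ℝ → 𝕜} (hv : Continuous v)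
    {b S : ℝ} (hab : a ≤ b) (hS : ∀ x ∈ Set.Icc a b, ‖v x‖ ≤ S) :
    ∫ t in a..b, ‖v t‖ ≤ (∫ t in a..b, ‖v t‖ ^ p) * S ^ (1 - p) := by
  have hvp : Continuous fun t => ‖v t‖ ^ p := hv.norm.rpow_const fun _ => Or.inr hp.le
  rw [← intervalIntegral.integral_mul_const]
  refine intervalIntegral.integral_mono_on hab (hv.norm.intervalIntegrable _ _)
    ((hvp.mul continuous_const).intervalIntegrable _ _) fun t ht => ?_
  rcases (norm_nonneg (v t)).eq_or_lt with h0 | h0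
  · rw [← h0, Real.zero_rpow hp.ne', zero_mul]
  · calc ‖v t‖ = ‖v t‖ ^ p * ‖v t‖ ^ (1 - p) := by
          rw [← Real.rpow_add h0, add_sub_cancel, Real.rpow_one]
      _ ≤ _ := by
          gcongr
          exact hS t ht

theorem ofReal_integral_rpow {p : ℝ} (hp : 0 < p) {v : ℝ → 𝕜} (hv : Continuous v) {b : ℝ}
    (hab : a ≤ b) :
    ENNReal.ofReal (∫ t in a..b, ‖v t‖ ^ p) = ∫⁻ t in Set.Ioc a b, ‖v t‖ₑ ^ p := by
  have hvp : Continuous fun t => ‖v t‖ ^ p := hv.norm.rpow_const fun _ => Or.inr hp.le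
  rw [intervalIntegral.integral_of_le hab, ofReal_integral_eq_lintegral_ofReal
    hvp.integrableOn_Ioc (Eventually.of_forall fun t => by positivity)]
  refine lintegral_congr fun t => ?_
  rw [← ofReal_norm, ENNReal.ofReal_rpow_of_nonneg (norm_nonneg _) hp.le]

/-- Local suprema are taken as attained values, so that global bounds for the derivatives apply to
them directly. -/
theorem exists_derivBounds {p : ℝ} (hp : 0 < p) (hp1 : p < 1) {g : ℝ → 𝕜}
    (hg : ContDiff ℝ (⊤ : ℕ∞) g) (a m : ℝ) : ∃ Y μ : ℕ → ℝ, IsDerivBounds p m Y μ ∧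
      Y 0 = ∫ t in a..(a + Real.exp (-m)), ‖g t‖ ∧ (∀ n, ∃ x, Y (n + 1) = ‖iteratedDeriv n g x‖) ∧
      ∀ n, ENNReal.ofReal (μ n) =
        ∫⁻ t in Set.Ioc a (a + Real.exp (-m)), ‖iteratedDeriv n g t‖ₑ ^ p := by
  set h := Real.exp (-m) with hh
  have hh0 : 0 < h := Real.exp_pos _
  have hem : Real.exp m = h⁻¹ := by rw [hh, Real.exp_neg, inv_inv]
  have hcont : ∀ n, Continuous (iteratedDeriv n g) := continuous_iteratedDeriv_of_smooth hg
  have hder : ∀ n x, HasDerivAt (iteratedDeriv n g) (iteratedDeriv (n + 1) g x) x := by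
    intro n x
    rw [iteratedDeriv_succ]
    exact ((contDiff_iteratedDeriv_of_smooth hg n).differentiable (by simp) x).hasDerivAt
  have hmax : ∀ n, ∃ x ∈ Set.Icc a (a + h), ∀ y ∈ Set.Icc a (a + h),
      ‖iteratedDeriv n g y‖ ≤ ‖iteratedDeriv n g x‖ := fun n =>
    isCompact_Icc.exists_isMaxOn (Set.nonempty_Icc.2 (by linarith)) (hcont n).norm.continuousOn
  choose x hx hxmax using hmax
  have hah : a ≤ a + h := by linarith
  set c := ∫ t in a..(a + h), ‖g t‖ with hc
  have hc0 : 0 ≤ c := intervalIntegral.integral_nonneg hah fun t _ => norm_nonneg _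
  set Y : ℕ → ℝ := fun n => Nat.casesOn n c fun n => ‖iteratedDeriv n g (x n)‖ with hY
  have hY0 : Y 0 = c := rfl
  have hYs : ∀ n, Y (n + 1) = ‖iteratedDeriv n g (x n)‖ := fun n => rfl
  set μ : ℕ → ℝ := fun n => ∫ t in a..(a + h), ‖iteratedDeriv n g t‖ ^ p with hμ
  refine ⟨Y, μ, ⟨?_, ?_, ?_, ?_, ?_⟩, hY0, fun n => ⟨x n, rfl⟩,
    fun n => ofReal_integral_rpow hp (hcont n) hah⟩
  · rintro (_ | n)
    · exact hc0
    · exact norm_nonneg _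
  · exact fun n => intervalIntegral.integral_nonneg hah fun t _ => by positivity
  · exact integral_norm_le_rpow hp hp1 hg.continuous hah (hxmax 0)
  · intro n
    have h1 := norm_mul_length_le (hder n) (hcont (n + 1)) hh0 (hx n)
    have h2 := integral_norm_le_rpow hp hp1 (hcont (n + 1)) hah (hxmax (n + 1))
    have h3 : ‖∫ t in a..(a + h), iteratedDeriv n g t‖ ≤ 2 * Y n := by
      rcases n with _ | n
      · have := intervalIntegral.norm_integral_le_integral_norm (f := g) (μ := volume) hah
        rw [iteratedDeriv_zero, hY0]
        linarith
      · rw [intervalIntegral.integral_eq_sub_of_hasDerivAt (fun t _ => hder n t)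
          ((hcont _).intervalIntegrable _ _), hYs]
        refine (norm_sub_le _ _).trans ?_
        linarith [hxmax n (a + h) ⟨hah, le_rfl⟩, hxmax n a ⟨le_rfl, hah⟩]
    have h4 := mul_le_mul_of_nonneg_left h3 (inv_pos.2 hh0).le
    rw [hem, hYs n]
    refine h1.trans ?_
    have h5 : h⁻¹ * (2 * Y n) = 2 * h⁻¹ * Y n := by ring
    rw [← h5]
    exact add_le_add h4 h2
  · intro n hn hlt
    rw [hem] at hlt
    exact landau_inequality (hder n) (hder (n + 1)) hh0 (hx (n + 1)) hn (hxmax n) (hxmax (n + 2)) hlt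

end Intervals


/-! ### Patches: replacing the increments of $G$ by cheap smooth bumps. -/

section Patch

variable {𝕜 : Type*} [RCLike 𝕜] {p : ℝ} {W : ℕ → ℝ}

theorem deriv_eq_zero_of_notMem {f : ℝ → 𝕜} (hf : Differentiable ℝ f) {a b : ℝ}
    (h : ∀ x ∉ Set.Ioo a b, f x = 0) : ∀ x ∉ Set.Ioo a b, deriv f x = 0 := by
  intro x hx
  have key : ∀ s : Set ℝ, UniqueDiffWithinAt ℝ s x → x ∈ s → (∀ y ∈ s, f y = 0) →
      deriv f x = 0 := by
    intro s hs hxs h0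
    rw [← (hf x).derivWithin hs, derivWithin_congr (f := fun _ => (0 : 𝕜)) h0 (h0 x hxs)]
    simp
  rcases le_or_gt x a with hxa | hxa
  · exact key (Set.Iic x) (uniqueDiffOn_Iic x x Set.self_mem_Iic) Set.self_mem_Iic
      fun y hy => h y fun hy' => absurd hy'.1 (not_lt.2 ((Set.mem_Iic.1 hy).trans hxa))
  · have hxb : b ≤ x := not_lt.1 fun hxb => hx ⟨hxa, hxb⟩
    exact key (Set.Ici x) (uniqueDiffOn_Ici x x Set.self_mem_Ici) Set.self_mem_Ici
      fun y hy => h y fun hy' => absurd hy'.2 (not_lt.2 (hxb.trans (Set.mem_Ici.1 hy)))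

theorem iteratedDeriv_eq_zero_of_notMem {f : ℝ → 𝕜} (hf : ContDiff ℝ (⊤ : ℕ∞) f) {a b : ℝ}
    (h : ∀ x ∉ Set.Ioo a b, f x = 0) (n : ℕ) : ∀ x ∉ Set.Ioo a b, iteratedDeriv n f x = 0 := by
  induction n with
  | zero => simpa using h
  | succ n ih =>
    rw [iteratedDeriv_succ]
    exact deriv_eq_zero_of_notMem
      ((contDiff_iteratedDeriv_of_smooth hf n).differentiable (by simp)) ih

/-- A smooth function supported in `(a, b)` whose primitive joins `G a` to `G b`, with bounds
`Z` for its derivatives and with cost `T`. -/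
structure IsPatch (p : ℝ) (W : ℕ → ℝ) (G : ℝ → 𝕜) (a b : ℝ) (Z : ℕ → ℝ) (T : ℝ≥0∞) (e : ℝ → 𝕜) :
    Prop where
  contDiff : ContDiff ℝ (⊤ : ℕ∞) e
  eq_zero : ∀ x ∉ Set.Ioo a b, e x = 0
  integral_eq : ∫ t in a..b, e t = G b - G a
  norm_le : ∀ n x, ‖iteratedDeriv n e x‖ ≤ Z n
  lintegral_le : ∀ n, ∫⁻ x, ‖iteratedDeriv n e x‖ₑ ^ p ≤
    ENNReal.ofReal (Real.exp (p * Real.log (W n))) * T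
  lintegral_sub_le : ∫⁻ x in Set.Ioc a b, ‖G x - G a - ∫ t in a..x, e t‖ₑ ^ p ≤ T

variable {G : ℝ → 𝕜} {a b c : ℝ} {Z : ℕ → ℝ} {T T₁ T₂ : ℝ≥0∞} {e e₁ e₂ : ℝ → 𝕜}

theorem IsPatch.mono (h : IsPatch p W G a b Z T₁ e) (hT : T₁ ≤ T₂) : IsPatch p W G a b Z T₂ e :=
  ⟨h.contDiff, h.eq_zero, h.integral_eq, h.norm_le,
    fun n => (h.lintegral_le n).trans (by gcongr), h.lintegral_sub_le.trans hT⟩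

theorem IsPatch.mono_bound (h : IsPatch p W G a b Z T e) {Z' : ℕ → ℝ} (hZ : ∀ n, Z n ≤ Z' n) :
    IsPatch p W G a b Z' T e :=
  ⟨h.contDiff, h.eq_zero, h.integral_eq, fun n x => (h.norm_le n x).trans (hZ n),
    h.lintegral_le, h.lintegral_sub_le⟩

theorem IsPatch.integral_eq_zero_left (h : IsPatch p W G a b Z T e) {x y : ℝ} (hx : x ≤ a)
    (hy : y ≤ a) : ∫ t in x..y, e t = 0 := by
  rw [intervalIntegral.integral_congr (g := fun _ => (0 : 𝕜)), intervalIntegral.integral_zero]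
  exact fun t ht => h.eq_zero t fun ht' => absurd ht'.1 (not_lt.2 (ht.2.trans (max_le hx hy)))

theorem IsPatch.integral_eq_zero_right (h : IsPatch p W G a b Z T e) {x y : ℝ} (hx : b ≤ x)
    (hy : b ≤ y) : ∫ t in x..y, e t = 0 := by
  rw [intervalIntegral.integral_congr (g := fun _ => (0 : 𝕜)), intervalIntegral.integral_zero]
  exact fun t ht => h.eq_zero t fun ht' => absurd ht'.2 (not_lt.2 ((le_min hx hy).trans ht.1))

/-- Costs add by $p$-subadditivity, while the bound `Z` is unchanged because the supports are
disjoint. The first patch has exactly the right integral, so the second interval inherits no error.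
-/
theorem IsPatch.add (hp : 0 < p) (hp1 : p < 1) (h₁ : IsPatch p W G a c Z T₁ e₁)
    (h₂ : IsPatch p W G c b Z T₂ e₂) (hac : a ≤ c) (hcb : c ≤ b) :
    IsPatch p W G a b Z (T₁ + T₂) (e₁ + e₂) := by
  have hi₁ : ∀ x y, IntervalIntegrable e₁ volume x y := fun x y =>
    h₁.contDiff.continuous.intervalIntegrable x y
  have hi₂ : ∀ x y, IntervalIntegrable e₂ volume x y := fun x y =>
    h₂.contDiff.continuous.intervalIntegrable x y
  have hadd : ∀ x y, ∫ t in x..y, (e₁ + e₂) t = (∫ t in x..y, e₁ t) + ∫ t in x..y, e₂ t :=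
    fun x y => intervalIntegral.integral_add (hi₁ x y) (hi₂ x y)
  refine ⟨h₁.contDiff.add h₂.contDiff, fun x hx => ?_, ?_, fun n x => ?_, fun n => ?_, ?_⟩
  · have e1 := h₁.eq_zero x fun h => hx ⟨h.1, h.2.trans_le hcb⟩
    have e2 := h₂.eq_zero x fun h => hx ⟨hac.trans_lt h.1, h.2⟩
    simp [e1, e2]
  · rw [hadd, ← intervalIntegral.integral_add_adjacent_intervals (hi₁ a c) (hi₁ c b),
      ← intervalIntegral.integral_add_adjacent_intervals (hi₂ a c) (hi₂ c b), h₁.integral_eq,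
      h₂.integral_eq, h₁.integral_eq_zero_right le_rfl hcb, h₂.integral_eq_zero_left hac le_rfl]
    abel
  · rw [iteratedDeriv_add_of_smooth h₁.contDiff h₂.contDiff, Pi.add_apply]
    by_cases hx : x ∈ Set.Ioo a c
    · rw [iteratedDeriv_eq_zero_of_notMem h₂.contDiff h₂.eq_zero n x
        fun h => absurd h.1 (not_lt.2 hx.2.le), add_zero]
      exact h₁.norm_le n x
    · rw [iteratedDeriv_eq_zero_of_notMem h₁.contDiff h₁.eq_zero n x hx, zero_add]
      exact h₂.norm_le n x
  · have h3 := eLpNorm_rpow_add_le (𝕜 := 𝕜) hp hp1 (f := iteratedDeriv n e₁)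
      (g := iteratedDeriv n e₂)
      (continuous_iteratedDeriv_of_smooth h₁.contDiff n).aestronglyMeasurable
    rw [← iteratedDeriv_add_of_smooth h₁.contDiff h₂.contDiff, eLpNorm_rpow_eq hp,
      eLpNorm_rpow_eq hp, eLpNorm_rpow_eq hp] at h3
    rw [mul_add]
    exact h3.trans (add_le_add (h₁.lintegral_le n) (h₂.lintegral_le n))
  · rw [← Set.Ioc_union_Ioc_eq_Ioc hac hcb,
      lintegral_union measurableSet_Ioc (Set.Ioc_disjoint_Ioc_of_le le_rfl)]
    refine add_le_add ((le_of_eq ?_).trans h₁.lintegral_sub_le)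
      ((le_of_eq ?_).trans h₂.lintegral_sub_le)
    · refine setLIntegral_congr_fun measurableSet_Ioc fun x hx => ?_
      rw [hadd, h₂.integral_eq_zero_left hac hx.2, add_zero]
    · refine setLIntegral_congr_fun measurableSet_Ioc fun x hx => ?_
      rw [hadd, ← intervalIntegral.integral_add_adjacent_intervals (hi₁ a c) (hi₁ c x),
        ← intervalIntegral.integral_add_adjacent_intervals (hi₂ a c) (hi₂ c x), h₁.integral_eq,
        h₁.integral_eq_zero_right le_rfl hx.1.le, h₂.integral_eq_zero_left hac le_rfl]
      congr 2
      abel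

/-- Kernels at the dyadic scales `2^{-i}`, together with a comparison principle. -/
structure IsKernelFamily (p : ℝ) (W : ℕ → ℝ) (C₀ E : ℝ) (Φ : ℕ → ℝ → ℝ) : Prop where
  contDiff : ∀ i, ContDiff ℝ (⊤ : ℕ∞) (Φ i)
  bump : ∀ i, IsUnitBump ((1 / 2) ^ (i + 1)) (Φ i)
  lintegral_le : ∀ i n, ∫⁻ x, ‖iteratedDeriv n (Φ i) x‖ₑ ^ p ≤
    ENNReal.ofReal ((1 / 2) ^ i) * ENNReal.ofReal (Real.exp (p * Real.log (W n)))
  exists_abs_le : ∀ i, ∃ A, 0 ≤ A ∧ ∀ n x, |iteratedDeriv n (Φ i) x| ≤ Real.exp (A * (n + 1) ^ 2)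
  zero_abs_le : ∀ n x, |iteratedDeriv n (Φ 0) x| ≤ Real.exp (E * (n + 1) ^ 2)
  comparison : ∀ (i : ℕ) Y μ N, IsDerivBounds p (i * Real.log 2) Y μ →
    (∀ n, (1 - p) ^ n * μ n ≤ Real.exp (p * Real.log (W n)) * N) →
    C₀ * N < (1 / 2) ^ i * Y 0 ^ p → ∀ n x, Y 0 * |iteratedDeriv n (Φ i) x| ≤
      (1 + ∑ i ∈ Finset.range (n + 1), Y (i + 1)) * Real.exp (E * (n + 1) ^ 2)

theorem exp_neg_mul_log_two (i : ℕ) : Real.exp (-(i * Real.log 2)) = (1 / 2) ^ i := by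
  rw [Real.exp_neg, Real.exp_nat_mul, Real.exp_log two_pos, one_div, inv_pow]

theorem IsDisconnecting.exists_kernelFamily (hW : IsDisconnecting p W) (hp : 0 < p) (hp1 : p < 1) :
    ∃ C₀ E Φ, 0 < C₀ ∧ 0 ≤ E ∧ IsKernelFamily p W C₀ E Φ := by
  obtain ⟨C, C', η, K, D, hC, hC', hD, hker⟩ := hW.exists_kernel hp hp1 (Real.log 8)
  obtain ⟨C₀, E, hC₀, hE, hcomp⟩ := exists_kernel_comparison (W := W) (η := η) (K := K) hp hp1 hC
    hC' hD
  have hlog2 : 0 < Real.log 2 := Real.log_pos one_lt_two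
  choose β ν Φ hΦ using fun i : ℕ => hker (i * Real.log 2) (by positivity)
  obtain ⟨E₀, hE₀, hΦ₀⟩ := (hΦ 0).exists_abs_le hD
  -- Enlarging $E$ by the constant of the kernel at scale $0$ provides the starting bound for the
  -- bisection.
  refine ⟨C₀, max E E₀, Φ, hC₀, le_max_of_le_left hE, fun i => (hΦ i).contDiff, fun i => ?_,
    fun i n => ?_, fun i => (hΦ i).exists_abs_le hD, fun n x => (hΦ₀ n x).trans ?_,
    fun i Y μ N hY hμ hN n x => ?_⟩
  · have := (hΦ i).bump
    rw [exp_neg_mul_log_two] at this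
    rwa [pow_succ, ← div_eq_mul_one_div]
  · refine ((hΦ i).lintegral_le n).trans_eq ?_
    rw [Real.exp_add, exp_neg_mul_log_two, ENNReal.ofReal_mul (by positivity)]
  · gcongr
    exact le_max_right _ _
  · rw [← exp_neg_mul_log_two] at hN
    refine (hcomp _ _ _ _ (hΦ i) Y μ N hY hμ hN n x).trans ?_
    have : 0 ≤ ∑ i ∈ Finset.range (n + 1), Y (i + 1) := Finset.sum_nonneg fun i _ => hY.nonneg _
    gcongr
    exact le_max_left _ _

variable {C₀ E : ℝ} {Φ : ℕ → ℝ → ℝ}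

/-- The derivative costs come from the kernel. The primitive errs by at most $2c$ on length
$2^{-i-1}$, and $2^p\le2$ keeps this below the same cost. -/
theorem IsKernelFamily.isPatch (hΦ : IsKernelFamily p W C₀ E Φ) (hp : 0 < p) (hp1 : p < 1) (i : ℕ)
    (a : ℝ) {c : ℝ} (hG : ∀ x ∈ Set.Icc a (a + (1 / 2) ^ (i + 1)), ‖G x - G a‖ ≤ c)
    (hZ : ∀ n x, c * |iteratedDeriv n (Φ i) x| ≤ Z n) :
    IsPatch p W G a (a + (1 / 2) ^ (i + 1)) Z (ENNReal.ofReal ((1 / 2) ^ i * c ^ p))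
      (fun x => (Φ i (x - a)) • (G (a + (1 / 2) ^ (i + 1)) - G a)) := by
  set l : ℝ := (1 / 2) ^ (i + 1) with hl
  have hl0 : 0 < l := by positivity
  set v := G (a + l) - G a with hv
  have hvc : ‖v‖ ≤ c := hG (a + l) ⟨by linarith, le_rfl⟩
  have hc : 0 ≤ c := (norm_nonneg _).trans hvc
  have hb := hΦ.bump i
  have hsm : ContDiff ℝ (⊤ : ℕ∞) fun x => Φ i (x - a) :=
    (hΦ.contDiff i).comp (contDiff_id.sub contDiff_const)
  have hder : ∀ n x, iteratedDeriv n (fun x => (Φ i (x - a)) • v) x =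
      iteratedDeriv n (Φ i) (x - a) • v := by
    intro n x
    rw [iteratedDeriv_smul_const (hsm.contDiffAt.of_le (by exact_mod_cast le_top)),
      iteratedDeriv_comp_sub_const]
  have hint : ∀ x, ∫ t in a..x, (Φ i (t - a)) • v = (∫ t in 0..(x - a), Φ i t) • v := by
    intro x
    rw [intervalIntegral.integral_smul_const, intervalIntegral.integral_comp_sub_right (Φ i) a,
      sub_self]
  refine ⟨hsm.smul contDiff_const, fun x hx => ?_, ?_, fun n x => ?_, fun n => ?_, ?_⟩
  · rw [hb.eq_zero (x - a) fun h => hx ⟨by linarith [h.1], by linarith [h.2]⟩, zero_smul]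
  · rw [hint, add_sub_cancel_left, hb.integral_eq, one_smul]
  · rw [hder, norm_smul, mul_comm, Real.norm_eq_abs]
    exact (mul_le_mul_of_nonneg_right hvc (abs_nonneg _)).trans (hZ n _)
  · simp only [hder, enorm_smul, ENNReal.mul_rpow_of_nonneg _ _ hp.le]
    rw [lintegral_mul_const' _ _ (by finiteness),
      lintegral_sub_right_eq_self (fun x => ‖iteratedDeriv n (Φ i) x‖ₑ ^ p) a,
      ENNReal.ofReal_mul (by positivity), ← mul_assoc, mul_comm (ENNReal.ofReal (Real.exp _))]
    refine mul_le_mul' (hΦ.lintegral_le i n) ?_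
    rw [← ofReal_norm, ENNReal.ofReal_rpow_of_nonneg (norm_nonneg _) hp.le]
    exact ENNReal.ofReal_le_ofReal (Real.rpow_le_rpow (norm_nonneg _) hvc hp.le)
  · have hbd : ∀ x ∈ Set.Ioc a (a + l),
        ‖G x - G a - ∫ t in a..x, (Φ i (t - a)) • v‖ₑ ^ p ≤ ENNReal.ofReal ((2 * c) ^ p) := by
      intro x hx
      rw [← ofReal_norm, ENNReal.ofReal_rpow_of_nonneg (norm_nonneg _) hp.le]
      refine ENNReal.ofReal_le_ofReal (Real.rpow_le_rpow (norm_nonneg _) ?_ hp.le)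
      rw [hint]
      refine (norm_sub_le _ _).trans ?_
      rw [norm_smul, Real.norm_of_nonneg (intervalIntegral.integral_nonneg (by linarith [hx.1])
        fun t _ => hb.nonneg t)]
      have h1 := hG x ⟨hx.1.le, hx.2⟩
      have h2 : (∫ t in 0..(x - a), Φ i t) * ‖v‖ ≤ 1 * c :=
        mul_le_mul (hb.intervalIntegral_le_one _ _) hvc (norm_nonneg _) zero_le_one
      linarith
    refine (setLIntegral_mono measurable_const hbd).trans ?_
    rw [setLIntegral_const, Real.volume_Ioc, add_sub_cancel_left,
      ← ENNReal.ofReal_mul (by positivity)]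
    refine ENNReal.ofReal_le_ofReal ?_
    rw [Real.mul_rpow zero_le_two hc, hl, pow_succ]
    have h2 : (2 : ℝ) ^ p ≤ 2 := by
      simpa using Real.rpow_le_rpow_of_exponent_le one_le_two hp1.le
    have h3 : 0 ≤ c ^ p := Real.rpow_nonneg hc p
    have h4 : (0 : ℝ) ≤ (1 / 2) ^ i := by positivity
    calc (2 : ℝ) ^ p * c ^ p * ((1 / 2) ^ i * (1 / 2)) ≤ 2 * c ^ p * ((1 / 2) ^ i * (1 / 2)) := by
          gcongr
      _ = _ := by ring

/-- Patches for a continuous function, at a fixed fine scale. -/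
theorem IsKernelFamily.exists_isPatch_of_osc (hΦ : IsKernelFamily p W C₀ E Φ) (hp : 0 < p)
    (hp1 : p < 1) (i : ℕ) {c : ℝ} {l r : ℝ}
    (hG : ∀ x ∈ Set.Icc l r, ∀ y ∈ Set.Icc l r, |x - y| ≤ (1 / 2) ^ (i + 1) → ‖G x - G y‖ ≤ c)
    (hZ : ∀ n x, c * |iteratedDeriv n (Φ i) x| ≤ Z n) (d : ℕ) :
    ∀ a, l ≤ a → a + 2 ^ d * (1 / 2) ^ (i + 1) ≤ r → ∃ e,
      IsPatch p W G a (a + 2 ^ d * (1 / 2) ^ (i + 1)) Z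
        (2 ^ d * ENNReal.ofReal ((1 / 2) ^ i * c ^ p)) e := by
  have hl0 : (0 : ℝ) < (1 / 2) ^ (i + 1) := by positivity
  induction d with
  | zero =>
    intro a hla har
    rw [pow_zero, one_mul] at har ⊢
    rw [pow_zero, one_mul]
    refine ⟨_, hΦ.isPatch hp hp1 i a (fun x hx => hG x ⟨hla.trans hx.1, hx.2.trans har⟩ a
      ⟨hla, by linarith⟩ ?_) hZ⟩
    rw [abs_of_nonneg (by linarith [hx.1])]
    linarith [hx.2]
  | succ d ih =>
    intro a hla har
    have hd : (0 : ℝ) < 2 ^ d * (1 / 2) ^ (i + 1) := by positivity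
    have h1 : a + 2 ^ (d + 1) * (1 / 2) ^ (i + 1) =
        a + 2 ^ d * (1 / 2) ^ (i + 1) + 2 ^ d * (1 / 2) ^ (i + 1) := by ring
    rw [h1] at har ⊢
    obtain ⟨e₁, he₁⟩ := ih a hla (by linarith)
    obtain ⟨e₂, he₂⟩ := ih (a + 2 ^ d * (1 / 2) ^ (i + 1)) (by linarith) har
    refine ⟨e₁ + e₂, ?_⟩
    have := he₁.add hp hp1 he₂ (by linarith) (by linarith)
    rwa [← add_mul, ← mul_two, ← pow_succ] at this

/-- Patches for the primitive of a smooth function, at scales adapted to the function. -/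
theorem IsKernelFamily.exists_isPatch_of_deriv (hΦ : IsKernelFamily p W C₀ E Φ) (hp : 0 < p)
    (hp1 : p < 1) (hC₀ : 0 < C₀) {g : ℝ → 𝕜} (hg : ContDiff ℝ (⊤ : ℕ∞) g) {B : ℕ → ℝ}
    (hB : ∀ n x, ‖iteratedDeriv n g x‖ ≤ B n) {w : ℝ → ℝ≥0∞}
    (hw : ∀ n x, ENNReal.ofReal ((1 - p) ^ n) * ‖iteratedDeriv n g x‖ₑ ^ p ≤
      ENNReal.ofReal (Real.exp (p * Real.log (W n))) * w x) (hwi : ∫⁻ x, w x ≠ ⊤)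
    (hG : ∀ x y, G y - G x = ∫ t in x..y, g t)
    (hZ : ∀ n, Z n = (1 + ∑ i ∈ Finset.range (n + 1), B i) * Real.exp (E * (n + 1) ^ 2)) (d : ℕ) :
    ∀ i a, (∀ n x, (∫ t in a..(a + (1 / 2) ^ (i + 1)), ‖g t‖) * |iteratedDeriv n (Φ i) x| ≤ Z n) →
      ∃ e, IsPatch p W G a (a + (1 / 2) ^ (i + 1)) Z
        (ENNReal.ofReal (2 * C₀) * (∫⁻ x in Set.Ioc a (a + (1 / 2) ^ (i + 1)), w x) +
          ENNReal.ofReal ((1 / 2) ^ i * ((1 / 2) ^ (i + d + 1) * B 0) ^ p)) e := by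
  have hnn : ∀ a b : ℝ, a ≤ b → 0 ≤ ∫ t in a..b, ‖g t‖ := fun a b hab =>
    intervalIntegral.integral_nonneg hab fun t _ => norm_nonneg _
  have hgi : ∀ x y, IntervalIntegrable (fun t => ‖g t‖) volume x y := fun x y =>
    hg.continuous.norm.intervalIntegrable x y
  have hpatch : ∀ i a, (∀ n x, (∫ t in a..(a + (1 / 2) ^ (i + 1)), ‖g t‖) *
      |iteratedDeriv n (Φ i) x| ≤ Z n) → ∃ e, IsPatch p W G a (a + (1 / 2) ^ (i + 1)) Z
        (ENNReal.ofReal ((1 / 2) ^ i * (∫ t in a..(a + (1 / 2) ^ (i + 1)), ‖g t‖) ^ p)) e := by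
    intro i a hZ
    refine ⟨_, hΦ.isPatch hp hp1 i a (fun x hx => ?_) hZ⟩
    rw [hG]
    refine (intervalIntegral.norm_integral_le_integral_norm hx.1).trans ?_
    rw [← intervalIntegral.integral_add_adjacent_intervals (hgi a x)
      (hgi x (a + (1 / 2) ^ (i + 1)))]
    linarith [hnn x _ hx.2]
  -- Here $d$ counts the bisections still allowed. At $d=0$ the integral of $\|g\|$ is tiny because
  -- the interval is short, and the patch is paid for by the last term of the cost.
  induction d with
  | zero =>
    intro i a hZ
    obtain ⟨e, he⟩ := hpatch i a hZ
    refine ⟨e, he.mono (le_add_of_nonneg_of_le zero_le (ENNReal.ofReal_le_ofReal ?_))⟩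
    have h1 : ∫ t in a..(a + (1 / 2) ^ (i + 1)), ‖g t‖ ≤ (1 / 2) ^ (i + 0 + 1) * B 0 := by
      have hle : a ≤ a + (1 / 2) ^ (i + 1) := le_add_of_nonneg_right (by positivity)
      have := intervalIntegral.integral_mono_on hle (hgi _ _) intervalIntegrable_const
        fun x _ => (show ‖g x‖ ≤ B 0 by simpa using hB 0 x)
      simpa using this
    have h0 := hnn a (a + (1 / 2) ^ (i + 1)) (le_add_of_nonneg_right (by positivity))
    gcongr
  | succ d ih =>
    intro i a hZi
    set l : ℝ := (1 / 2) ^ (i + 1) with hl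
    have hl0 : 0 < l := by positivity
    set c := ∫ t in a..(a + l), ‖g t‖ with hc
    set N := ∫⁻ x in Set.Ioc a (a + l), w x with hN
    have hNtop : N ≠ ⊤ := ne_top_of_le_ne_top hwi (setLIntegral_le_lintegral _ _)
    -- The stopping rule: a patch that can be charged to the local mass of `w` is accepted.
    -- Otherwise the comparison principle for this interval bounds the kernel of the next scale,
    -- which lives on half of it, and the interval may be bisected.
    rcases le_or_gt (l * c ^ p) (C₀ * N.toReal) with hle | hlt
    · obtain ⟨e, he⟩ := hpatch i a hZi
      refine ⟨e, he.mono (le_add_of_le_of_nonneg ?_ zero_le)⟩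
      rw [← ENNReal.ofReal_toReal hNtop, ← ENNReal.ofReal_mul (by positivity)]
      refine ENNReal.ofReal_le_ofReal ?_
      have h2 : (1 / 2 : ℝ) ^ i = 2 * l := by rw [hl, pow_succ]; ring
      rw [h2]
      linarith
    · have hlexp : Real.exp (-((i + 1 : ℕ) * Real.log 2)) = l := exp_neg_mul_log_two (i + 1)
      obtain ⟨Y, μ, hY, hY0, hYs, hμ⟩ := exists_derivBounds hp hp1 hg a ((i + 1 : ℕ) * Real.log 2)
      rw [hlexp] at hY0 hμ
      have hc0 : 0 ≤ c := hnn a (a + l) (by linarith)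
      have hcomp := hΦ.comparison (i + 1) Y μ N.toReal hY (fun n => by
        have h1 : ENNReal.ofReal ((1 - p) ^ n * μ n) ≤
            ENNReal.ofReal (Real.exp (p * Real.log (W n)) * N.toReal) := by
          have hq : 0 ≤ (1 - p) ^ n := pow_nonneg (by linarith) n
          rw [ENNReal.ofReal_mul hq, hμ, ENNReal.ofReal_mul (Real.exp_pos _).le,
            ENNReal.ofReal_toReal hNtop, ← lintegral_const_mul' _ _ ENNReal.ofReal_ne_top,
            ← lintegral_const_mul' _ _ ENNReal.ofReal_ne_top]
          exact lintegral_mono fun x => hw n x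
        exact (ENNReal.ofReal_le_ofReal_iff (by positivity)).1 h1) (by
          rw [hY0]
          exact hlt)
      rw [hY0] at hcomp
      have hcZ : ∀ n x, c * |iteratedDeriv n (Φ (i + 1)) x| ≤ Z n := by
        intro n x
        refine (hcomp n x).trans ?_
        rw [hZ]
        gcongr with k _
        obtain ⟨x, hx⟩ := hYs k
        rw [hx]
        exact hB k x
      set l' : ℝ := (1 / 2) ^ (i + 1 + 1) with hl'
      have hll : l = l' + l' := by rw [hl, hl']; ring
      have hl'0 : 0 < l' := by positivity
      have hsplit : c = (∫ t in a..(a + l'), ‖g t‖) + ∫ t in (a + l')..(a + l' + l'), ‖g t‖ := by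
        rw [hc, intervalIntegral.integral_add_adjacent_intervals (hgi _ _) (hgi _ _), hll, add_assoc]
      have hn1 := hnn a (a + l') (by linarith)
      have hn2 := hnn (a + l') (a + l' + l') (by linarith)
      obtain ⟨e₁, he₁⟩ := ih (i + 1) a fun n x =>
        (mul_le_mul_of_nonneg_right (by linarith) (abs_nonneg _)).trans (hcZ n x)
      obtain ⟨e₂, he₂⟩ := ih (i + 1) (a + l') fun n x =>
        (mul_le_mul_of_nonneg_right (by linarith) (abs_nonneg _)).trans (hcZ n x)
      refine ⟨e₁ + e₂, ?_⟩
      have h3 := he₁.add hp hp1 he₂ (by linarith) (by linarith)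
      rw [← hl', add_assoc a l' l', ← hll] at h3
      refine h3.mono (le_of_eq ?_)
      have hN2 : N = (∫⁻ x in Set.Ioc a (a + l'), w x) + ∫⁻ x in Set.Ioc (a + l') (a + l), w x := by
        rw [hN, ← lintegral_union measurableSet_Ioc (Set.Ioc_disjoint_Ioc_of_le le_rfl),
          Set.Ioc_union_Ioc_eq_Ioc (by linarith) (by linarith)]
      have hpow : i + 1 + d + 1 = i + (d + 1) + 1 := by ring
      have hP : (0 : ℝ) ≤ (1 / 2) ^ (i + 1) * ((1 / 2) ^ (i + (d + 1) + 1) * B 0) ^ p := by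
        have : 0 ≤ B 0 := (norm_nonneg _).trans (hB 0 0)
        positivity
      rw [hN2, mul_add, add_add_add_comm, hpow, ← ENNReal.ofReal_add hP hP]
      congr 2
      rw [pow_succ]
      ring

end Patch


/-! ### Gluing patches along the unit cells. -/

section Glue

variable {𝕜 : Type*} [RCLike 𝕜] {p : ℝ} {W : ℕ → ℝ} {G : ℝ → 𝕜} {Z : ℕ → ℝ}

theorem IsPatch.zero (hp : 0 < p) {a b : ℝ} (hG : ∀ x ∈ Set.Icc a b, G x = G a) (hab : a ≤ b)
    (hZ : ∀ n, 0 ≤ Z n) : IsPatch p W G a b Z 0 (fun _ => (0 : 𝕜)) := by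
  have h0 : ∀ n x, iteratedDeriv n (fun _ : ℝ => (0 : 𝕜)) x = (0 : 𝕜) := fun n x => by
    simp
  refine ⟨contDiff_const, fun _ _ => rfl, ?_, fun n x => ?_, fun n => ?_, ?_⟩
  · rw [hG b ⟨hab, le_rfl⟩]
    simp
  · rw [h0, norm_zero]
    exact hZ n
  · simp [h0, hp]
  · rw [setLIntegral_congr_fun (g := fun _ => 0) measurableSet_Ioc fun x hx => ?_]
    · simp
    · simp only
      rw [hG x ⟨hx.1.le, hx.2⟩]
      simp [hp]

theorem lintegral_eq_tsum_Ioc (f : ℝ → ℝ≥0∞) :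
    ∫⁻ x, f x = ∑' k : ℤ, ∫⁻ x in Set.Ioc (k : ℝ) (k + 1), f x := by
  rw [← lintegral_iUnion (fun _ => measurableSet_Ioc) (Set.pairwise_disjoint_Ioc_intCast ℝ),
    iUnion_Ioc_intCast, setLIntegral_univ]

/-- Patches on the unit cells glue to a smooth function on the line. -/
theorem exists_glue {T : ℤ → ℝ≥0∞} {e : ℤ → ℝ → 𝕜}
    (he : ∀ k : ℤ, IsPatch p W G k (k + 1) Z (T k) (e k)) : ∃ f : ℝ → 𝕜,
      ContDiff ℝ (⊤ : ℕ∞) f ∧ (∀ n x, ‖iteratedDeriv n f x‖ ≤ Z n) ∧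
      (∀ n, ∫⁻ x, ‖iteratedDeriv n f x‖ₑ ^ p ≤
        ENNReal.ofReal (Real.exp (p * Real.log (W n))) * ∑' k, T k) ∧
      ∫⁻ x, ‖G x - G 0 - ∫ t in 0..x, f t‖ₑ ^ p ≤ ∑' k, T k := by
  set f : ℝ → 𝕜 := fun x => e ⌊x⌋ x with hf
  -- Around each integer the function is a sum of two smooth patches, so the floor function causes
  -- no loss of smoothness.
  have hloc : ∀ (k : ℤ), Set.EqOn f (e (k - 1) + e k) (Set.Ioo ((k : ℝ) - 1) (k + 1)) := by
    intro k x hx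
    rcases lt_or_ge x k with h | h
    · have h1 : ⌊x⌋ = k - 1 := by
        rw [Int.floor_eq_iff]
        push_cast
        exact ⟨hx.1.le, by linarith⟩
      simp only [hf, Pi.add_apply]
      rw [h1, (he k).eq_zero x fun h' => absurd h'.1 (not_lt.2 h.le), add_zero]
    · have h1 : ⌊x⌋ = k := by
        rw [Int.floor_eq_iff]
        exact ⟨h, hx.2⟩
      simp only [hf, Pi.add_apply]
      rw [h1, (he (k - 1)).eq_zero x fun h' => ?_, zero_add]
      have := h'.2
      push_cast at this
      linarith
  have hev : ∀ x : ℝ, f =ᶠ[𝓝 x] e (⌊x⌋ - 1) + e ⌊x⌋ := fun x =>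
    (hloc ⌊x⌋).eventuallyEq_of_mem (Ioo_mem_nhds (by linarith [Int.floor_le x])
      (Int.lt_floor_add_one x))
  have hcd : ContDiff ℝ (⊤ : ℕ∞) f := contDiff_iff_contDiffAt.2 fun x =>
    (((he _).contDiff.add (he _).contDiff).contDiffAt).congr_of_eventuallyEq (hev x)
  have hder : ∀ n x, iteratedDeriv n f x = iteratedDeriv n (e ⌊x⌋) x := by
    intro n x
    rw [(hev x).iteratedDeriv_eq n, iteratedDeriv_add_of_smooth (he _).contDiff (he _).contDiff,
      Pi.add_apply, iteratedDeriv_eq_zero_of_notMem (he (⌊x⌋ - 1)).contDiff (he (⌊x⌋ - 1)).eq_zero,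
      zero_add]
    intro h
    have := h.2
    push_cast at this
    linarith [Int.floor_le x]
  have hcell : ∀ (n : ℕ) (k : ℤ), ∀ x ∈ Set.Icc (k : ℝ) (k + 1),
      iteratedDeriv n f x = iteratedDeriv n (e k) x := by
    intro n k x hx
    rw [hder]
    rcases hx.2.eq_or_lt with h | h
    · have h1 : ⌊x⌋ = k + 1 := by rw [h, Int.floor_add_one, Int.floor_intCast]
      rw [h1, iteratedDeriv_eq_zero_of_notMem (he _).contDiff (he _).eq_zero,
        iteratedDeriv_eq_zero_of_notMem (he _).contDiff (he _).eq_zero]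
      · exact fun h' => absurd h'.2 (by rw [h]; exact lt_irrefl _)
      · intro h'
        have := h'.1
        push_cast at this
        linarith
    · rw [Int.floor_eq_iff.2 ⟨hx.1, h⟩]
  have hfi : ∀ x y, IntervalIntegrable f volume x y := fun x y =>
    hcd.continuous.intervalIntegrable x y
  have hfk : ∀ (k : ℤ), ∀ x ∈ Set.Icc (k : ℝ) (k + 1), ∫ t in k..x, f t = ∫ t in k..x, e k t := by
    intro k x hx
    refine intervalIntegral.integral_congr fun t ht => ?_
    rw [Set.uIcc_of_le hx.1] at ht
    simpa using hcell 0 k t ⟨ht.1, ht.2.trans hx.2⟩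
  have hstep : ∀ k : ℤ, ∫ t in (k : ℝ)..((k + 1 : ℤ) : ℝ), f t = G ((k + 1 : ℤ) : ℝ) - G k := by
    intro k
    push_cast
    rw [hfk k _ ⟨by linarith, le_rfl⟩, (he k).integral_eq]
  -- The primitive is exact at the integers, so on each cell the error is that of its own patch.
  have hint : ∀ k : ℤ, ∫ t in 0..(k : ℝ), f t = G k - G 0 := by
    intro k
    induction k using Int.induction_on with
    | zero => simp
    | succ k ih =>
      rw [← intervalIntegral.integral_add_adjacent_intervals (hfi 0 ((k : ℤ) : ℝ)) (hfi _ _), ih,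
        hstep]
      abel
    | pred k ih =>
      have h1 := hstep (-(k : ℤ) - 1)
      rw [sub_add_cancel] at h1
      have h2 := intervalIntegral.integral_add_adjacent_intervals
        (hfi 0 ((-(k : ℤ) - 1 : ℤ) : ℝ)) (hfi _ ((-(k : ℤ) : ℤ) : ℝ))
      rw [ih, h1] at h2
      rw [← add_right_cancel_iff, h2]
      abel
  refine ⟨f, hcd, fun n x => ?_, fun n => ?_, ?_⟩
  · rw [hder]
    exact (he _).norm_le n x
  · rw [lintegral_eq_tsum_Ioc, ← ENNReal.tsum_mul_left]
    refine ENNReal.tsum_le_tsum fun k => ?_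
    refine le_trans ?_ ((he k).lintegral_le n)
    refine le_trans (le_of_eq ?_) (setLIntegral_le_lintegral (Set.Ioc (k : ℝ) (k + 1)) _)
    refine setLIntegral_congr_fun measurableSet_Ioc fun x hx => ?_
    rw [hcell n k x ⟨hx.1.le, hx.2⟩]
  · rw [lintegral_eq_tsum_Ioc]
    refine ENNReal.tsum_le_tsum fun k => ?_
    refine le_trans (le_of_eq ?_) (he k).lintegral_sub_le
    refine setLIntegral_congr_fun measurableSet_Ioc fun x hx => ?_
    rw [← intervalIntegral.integral_add_adjacent_intervals (hfi 0 k) (hfi k x), hint,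
      hfk k x ⟨hx.1.le, hx.2⟩]
    congr 2
    abel

end Glue

/-! ### Patches on a unit cell, at a fixed scale or at adapted scales. -/

section Cells

variable {𝕜 : Type*} [RCLike 𝕜] {p : ℝ} {W : ℕ → ℝ} {G : ℝ → 𝕜} {C₀ E : ℝ} {Φ : ℕ → ℝ → ℝ}

theorem exists_pos_rpow_le (hp : 0 < p) {δ : ℝ≥0∞} (hδ : δ ≠ 0) :
    ∃ c : ℝ, 0 < c ∧ c ≤ 1 ∧ ENNReal.ofReal (2 * c ^ p) ≤ δ := by
  obtain ⟨r, hr0, hr⟩ := ENNReal.lt_iff_exists_real_btwn.1 (pos_iff_ne_zero.2 hδ)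
  have hr0' : 0 < r := ENNReal.ofReal_pos.1 hr.1
  refine ⟨min 1 ((r / 2) ^ p⁻¹), lt_min one_pos (by positivity), min_le_left _ _, ?_⟩
  refine le_trans (ENNReal.ofReal_le_ofReal ?_) hr.2.le
  have h1 : (min 1 ((r / 2) ^ p⁻¹)) ^ p ≤ ((r / 2) ^ p⁻¹) ^ p :=
    Real.rpow_le_rpow (le_min zero_le_one (by positivity)) (min_le_right _ _) hp.le
  rw [Real.rpow_inv_rpow (by positivity) hp.ne'] at h1
  linarith

/-- Uniform continuity supplies a scale with oscillation at most $c$, and the $2^{i+1}$ patches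
together cost $2c^p$. The growth constant depends on the scale, so this serves only finitely many
cells. -/
theorem IsKernelFamily.exists_cell_of_continuous (hΦ : IsKernelFamily p W C₀ E Φ) (hp : 0 < p)
    (hp1 : p < 1) (hG : Continuous G) (k : ℝ) {δ : ℝ≥0∞} (hδ : δ ≠ 0) : ∃ A e, 0 ≤ A ∧
      IsPatch p W G k (k + 1) (fun n => Real.exp (A * (n + 1) ^ 2)) δ e := by
  obtain ⟨c, hc0, hc1, hcδ⟩ := exists_pos_rpow_le hp hδ
  obtain ⟨η, hη, hηc⟩ := Metric.uniformContinuousOn_iff_le.1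
    ((isCompact_Icc (a := k) (b := k + 1)).uniformContinuousOn_of_continuous hG.continuousOn) c hc0
  obtain ⟨i, hi⟩ := exists_pow_lt_of_lt_one hη (show (1 / 2 : ℝ) < 1 by norm_num)
  obtain ⟨A, hA, hA'⟩ := hΦ.exists_abs_le i
  have hle : (1 / 2 : ℝ) ^ (i + 1) ≤ η :=
    (pow_le_pow_of_le_one (by norm_num) (by norm_num) i.le_succ).trans hi.le
  have hone : (2 : ℝ) ^ (i + 1) * (1 / 2) ^ (i + 1) = 1 := by
    rw [← mul_pow]
    norm_num
  obtain ⟨e, he⟩ := hΦ.exists_isPatch_of_osc (G := G) (Z := fun n => Real.exp (A * (n + 1) ^ 2))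
    (l := k) (r := k + 1) (c := c) hp hp1 i
    (fun x hx y hy hxy => by
      rw [← dist_eq_norm]
      exact hηc x hx y hy (hxy.trans hle))
    (fun n x => (mul_le_of_le_one_left (abs_nonneg _) hc1).trans (hA' n x)) (i + 1) k le_rfl
    (by rw [hone])
  rw [hone] at he
  refine ⟨A, e, hA, he.mono (le_trans (le_of_eq ?_) hcδ)⟩
  have h2 : (2 : ℝ≥0∞) ^ (i + 1) = ENNReal.ofReal (2 ^ (i + 1)) := by
    rw [ENNReal.ofReal_pow zero_le_two, ENNReal.ofReal_ofNat]
  rw [h2, ← ENNReal.ofReal_mul (by positivity)]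
  congr 1
  rw [pow_succ, show (2 : ℝ) ^ i * 2 * ((1 / 2) ^ i * c ^ p) = 2 * (2 ^ i * (1 / 2) ^ i) * c ^ p by
    ring, ← mul_pow]
  norm_num

/-- The bound on the derivatives does not depend on the cell, unlike in the fixed-scale
construction. The cell is treated as two halves, the intervals on which the scale-$0$ kernel lives,
and $d$ is taken so large that the unpaid remainder is below $\delta$. -/
theorem IsKernelFamily.exists_cell_of_deriv (hΦ : IsKernelFamily p W C₀ E Φ) (hp : 0 < p)
    (hp1 : p < 1) (hC₀ : 0 < C₀) {g : ℝ → 𝕜} (hg : ContDiff ℝ (⊤ : ℕ∞) g) {B : ℕ → ℝ}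
    (hB : ∀ n x, ‖iteratedDeriv n g x‖ ≤ B n) {w : ℝ → ℝ≥0∞}
    (hw : ∀ n x, ENNReal.ofReal ((1 - p) ^ n) * ‖iteratedDeriv n g x‖ₑ ^ p ≤
      ENNReal.ofReal (Real.exp (p * Real.log (W n))) * w x) (hwi : ∫⁻ x, w x ≠ ⊤)
    (hG : ∀ x y, G y - G x = ∫ t in x..y, g t) (k : ℝ) {δ : ℝ≥0∞} (hδ : δ ≠ 0) : ∃ e,
      IsPatch p W G k (k + 1)
        (fun n => (1 + ∑ i ∈ Finset.range (n + 1), B i) * Real.exp (E * (n + 1) ^ 2))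
        (ENNReal.ofReal (2 * C₀) * (∫⁻ x in Set.Ioc k (k + 1), w x) + δ) e := by
  have hB0 : ∀ n, 0 ≤ B n := fun n => (norm_nonneg _).trans (hB n 0)
  obtain ⟨c, hc0, hc1, hcδ⟩ := exists_pos_rpow_le hp hδ
  obtain ⟨d, hd⟩ := exists_pow_lt_of_lt_one (show 0 < c / (B 0 + 1) from
    div_pos hc0 (by linarith [hB0 0])) (show (1 / 2 : ℝ) < 1 by norm_num)
  rw [lt_div_iff₀ (by linarith [hB0 0])] at hd
  have hBd : (1 / 2) ^ (0 + d + 1) * B 0 ≤ c := by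
    rw [zero_add, pow_succ]
    have h1 : (0 : ℝ) < (1 / 2) ^ d := by positivity
    nlinarith [hB0 0]
  have hhalf : ∀ a : ℝ, ∀ n x, (∫ t in a..(a + (1 / 2) ^ (0 + 1)), ‖g t‖) *
      |iteratedDeriv n (Φ 0) x| ≤
        (1 + ∑ i ∈ Finset.range (n + 1), B i) * Real.exp (E * (n + 1) ^ 2) := by
    intro a n x
    have h1 := intervalIntegral.integral_mono_on (show a ≤ a + (1 / 2) ^ (0 + 1) by norm_num)
      (hg.continuous.norm.intervalIntegrable (μ := volume) _ _) intervalIntegrable_const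
      fun x _ => (show ‖g x‖ ≤ B 0 by simpa using hB 0 x)
    rw [intervalIntegral.integral_const, smul_eq_mul, add_sub_cancel_left, zero_add, pow_one] at h1
    have h2 : B 0 ≤ ∑ i ∈ Finset.range (n + 1), B i :=
      Finset.single_le_sum (f := B) (fun i _ => hB0 i) (Finset.mem_range.2 n.succ_pos)
    rw [zero_add, pow_one]
    refine mul_le_mul (by linarith [hB0 0]) (hΦ.zero_abs_le n x) (abs_nonneg _) ?_
    linarith [hB0 0]
  obtain ⟨e₁, he₁⟩ := hΦ.exists_isPatch_of_deriv hp hp1 hC₀ hg hB hw hwi hG (fun _ => rfl) d 0 k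
    (hhalf k)
  obtain ⟨e₂, he₂⟩ := hΦ.exists_isPatch_of_deriv hp hp1 hC₀ hg hB hw hwi hG (fun _ => rfl) d 0
    (k + (1 / 2) ^ (0 + 1)) (hhalf _)
  have h3 := he₁.add hp hp1 he₂ (by norm_num) (by norm_num)
  have h4 : k + (1 / 2) ^ (0 + 1) + (1 / 2) ^ (0 + 1) = k + 1 := by norm_num [add_assoc]
  rw [h4] at h3
  refine ⟨_, h3.mono ?_⟩
  rw [add_add_add_comm, ← mul_add, ← lintegral_union measurableSet_Ioc
    (Set.Ioc_disjoint_Ioc_of_le le_rfl), Set.Ioc_union_Ioc_eq_Ioc (by norm_num) (by norm_num)]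
  gcongr
  refine le_trans ?_ hcδ
  have h5 : 0 ≤ (1 / 2) ^ (0 + d + 1) * B 0 := mul_nonneg (by positivity) (hB0 0)
  have h6 : ((1 / 2) ^ (0 + d + 1) * B 0) ^ p ≤ c ^ p := Real.rpow_le_rpow h5 hBd hp.le
  rw [pow_zero, one_mul, ← ENNReal.ofReal_add (Real.rpow_nonneg h5 p) (Real.rpow_nonneg h5 p)]
  exact ENNReal.ofReal_le_ofReal (by linarith)

end Cells


/-! ### Tameness and boundedness of derivatives. -/

section Bounds

variable {𝕜 : Type*} [RCLike 𝕜] {p : ℝ} {W : ℕ → ℝ}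

theorem enorm_le_eLpNorm_top {f : ℝ → 𝕜} (hf : Continuous f) (x : ℝ) :
    ‖f x‖ₑ ≤ eLpNorm f ⊤ volume := by
  have h1 : ∀ᵐ y ∂(volume : Measure ℝ), ‖f y‖ₑ ≤ eLpNorm f ⊤ volume := by
    rw [eLpNorm_exponent_top]
    exact ae_le_eLpNormEssSup
  have h2 : IsClosed {y | ‖f y‖ₑ ≤ eLpNorm f ⊤ volume} :=
    isClosed_le hf.enorm continuous_const
  have h3 := (Measure.dense_of_ae h1).closure_eq
  rw [h2.closure_eq] at h3
  exact h3.ge (Set.mem_univ x)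

/-- A large value of $u$ persists, up to $A$, over a unit interval, and the $L^p$ norm limits it
there. -/
theorem exists_bound_of_deriv_bound (hp : 0 < p) {u u' : ℝ → 𝕜} (hu : ∀ x, HasDerivAt u (u' x) x)
    {A : ℝ} (hA : ∀ x, ‖u' x‖ ≤ A) (hup : ∫⁻ x, ‖u x‖ₑ ^ p ≠ ⊤) : ∃ B, ∀ x, ‖u x‖ ≤ B := by
  set I := ∫⁻ x, ‖u x‖ₑ ^ p with hI
  refine ⟨A + I.toReal ^ p⁻¹, fun x => ?_⟩
  have hA0 : 0 ≤ A := (norm_nonneg _).trans (hA 0)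
  by_contra! hlt
  have hs : 0 ≤ ‖u x‖ - A := by
    have : 0 ≤ I.toReal ^ p⁻¹ := by positivity
    linarith
  have h1 : ∀ y ∈ Set.Ioc x (x + 1), ENNReal.ofReal ((‖u x‖ - A) ^ p) ≤ ‖u y‖ₑ ^ p := by
    intro y hy
    rw [← ofReal_norm, ENNReal.ofReal_rpow_of_nonneg (norm_nonneg _) hp.le]
    refine ENNReal.ofReal_le_ofReal (Real.rpow_le_rpow hs ?_ hp.le)
    have h2 := convex_univ.norm_image_sub_le_of_norm_hasDerivWithin_le
      (fun w _ => (hu w).hasDerivWithinAt) (fun w _ => hA w) (Set.mem_univ y) (Set.mem_univ x)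
    have h3 : ‖x - y‖ ≤ 1 := by
      rw [Real.norm_eq_abs, abs_le]
      constructor <;> linarith [hy.1, hy.2]
    have h4 := norm_sub_norm_le (u x) (u y)
    have h5 := mul_le_of_le_one_right hA0 h3
    linarith
  have h2 : ENNReal.ofReal ((‖u x‖ - A) ^ p) ≤ I := by
    have := setLIntegral_mono' (μ := volume) measurableSet_Ioc h1
    rw [setLIntegral_const, Real.volume_Ioc, add_sub_cancel_left, ENNReal.ofReal_one, mul_one]
      at this
    exact this.trans (setLIntegral_le_lintegral _ _)
  rw [← ENNReal.ofReal_toReal hup, ENNReal.ofReal_le_ofReal_iff ENNReal.toReal_nonneg] at h2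
  have h3 := Real.rpow_le_rpow (Real.rpow_nonneg hs p) h2 (inv_pos.2 hp).le
  rw [Real.rpow_rpow_inv hs hp.ne'] at h3
  linarith

theorem hasDerivAt_iteratedDeriv {g : ℝ → 𝕜} (hg : ContDiff ℝ (⊤ : ℕ∞) g) (n : ℕ) (x : ℝ) :
    HasDerivAt (iteratedDeriv n g) (iteratedDeriv (n + 1) g x) x := by
  rw [iteratedDeriv_succ]
  exact ((contDiff_iteratedDeriv_of_smooth hg n).differentiable (by simp) x).hasDerivAt

/-- All derivatives of a test function are bounded. -/
theorem IsTame.eLpNorm_top_ne_top {θ : ℝ} (hp : 0 < p) (hp1 : p < 1) {g : ℝ → 𝕜}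
    (hg : ContDiff ℝ (⊤ : ℕ∞) g) (hgt : IsTame p θ g) (hgW : carlemanNorm p W g ≠ ⊤) (n : ℕ) :
    eLpNorm (_root_.iteratedDeriv n g) ⊤ volume ≠ ⊤ := by
  obtain ⟨n₀, hn₀⟩ := eventually_atTop.1 ((isTame_iff hp1 θ g).1 hgt (θ + 1) (by linarith))
  -- Tameness bounds derivatives of high order only; descending induction on the order reaches the
  -- others.
  have key : ∀ j n, n₀ ≤ n + j → eLpNorm (_root_.iteratedDeriv n g) ⊤ volume ≠ ⊤ := by
    intro j
    induction j with
    | zero => exact fun n hn => ne_top_of_le_ne_top ENNReal.ofReal_ne_top (hn₀ n hn)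
    | succ j ih =>
      intro n hn
      have h1 := ih (n + 1) (by omega)
      have h2 : ∀ x, ‖_root_.iteratedDeriv (n + 1) g x‖ ≤
          (eLpNorm (_root_.iteratedDeriv (n + 1) g) ⊤ volume).toReal := by
        intro x
        rw [← toReal_enorm]
        exact ENNReal.toReal_mono h1
          (enorm_le_eLpNorm_top (continuous_iteratedDeriv_of_smooth hg _) x)
      obtain ⟨B, hB⟩ := exists_bound_of_deriv_bound hp (hasDerivAt_iteratedDeriv hg n) h2 (by
        rw [← eLpNorm_rpow_eq hp]
        refine ENNReal.rpow_ne_top_of_nonneg hp.le (ne_top_of_le_ne_top ?_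
          (eLpNorm_le_carlemanNorm W g n hgW))
        exact ENNReal.mul_ne_top ENNReal.ofReal_ne_top hgW)
      exact (memLp_top_of_bound
        (continuous_iteratedDeriv_of_smooth hg n).aestronglyMeasurable B
        (Eventually.of_forall hB)).2.ne
  exact key n₀ n (by omega)

theorem eventually_mul_exp_sq_le (hp : 0 < p) (hp1 : p < 1) (S A : ℝ) {b : ℝ} (hb : 0 < b) :
    ∀ᶠ n : ℕ in atTop, (S + n) * Real.exp (A * (n + 1) ^ 2) ≤ Real.exp (b / (1 - p) ^ n) := by
  have hq0 : 0 < 1 - p := by linarith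
  have h1 := (tendsto_pow_const_mul_const_pow_of_abs_lt_one 2
    (show |1 - p| < 1 by rw [abs_of_pos hq0]; linarith)).const_mul (|S| + 1 + 4 * |A|)
  rw [mul_zero] at h1
  filter_upwards [h1.eventually_lt_const hb, eventually_ge_atTop 1] with n hn hn1
  have hn1' : (1 : ℝ) ≤ n := by exact_mod_cast hn1
  have h2 : S + n ≤ Real.exp (|S| + n) := by
    have := Real.add_one_le_exp (|S| + n)
    linarith [le_abs_self S]
  refine (mul_le_mul_of_nonneg_right h2 (Real.exp_pos _).le).trans ?_
  rw [← Real.exp_add, Real.exp_le_exp, le_div_iff₀ (pow_pos hq0 n)]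
  refine le_trans ?_ hn.le
  rw [← mul_assoc]
  refine mul_le_mul_of_nonneg_right ?_ (pow_pos hq0 n).le
  have h3 : A * ((n : ℝ) + 1) ^ 2 ≤ |A| * (4 * n ^ 2) :=
    mul_le_mul (le_abs_self A) (by nlinarith) (by positivity) (abs_nonneg A)
  have h4 : |S| ≤ |S| * (n : ℝ) ^ 2 := le_mul_of_one_le_right (abs_nonneg S) (by nlinarith)
  nlinarith

/-- Quadratic exponents and sums over lower orders do not affect the limsup defining tameness.
Nonnegativity of $\theta$ makes $e^{b'(1-p)^{-i}}$ increasing in $i$ for $b'>\theta$, so the last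
term controls the earlier ones. -/
theorem isTame_of_sum_bound (hp : 0 < p) (hp1 : p < 1) {θ : ℝ} (hθ : 0 ≤ θ) {e : ℝ → 𝕜}
    {B : ℕ → ℝ} (hB : ∀ n, 0 ≤ B n)
    (hBθ : ∀ b, θ < b → ∀ᶠ n : ℕ in atTop, B n ≤ Real.exp (b / (1 - p) ^ n)) {A : ℝ}
    (he : ∀ n x, ‖iteratedDeriv n e x‖ ≤
      (1 + ∑ i ∈ Finset.range (n + 1), B i) * Real.exp (A * (n + 1) ^ 2)) : IsTame p θ e := by
  have hq0 : 0 < 1 - p := by linarith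
  rw [isTame_iff hp1]
  intro b hb
  obtain ⟨b', hb', hb'b⟩ := exists_between hb
  have hb'0 : 0 < b' := by linarith
  obtain ⟨n₀, hn₀⟩ := eventually_atTop.1 (hBθ b' hb')
  set S := ∑ i ∈ Finset.range n₀, B i with hS
  have hS0 : 0 ≤ S := Finset.sum_nonneg fun i _ => hB i
  filter_upwards [eventually_mul_exp_sq_le hp hp1 (S + 2) A (sub_pos.2 hb'b)] with n hn
  have hX : ∀ i ≤ n, Real.exp (b' / (1 - p) ^ i) ≤ Real.exp (b' / (1 - p) ^ n) := by
    intro i hi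
    rw [Real.exp_le_exp]
    have := pow_le_pow_of_le_one hq0.le (by linarith) hi
    have := pow_pos hq0 n
    gcongr
  set X := Real.exp (b' / (1 - p) ^ n) with hXdef
  have hX1 : 1 ≤ X := Real.one_le_exp (by positivity)
  have h1 : ∑ i ∈ Finset.range (n + 1), B i ≤ S + (n + 1) * X := by
    have h2 : ∀ i ∈ Finset.range (n + 1), B i ≤ (if i < n₀ then B i else 0) + X := by
      intro i hi
      split_ifs with h
      · linarith
      · rw [zero_add]
        exact (hn₀ i (not_lt.1 h)).trans (hX i (Nat.lt_succ_iff.1 (Finset.mem_range.1 hi)))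
    refine (Finset.sum_le_sum h2).trans ?_
    rw [Finset.sum_add_distrib, ← Finset.sum_filter, Finset.sum_const, Finset.card_range,
      nsmul_eq_mul]
    push_cast
    gcongr
    refine Finset.sum_le_sum_of_subset_of_nonneg (fun i hi => ?_) fun i _ _ => hB i
    exact Finset.mem_range.2 (Finset.mem_filter.1 hi).2
  have h3 : 1 + ∑ i ∈ Finset.range (n + 1), B i ≤ (S + 2 + n) * X := by nlinarith
  rw [eLpNorm_exponent_top]
  refine eLpNormEssSup_le_of_ae_bound (Eventually.of_forall fun x => (he n x).trans ?_)
  calc _ ≤ (S + 2 + n) * X * Real.exp (A * (n + 1) ^ 2) := by gcongr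
    _ = (S + 2 + n) * Real.exp (A * (n + 1) ^ 2) * X := by ring
    _ ≤ Real.exp ((b - b') / (1 - p) ^ n) * X := by gcongr
    _ = _ := by
      rw [hXdef, ← Real.exp_add]
      congr 1
      ring

theorem IsTame.of_deriv (hp1 : p < 1) {θ : ℝ} {f : ℝ → 𝕜}
    (hf : IsTame p (θ / (1 - p)) (deriv f)) : IsTame p θ f := by
  have hq0 : 0 < 1 - p := by linarith
  rw [isTame_iff hp1] at *
  intro b hb
  obtain ⟨n₀, hn₀⟩ := eventually_atTop.1 (hf (b / (1 - p)) (by gcongr))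
  filter_upwards [eventually_ge_atTop (n₀ + 1)] with n hn
  obtain ⟨k, rfl⟩ := Nat.exists_eq_add_of_le' (show 1 ≤ n by omega)
  have := hn₀ k (by omega)
  rwa [← iteratedDeriv_succ', div_div, ← pow_succ'] at this

theorem carlemanNorm_rpow_le (hp : 0 < p) (hW : ∀ n, 0 < W n) {e : ℝ → 𝕜} {T : ℝ≥0∞}
    (h : ∀ n, ∫⁻ x, ‖iteratedDeriv n e x‖ₑ ^ p ≤
      ENNReal.ofReal (Real.exp (p * Real.log (W n))) * T) : carlemanNorm p W e ^ p ≤ T := by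
  rw [← ENNReal.le_rpow_inv_iff hp]
  refine iSup_le fun n => ?_
  rw [ENNReal.le_rpow_inv_iff hp, ENNReal.div_rpow_of_nonneg _ _ hp.le, eLpNorm_rpow_eq hp]
  refine ENNReal.div_le_of_le_mul' ((h n).trans_eq ?_)
  rw [ENNReal.ofReal_rpow_of_pos (hW n), Real.rpow_def_of_pos (hW n), mul_comm p]

end Bounds

/-! ### The two approximations behind density. -/

section Approximation

variable {𝕜 : Type*} [RCLike 𝕜] {p : ℝ} {W : ℕ → ℝ} {G : ℝ → 𝕜} {C₀ E : ℝ} {Φ : ℕ → ℝ → ℝ}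

/-- Cells in the finite set use fixed-scale patches, whose growth constants are simply added
together. All other cells must come with one common bound. -/
theorem IsKernelFamily.exists_glue (hΦ : IsKernelFamily p W C₀ E Φ) (hp : 0 < p) (hp1 : p < 1)
    (hE : 0 ≤ E) (hG : Continuous G) {B : ℕ → ℝ} (hB : ∀ n, 0 ≤ B n) (F : Finset ℤ)
    {T : ℤ → ℝ≥0∞} (hT : ∀ k, T k ≠ 0) (htail : ∀ k : ℤ, k ∉ F → ∃ e, IsPatch p W G k (k + 1)
      (fun n => (1 + ∑ i ∈ Finset.range (n + 1), B i) * Real.exp (E * (n + 1) ^ 2)) (T k) e) :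
    ∃ (A : ℝ) (f : ℝ → 𝕜), ContDiff ℝ (⊤ : ℕ∞) f ∧
      (∀ n x, ‖iteratedDeriv n f x‖ ≤
        (1 + ∑ i ∈ Finset.range (n + 1), B i) * Real.exp (A * (n + 1) ^ 2)) ∧
      (∀ n, ∫⁻ x, ‖iteratedDeriv n f x‖ₑ ^ p ≤
        ENNReal.ofReal (Real.exp (p * Real.log (W n))) * ∑' k, T k) ∧
      ∫⁻ x, ‖G x - G 0 - ∫ t in 0..x, f t‖ₑ ^ p ≤ ∑' k, T k := by
  choose A e hA he using fun k : ℤ => hΦ.exists_cell_of_continuous hp hp1 hG (k : ℝ) (hT k)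
  set A' := E + ∑ k ∈ F, A k with hA'
  have hsum : ∀ n, 1 ≤ 1 + ∑ i ∈ Finset.range (n + 1), B i := fun n => by
    have : 0 ≤ ∑ i ∈ Finset.range (n + 1), B i := Finset.sum_nonneg fun i _ => hB i
    linarith
  have hEA : E ≤ A' := by
    have : 0 ≤ ∑ k ∈ F, A k := Finset.sum_nonneg fun k _ => hA k
    linarith
  have hall : ∀ k : ℤ, ∃ e, IsPatch p W G k (k + 1)
      (fun n => (1 + ∑ i ∈ Finset.range (n + 1), B i) * Real.exp (A' * (n + 1) ^ 2)) (T k) e := by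
    intro k
    by_cases hk : k ∈ F
    · refine ⟨e k, (he k).mono_bound fun n => ?_⟩
      have h1 : A k ≤ A' := by
        have := Finset.single_le_sum (f := A) (fun k _ => hA k) hk
        linarith
      refine le_trans ?_ (le_mul_of_one_le_left (Real.exp_pos _).le (hsum n))
      gcongr
    · obtain ⟨e', he'⟩ := htail k hk
      refine ⟨e', he'.mono_bound fun n => ?_⟩
      have := hsum n
      gcongr
  choose e' he' using hall
  exact ⟨A', LpCarleman.exists_glue he'⟩

/-- Every test function for the shifted sequence is nearly the derivative of a function that is
small in `L^p`. -/
theorem IsDisconnecting.exists_small_primitive (hW : IsDisconnecting p W) (hp : 0 < p)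
    (hp1 : p < 1) {θ : ℝ} (hθ : 0 ≤ θ) {g : ℝ → 𝕜} (hg : ContDiff ℝ (⊤ : ℕ∞) g)
    (hgW : carlemanNorm p W g ≠ ⊤) (hgt : IsTame p θ g) {ε : ℝ≥0∞} (hε : ε ≠ 0) :
    ∃ f : ℝ → 𝕜, ContDiff ℝ (⊤ : ℕ∞) f ∧ IsTame p θ (deriv f) ∧ ∫⁻ x, ‖f x‖ₑ ^ p ≤ ε ∧
      carlemanNorm p W (deriv f - g) ^ p ≤ ε := by
  have hq0 : 0 < 1 - p := by linarith
  obtain ⟨C₀, E, Φ, hC₀, hE, hΦ⟩ := hW.exists_kernelFamily hp hp1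
  have htop := hgt.eLpNorm_top_ne_top (W := W) hp hp1 hg hgW
  set B : ℕ → ℝ := fun n => (eLpNorm (iteratedDeriv n g) ⊤ volume).toReal with hBdef
  have hB0 : ∀ n, 0 ≤ B n := fun n => ENNReal.toReal_nonneg
  have hB : ∀ n x, ‖iteratedDeriv n g x‖ ≤ B n := fun n x => by
    rw [← toReal_enorm]
    exact ENNReal.toReal_mono (htop n)
      (enorm_le_eLpNorm_top (continuous_iteratedDeriv_of_smooth hg n) x)
  -- A single density to which all derivatives can be charged at once. The geometric weights make it
  -- integrable.
  set w : ℝ → ℝ≥0∞ := fun x => ∑' n, ENNReal.ofReal ((1 - p) ^ n) *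
    (ENNReal.ofReal (Real.exp (-(p * Real.log (W n)))) * ‖iteratedDeriv n g x‖ₑ ^ p) with hw
  have hcancel : ∀ n, ENNReal.ofReal (Real.exp (p * Real.log (W n))) *
      ENNReal.ofReal (Real.exp (-(p * Real.log (W n)))) = 1 := fun n => by
    rw [← ENNReal.ofReal_mul (Real.exp_pos _).le, ← Real.exp_add, add_neg_cancel, Real.exp_zero,
      ENNReal.ofReal_one]
  have hwle : ∀ n x, ENNReal.ofReal ((1 - p) ^ n) * ‖iteratedDeriv n g x‖ₑ ^ p ≤
      ENNReal.ofReal (Real.exp (p * Real.log (W n))) * w x := by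
    intro n x
    calc _ = ENNReal.ofReal (Real.exp (p * Real.log (W n))) * (ENNReal.ofReal ((1 - p) ^ n) *
          (ENNReal.ofReal (Real.exp (-(p * Real.log (W n)))) * ‖iteratedDeriv n g x‖ₑ ^ p)) := by
          rw [mul_left_comm, ← mul_assoc (ENNReal.ofReal (Real.exp (p * Real.log (W n)))),
            hcancel, one_mul]
      _ ≤ _ := by
          gcongr
          exact ENNReal.le_tsum (f := fun n => ENNReal.ofReal ((1 - p) ^ n) *
            (ENNReal.ofReal (Real.exp (-(p * Real.log (W n)))) * ‖iteratedDeriv n g x‖ₑ ^ p)) n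
  have hmeas : ∀ n, Measurable fun x => ‖iteratedDeriv n g x‖ₑ ^ p := fun n =>
    (continuous_iteratedDeriv_of_smooth hg n).measurable.enorm.pow_const p
  have hwi : ∫⁻ x, w x ≠ ⊤ := by
    rw [hw, lintegral_tsum fun n => (((hmeas n).const_mul _).const_mul _).aemeasurable]
    have h1 : ∀ n, ∫⁻ x, ENNReal.ofReal ((1 - p) ^ n) *
        (ENNReal.ofReal (Real.exp (-(p * Real.log (W n)))) * ‖iteratedDeriv n g x‖ₑ ^ p) ≤
          ENNReal.ofReal ((1 - p) ^ n) * carlemanNorm p W g ^ p := by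
      intro n
      rw [lintegral_const_mul' _ _ ENNReal.ofReal_ne_top,
        lintegral_const_mul' _ _ ENNReal.ofReal_ne_top, ← eLpNorm_rpow_eq hp]
      gcongr
      have h2 := ENNReal.rpow_le_rpow (eLpNorm_le_carlemanNorm W g n hgW) hp.le
      rw [ENNReal.mul_rpow_of_nonneg _ _ hp.le, ENNReal.ofReal_rpow_of_pos (hW.pos n),
        Real.rpow_def_of_pos (hW.pos n), mul_comm (Real.log _)] at h2
      calc _ ≤ ENNReal.ofReal (Real.exp (-(p * Real.log (W n)))) *
            (ENNReal.ofReal (Real.exp (p * Real.log (W n))) * carlemanNorm p W g ^ p) := by gcongr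
        _ = _ := by rw [← mul_assoc, mul_comm (ENNReal.ofReal (Real.exp (-_))), hcancel, one_mul]
    refine ne_top_of_le_ne_top ?_ (ENNReal.tsum_le_tsum h1)
    rw [ENNReal.tsum_mul_right]
    refine ENNReal.mul_ne_top ?_ (ENNReal.rpow_ne_top_of_nonneg hp.le hgW)
    rw [← ENNReal.ofReal_tsum_of_nonneg (fun n => by positivity)
      (summable_geometric_of_lt_one hq0.le (by linarith))]
    exact ENNReal.ofReal_ne_top
  set G : ℝ → 𝕜 := fun x => ∫ t in 0..x, g t with hG
  have hgi : ∀ x y, IntervalIntegrable g volume x y := fun x y =>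
    hg.continuous.intervalIntegrable x y
  have hGd : ∀ x, HasDerivAt G (g x) x := fun x =>
    intervalIntegral.integral_hasDerivAt_right (hgi _ _)
      (hg.continuous.stronglyMeasurableAtFilter _ _) hg.continuous.continuousAt
  have hGc : Continuous G := continuous_iff_continuousAt.2 fun x => (hGd x).continuousAt
  have hGsub : ∀ x y, G y - G x = ∫ t in x..y, g t := fun x y =>
    intervalIntegral.integral_interval_sub_left (hgi _ _) (hgi _ _)
  set w' : ℤ → ℝ≥0∞ := fun k => ∫⁻ x in Set.Ioc (k : ℝ) (k + 1), w x with hw'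
  rw [lintegral_eq_tsum_Ioc] at hwi
  have hε2 : ε / 2 ≠ 0 := (ENNReal.half_pos hε).ne'
  obtain ⟨δ, hδ0, hδ⟩ := ENNReal.exists_pos_sum_of_countable' hε2 ℤ
  have hC₀' : ENNReal.ofReal (2 * C₀) ≠ 0 := by
    rw [ne_eq, ENNReal.ofReal_eq_zero]
    linarith
  have hsmall : 0 < ε / 2 / ENNReal.ofReal (2 * C₀) :=
    ENNReal.div_pos hε2 ENNReal.ofReal_ne_top
  obtain ⟨F, hF⟩ := ((ENNReal.tendsto_tsum_compl_atTop_zero hwi).eventually_lt_const hsmall).exists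
  -- Only cells outside `F` are charged to `w`, and their total charge is at most $\varepsilon/2$.
  -- Cells in `F` cost only their share of $\sum\delta_k$.
  set T : ℤ → ℝ≥0∞ := fun k =>
    ENNReal.ofReal (2 * C₀) * ({k | k ∉ F} : Set ℤ).indicator w' k + δ k with hT
  obtain ⟨A, e, he, hez, hel, heG⟩ := hΦ.exists_glue hp hp1 hE hGc hB0 F (T := T)
    (fun k => ((hδ0 k).trans_le le_add_self).ne') (fun k hk => by
      obtain ⟨e, he⟩ := hΦ.exists_cell_of_deriv hp hp1 hC₀ hg hB hwle
        (by rw [lintegral_eq_tsum_Ioc]; exact hwi) hGsub (k : ℝ) (hδ0 k).ne'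
      refine ⟨e, he.mono ?_⟩
      simp only [hT]
      rw [Set.indicator_of_mem (show k ∈ ({k | k ∉ F} : Set ℤ) from hk)])
  have hTsum : ∑' k, T k ≤ ε := by
    rw [hT, ENNReal.tsum_add, ENNReal.tsum_mul_left, ← tsum_subtype]
    have h1 : ENNReal.ofReal (2 * C₀) * ∑' x : {k // k ∉ F}, w' x ≤ ε / 2 :=
      ENNReal.mul_le_of_le_div' hF.le
    calc _ ≤ ε / 2 + ε / 2 := add_le_add h1 hδ.le
      _ = ε := ENNReal.add_halves ε
  have hed : ∀ x, HasDerivAt (fun x => ∫ t in 0..x, e t) (e x) x := fun x =>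
    intervalIntegral.integral_hasDerivAt_right (he.continuous.intervalIntegrable _ _)
      (he.continuous.stronglyMeasurableAtFilter _ _) he.continuous.continuousAt
  have hfd : ∀ x, HasDerivAt (fun x => G x - ∫ t in 0..x, e t) (g x - e x) x := fun x =>
    (hGd x).sub (hed x)
  have hder : deriv (fun x => G x - ∫ t in 0..x, e t) = g + (-1 : 𝕜) • e := by
    funext x
    rw [(hfd x).deriv]
    simp [sub_eq_add_neg]
  have hsm : ContDiff ℝ (⊤ : ℕ∞) (g + (-1 : 𝕜) • e) := hg.add (contDiff_const.smul he)
  refine ⟨fun x => G x - ∫ t in 0..x, e t, ?_, ?_, ?_, ?_⟩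
  · rw [contDiff_infty_iff_deriv, hder]
    exact ⟨fun x => (hfd x).differentiableAt, hsm⟩
  · rw [hder]
    refine hgt.add hp hp1 hg (contDiff_const.smul he) (IsTame.smul hp hp1 _ ?_)
    refine isTame_of_sum_bound hp hp1 hθ hB0 (fun b hb => ?_) hez
    filter_upwards [(isTame_iff hp1 θ g).1 hgt b hb] with n hn
    exact ENNReal.toReal_le_of_le_ofReal (Real.exp_pos _).le hn
  · refine le_trans (le_of_eq ?_) (heG.trans hTsum)
    have hG0 : G 0 = 0 := intervalIntegral.integral_same
    simp [hG0]
  · rw [hder, add_sub_cancel_left, carlemanNorm_smul]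
    simp only [enorm_neg, enorm_one, one_mul]
    refine carlemanNorm_rpow_le hp hW.pos fun n => (hel n).trans ?_
    gcongr

/-- Every element of `L^p` is nearly a smooth function with small derivatives. -/
theorem IsDisconnecting.exists_smooth_approx (hW : IsDisconnecting p W) (hp : 0 < p)
    (hp1 : p < 1) {θ : ℝ} (hθ : 0 ≤ θ) {h : ℝ → 𝕜} (hh : MemLp h (ENNReal.ofReal p) volume)
    {ε : ℝ≥0∞} (hε : ε ≠ 0) :
    ∃ f : ℝ → 𝕜, ContDiff ℝ (⊤ : ℕ∞) f ∧ IsTame p θ (deriv f) ∧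
      ∫⁻ x, ‖f x - h x‖ₑ ^ p ≤ ε ∧ carlemanNorm p W (deriv f) ^ p ≤ ε := by
  obtain ⟨C₀, E, Φ, hC₀, hE, hΦ⟩ := hW.exists_kernelFamily hp hp1
  have hε2 : ε / 2 ≠ 0 := (ENNReal.half_pos hε).ne'
  have hε2' : (ε / 2) ^ p⁻¹ ≠ 0 := by
    rw [ne_eq, ENNReal.rpow_eq_zero_iff_of_pos (inv_pos.2 hp)]
    exact hε2
  obtain ⟨G, hGs, hGh, hGc, -⟩ := hh.exists_hasCompactSupport_eLpNorm_sub_le ENNReal.ofReal_ne_top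
    hε2'
  rw [ENNReal.le_rpow_inv_iff hp, eLpNorm_rpow_eq hp] at hGh
  obtain ⟨R, hR⟩ := hGs.isCompact.isBounded.subset_closedBall 0
  have hG0 : ∀ x, R < |x| → G x = 0 := by
    intro x hx
    refine image_eq_zero_of_notMem_tsupport fun hx' => ?_
    have := hR hx'
    rw [mem_closedBall_zero_iff, Real.norm_eq_abs] at this
    linarith
  obtain ⟨N, hN⟩ := exists_nat_gt R
  obtain ⟨δ, hδ0, hδ⟩ := ENNReal.exists_pos_sum_of_countable' hε2 ℤ
  -- Beyond the support of `G` the zero patch suffices, so no bounds on derivatives of `G` are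
  -- needed and `B` may vanish.
  obtain ⟨A, e, he, hez, hel, heG⟩ := hΦ.exists_glue hp hp1 hE hGc (B := fun _ => 0)
    (fun _ => le_rfl) (Finset.Icc (-(N : ℤ) - 1) N) (T := δ) (fun k => (hδ0 k).ne') (fun k hk => by
      have hk' : ∀ x ∈ Set.Icc (k : ℝ) (k + 1), G x = 0 := by
        intro x hx
        refine hG0 x (hN.trans ?_)
        rw [Finset.mem_Icc, not_and_or, not_le, not_le] at hk
        rcases hk with hk | hk
        · have h1 : (k : ℝ) + 1 + 1 ≤ -(N : ℝ) := by exact_mod_cast (show k + 1 + 1 ≤ -(N : ℤ) by omega)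
          have := neg_le_abs x
          linarith [hx.2]
        · have h1 : (N : ℝ) < k := by exact_mod_cast hk
          have := le_abs_self x
          linarith [hx.1]
      refine ⟨_, (IsPatch.zero hp (fun x hx => ?_) (by linarith) fun n => by positivity).mono
        zero_le⟩
      rw [hk' x hx, hk' k ⟨le_rfl, by linarith⟩])
  have hed : ∀ x, HasDerivAt (fun x => G 0 + ∫ t in 0..x, e t) (e x) x := fun x =>
    (intervalIntegral.integral_hasDerivAt_right (he.continuous.intervalIntegrable _ _)
      (he.continuous.stronglyMeasurableAtFilter _ _) he.continuous.continuousAt).const_add _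
  have hder : deriv (fun x => G 0 + ∫ t in 0..x, e t) = e := funext fun x => (hed x).deriv
  have hfc : Continuous fun x => G 0 + ∫ t in 0..x, e t :=
    continuous_iff_continuousAt.2 fun x => (hed x).continuousAt
  refine ⟨fun x => G 0 + ∫ t in 0..x, e t, ?_, ?_, ?_, ?_⟩
  · rw [contDiff_infty_iff_deriv, hder]
    exact ⟨fun x => (hed x).differentiableAt, he⟩
  · rw [hder]
    refine isTame_of_sum_bound hp hp1 hθ (fun _ => le_rfl) (fun b hb => ?_) hez
    exact Eventually.of_forall fun n => (Real.exp_pos _).le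
  · have h1 := eLpNorm_rpow_add_le (𝕜 := 𝕜) hp hp1
      (f := (fun x => G 0 + ∫ t in 0..x, e t) - G) (g := G - h)
      (hfc.sub hGc).aestronglyMeasurable
    rw [sub_add_sub_cancel, eLpNorm_rpow_eq hp, eLpNorm_rpow_eq hp, eLpNorm_rpow_eq hp] at h1
    refine h1.trans ?_
    rw [← ENNReal.add_halves ε]
    refine add_le_add (le_trans (le_of_eq ?_) (heG.trans hδ.le)) (le_trans (le_of_eq ?_) hGh)
    · refine lintegral_congr fun x => ?_
      rw [← enorm_neg, Pi.sub_apply]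
      congr 2
      abel
    · refine lintegral_congr fun x => ?_
      rw [← enorm_neg]
      simp
  · rw [hder]
    refine carlemanNorm_rpow_le hp hW.pos fun n => (hel n).trans ?_
    gcongr
    exact hδ.le.trans ENNReal.half_le_self

end Approximation


/-! ### Density of the pairs and of the longer tuples of derivatives. -/

section Density

variable {𝕜 : Type*} [RCLike 𝕜] {p : ℝ} {M : ℕ → ℝ}

/-- The quasinorm is controlled by finitely many derivatives and the quasinorm of the next one. -/
theorem carlemanNorm_rpow_le_sum (hp : 0 < p) (M : ℕ → ℝ) (f : ℝ → 𝕜) (k : ℕ) :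
    carlemanNorm p M f ^ p ≤ ∑ i ∈ Finset.range k,
      (eLpNorm (iteratedDeriv i f) (ENNReal.ofReal p) volume / ENNReal.ofReal (M i)) ^ p +
        carlemanNorm p (shift k M) (iteratedDeriv k f) ^ p := by
  rw [← ENNReal.le_rpow_inv_iff hp]
  refine iSup_le fun n => ?_
  rw [ENNReal.le_rpow_inv_iff hp]
  rcases lt_or_ge n k with hn | hn
  · exact (Finset.single_le_sum (f := fun i =>
      (eLpNorm (iteratedDeriv i f) (ENNReal.ofReal p) volume / ENNReal.ofReal (M i)) ^ p)
      (fun _ _ => zero_le) (Finset.mem_range.2 hn)).trans le_self_add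
  · obtain ⟨m, rfl⟩ := Nat.exists_eq_add_of_le' hn
    refine le_trans (ENNReal.rpow_le_rpow ?_ hp.le) le_add_self
    rw [← iteratedDeriv_iteratedDeriv]
    exact le_iSup (fun m : ℕ => eLpNorm (iteratedDeriv m (iteratedDeriv k f)) (ENNReal.ofReal p)
      volume / ENNReal.ofReal (shift k M m)) m

theorem IsPRegular.exists_test_approx [hp : Fact (p ∈ Set.Ioo (0 : ℝ) 1)] (hM : IsPRegular p M)
    {θ : ℝ} (hθ : 0 ≤ θ) {h : ℝ → 𝕜} (hh : MemLp h (ENNReal.ofReal p) volume) {g : ℝ → 𝕜}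
    (hg : g ∈ testSubmodule 𝕜 p (θ / (1 - p)) (shift 1 M)) {ε : ℝ≥0∞} (hε : ε ≠ 0) :
    ∃ f ∈ testSubmodule 𝕜 p θ M, eLpNorm (f - h) (ENNReal.ofReal p) volume ^ p ≤ ε ∧
      carlemanNorm p (shift 1 M) (deriv f - g) ^ p ≤ ε := by
  obtain ⟨hp0, hp1⟩ := hp.out
  have hW := hM.isDisconnecting_shift hp0 hp1
  have hθ' : 0 ≤ θ / (1 - p) := div_nonneg hθ (by linarith)
  -- Finite errors are needed for membership: the sum has finite quasinorm because it is finitely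
  -- close to `h` and its derivative to `g`.
  wlog hεt : ε ≠ ⊤ generalizing ε
  · obtain ⟨f, hf, h1, h2⟩ := this one_ne_zero ENNReal.one_ne_top
    rw [not_not] at hεt
    exact ⟨f, hf, hεt ▸ le_top, hεt ▸ le_top⟩
  have hε2 : ε / 2 ≠ 0 := (ENNReal.half_pos hε).ne'
  obtain ⟨hgs, hgW, hgt⟩ := hg
  obtain ⟨f, hf, hft, hfi, hfW⟩ := hW.exists_small_primitive hp0 hp1 hθ' hgs hgW.ne hgt hε2
  obtain ⟨u, hu, hut, hui, huW⟩ := hW.exists_smooth_approx hp0 hp1 hθ' hh hε2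
  have hfd : ContDiff ℝ (⊤ : ℕ∞) (deriv f) := (contDiff_infty_iff_deriv.1 hf).2
  have hud : ContDiff ℝ (⊤ : ℕ∞) (deriv u) := (contDiff_infty_iff_deriv.1 hu).2
  have hder : deriv (f + u) = deriv f + deriv u := by
    have := iteratedDeriv_add_of_smooth hf hu 1
    simpa only [iteratedDeriv_one] using this
  have hLp : eLpNorm (f + u - h) (ENNReal.ofReal p) volume ^ p ≤ ε := by
    rw [add_sub_assoc, ← ENNReal.add_halves ε]
    refine (eLpNorm_rpow_add_le hp0 hp1 hf.continuous.aestronglyMeasurable).trans ?_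
    rw [eLpNorm_rpow_eq hp0, eLpNorm_rpow_eq hp0]
    exact add_le_add hfi hui
  have hC : carlemanNorm p (shift 1 M) (deriv (f + u) - g) ^ p ≤ ε := by
    rw [hder, add_sub_right_comm, ← ENNReal.add_halves ε]
    exact (carlemanNorm_rpow_add_le hp0 hp1 _ (hfd.sub hgs) hud).trans (add_le_add hfW huW)
  refine ⟨f + u, ⟨hf.add hu, ?_, hft.of_deriv hp1 |>.add hp0 hp1 hf hu (hut.of_deriv hp1)⟩, hLp, hC⟩
  rw [← ENNReal.rpow_lt_top_iff_of_pos hp0]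
  refine (carlemanNorm_rpow_le_sum hp0 M _ 1).trans_lt ?_
  rw [Finset.sum_range_one, iteratedDeriv_one, iteratedDeriv_zero]
  refine ENNReal.add_lt_top.2 ⟨ENNReal.rpow_lt_top_of_nonneg hp0.le ?_, ?_⟩
  · refine (ENNReal.div_lt_top ?_ (by simpa using hM.logConvex.1 0)).ne
    rw [← sub_add_cancel (f + u) h]
    refine (MemLp.add (f := f + u - h) ⟨(hf.add hu).continuous.aestronglyMeasurable.sub hh.1, ?_⟩
      hh).2.ne
    exact (ENNReal.rpow_lt_top_iff_of_pos hp0).1 (hLp.trans_lt hεt.lt_top)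
  · rw [← sub_add_cancel (deriv (f + u)) g]
    refine (carlemanNorm_rpow_add_le hp0 hp1 _ ?_ hgs).trans_lt ?_
    · rw [hder]
      exact (hfd.add hud).sub hgs
    · exact ENNReal.add_lt_top.2 ⟨hC.trans_lt hεt.lt_top,
        ENNReal.rpow_lt_top_of_nonneg hp0.le hgW.ne⟩

/-- Work from the highest derivative downwards: a test function $u$ at level $k$ takes care of the
last pair and then becomes the target of the induction hypothesis. -/
theorem IsPRegular.exists_test_approx_iterate [hp : Fact (p ∈ Set.Ioo (0 : ℝ) 1)]
    (hM : IsPRegular p M) {θ : ℝ} (hθ : 0 ≤ θ) {h : ℕ → ℝ → 𝕜}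
    (hh : ∀ i, MemLp (h i) (ENNReal.ofReal p) volume) (k : ℕ) {g : ℝ → 𝕜}
    (hg : g ∈ testSubmodule 𝕜 p (θ / (1 - p) ^ k) (shift k M)) {ε : ℝ≥0∞} (hε : ε ≠ 0) :
    ∃ f ∈ testSubmodule 𝕜 p θ M,
      (∀ i < k, eLpNorm (iteratedDeriv i f - h i) (ENNReal.ofReal p) volume ^ p ≤ ε) ∧
      carlemanNorm p (shift k M) (iteratedDeriv k f - g) ^ p ≤ ε := by
  obtain ⟨hp0, hp1⟩ := hp.out
  have hq0 : 0 < 1 - p := by linarith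
  induction k generalizing g ε with
  | zero =>
    refine ⟨g, by simpa [shift_zero] using hg, by simp, ?_⟩
    have h0 : carlemanNorm p M (0 : ℝ → 𝕜) = 0 := by
      simpa using carlemanNorm_smul (p := p) M (0 : 𝕜) (0 : ℝ → 𝕜)
    rw [iteratedDeriv_zero, sub_self, shift_zero, h0, ENNReal.zero_rpow_of_pos hp0]
    exact zero_le
  | succ k ih =>
    have hk := hM.shift_iterate hp0 hp1 k
    have hε2 : ε / 2 ≠ 0 := (ENNReal.half_pos hε).ne'
    obtain ⟨u, hu, hui, huW⟩ := hk.exists_test_approx (𝕜 := 𝕜) (div_nonneg hθ (pow_pos hq0 k).le)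
      (hh k) (g := g) (by rwa [div_div, ← pow_succ, shift_shift, add_comm 1 k]) hε2
    have hMk : ENNReal.ofReal (M k) ^ p ≠ ⊤ :=
      ENNReal.rpow_ne_top_of_nonneg hp0.le ENNReal.ofReal_ne_top
    -- The $L^p$ distance of the $k$-th derivative to $u$ is up to $M_k$ times the quasinorm
    -- distance, which explains the second entry.
    set η := min (ε / 2) (ε / 2 / ENNReal.ofReal (M k) ^ p) with hη
    have hη0 : η ≠ 0 := by
      refine (lt_min (pos_iff_ne_zero.2 hε2) (ENNReal.div_pos hε2 hMk)).ne'
    obtain ⟨f, hf, hfi, hfW⟩ := ih hu hη0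
    have hsm : ContDiff ℝ (⊤ : ℕ∞) (iteratedDeriv k f - u) :=
      (contDiff_iteratedDeriv_of_smooth hf.1 k).sub hu.1
    have hsplit : iteratedDeriv (k + 1) f = deriv (iteratedDeriv k f - u) + deriv u := by
      have := iteratedDeriv_add_of_smooth hsm hu.1 1
      rw [sub_add_cancel] at this
      simpa only [iteratedDeriv_one, ← iteratedDeriv_succ] using this
    refine ⟨f, hf, fun i hi => ?_, ?_⟩
    · rcases (Nat.lt_succ_iff_lt_or_eq.1 hi) with hi | rfl
      · exact (hfi i hi).trans ((min_le_left _ _).trans ENNReal.half_le_self)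
      · rw [← sub_add_sub_cancel _ u, ← ENNReal.add_halves ε]
        refine (eLpNorm_rpow_add_le hp0 hp1 hsm.continuous.aestronglyMeasurable).trans
          (add_le_add ?_ hui)
        by_cases htop : carlemanNorm p (shift i M) (iteratedDeriv i f - u) = ⊤
        · rw [htop, ENNReal.top_rpow_of_pos hp0, top_le_iff] at hfW
          have : ε / 2 = ⊤ := top_le_iff.1 (hfW.symm.le.trans (min_le_left _ _))
          rw [this]
          exact le_top
        have h1 := eLpNorm_le_carlemanNorm (p := p) (shift i M) (iteratedDeriv i f - u) 0 htop
        rw [iteratedDeriv_zero] at h1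
        have h2 := ENNReal.rpow_le_rpow h1 hp0.le
        rw [ENNReal.mul_rpow_of_nonneg _ _ hp0.le, shift, zero_add] at h2
        refine h2.trans (ENNReal.mul_le_of_le_div' (hfW.trans (min_le_right _ _)))
    · rw [hsplit, add_sub_assoc, ← ENNReal.add_halves ε]
      refine (carlemanNorm_rpow_add_le hp0 hp1 _ (contDiff_infty_iff_deriv.1 hsm).2
        ((contDiff_infty_iff_deriv.1 hu.1).2.sub ?_)).trans (add_le_add ?_ ?_)
      · exact hg.1
      · refine le_trans (ENNReal.rpow_le_rpow ?_ hp0.le) (hfW.trans (min_le_left _ _))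
        have := carlemanNorm_iteratedDeriv_le (p := p) (shift k M) (iteratedDeriv k f - u) 1
        rwa [shift_shift, add_comm 1 k, iteratedDeriv_one] at this
      · rwa [shift_shift, add_comm 1 k] at huW

end Density


/-! ### Extending a map with dense range to the completion. -/

section Extension

variable {𝕜 X Y : Type*} [RCLike 𝕜] [NormedAddCommGroup X] [Module 𝕜 X]
  [UniformContinuousConstSMul 𝕜 X] [NormedAddCommGroup Y] [Module 𝕜 Y] [ContinuousConstSMul 𝕜 Y]

/-- A linear map with dense range, bounded below and with a continuous extension to the
completion, extends to an isomorphism. -/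
theorem exists_completion_equiv {φ : UniformSpace.Completion X → Y} (hφ : UniformContinuous φ)
    (hadd : ∀ f g : X, φ ((f + g : X) : UniformSpace.Completion X) = φ f + φ g)
    (hsmul : ∀ (c : 𝕜) (f : X), φ ((c • f : X) : UniformSpace.Completion X) = c • φ f)
    {C : ℝ≥0} (hC : ∀ f : X, ‖f‖ ≤ C * ‖φ f‖)
    (hd : ∀ y, ∀ ε > 0, ∃ f : X, ‖φ f - y‖ < ε) :
    ∃ e : UniformSpace.Completion X ≃L[𝕜] Y, ∀ x, e x = φ x := by
  have hc := hφ.continuous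
  have hadd' : ∀ x y, φ (x + y) = φ x + φ y := fun x y =>
    UniformSpace.Completion.induction_on₂ x y
      (isClosed_eq (hc.comp (continuous_fst.add continuous_snd))
        ((hc.comp continuous_fst).add (hc.comp continuous_snd)))
      fun f g => by rw [← UniformSpace.Completion.coe_add, hadd]
  have hsmul' : ∀ (c : 𝕜) x, φ (c • x) = c • φ x := fun c x =>
    UniformSpace.Completion.induction_on x
      (isClosed_eq (hc.comp (continuous_const_smul c)) (hc.const_smul c))
      fun f => by rw [← UniformSpace.Completion.coe_smul, hsmul]
  have hC' : ∀ x, ‖x‖ ≤ C * ‖φ x‖ := fun x =>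
    UniformSpace.Completion.induction_on x
      (isClosed_le continuous_norm (continuous_const.mul hc.norm))
      fun f => by rw [UniformSpace.Completion.norm_coe]; exact hC f
  let L : UniformSpace.Completion X →ₗ[𝕜] Y := ⟨⟨φ, hadd'⟩, hsmul'⟩
  -- Bounded below on a complete space, the map has closed range, so density gives surjectivity; the
  -- same estimate makes the inverse continuous.
  have hanti : AntilipschitzWith C φ := AntilipschitzWith.of_le_mul_dist fun x y => by
    rw [dist_eq_norm, dist_eq_norm]
    exact (hC' (x - y)).trans_eq (by rw [show φ (x - y) = φ x - φ y from map_sub L x y])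
  have hsurj : Function.Surjective φ := by
    rw [← Set.range_eq_univ, ← (hanti.isClosed_range hφ).closure_eq]
    refine DenseRange.closure_range (Metric.denseRange_iff.2 fun y r hr => ?_)
    obtain ⟨f, hf⟩ := hd y r hr
    exact ⟨f, by rwa [dist_comm, dist_eq_norm]⟩
  let e := LinearEquiv.ofBijective L ⟨hanti.injective, hsurj⟩
  refine ⟨⟨e, hc, ?_⟩, fun x => rfl⟩
  refine (hanti.to_rightInverse (g := e.symm) fun y => ?_).continuous
  exact e.apply_symm_apply y

end Extension

/-! ### The splitting isomorphisms. -/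

section Isomorphism

variable {𝕜 : Type*} [RCLike 𝕜] {p : ℝ} [hp : Fact (p ∈ Set.Ioo (0 : ℝ) 1)] {θ : ℝ} {M : ℕ → ℝ}

theorem LpR.norm_eq_of_ae {f : LpR 𝕜 p} {u : ℝ → 𝕜} (h : f.rep =ᵐ[volume] u) :
    ‖f‖ = (eLpNorm u (ENNReal.ofReal p) volume ^ p).toReal := by
  rw [LpR.norm_def, ENNReal.toReal_rpow, eLpNorm_congr_ae h]

instance : ContinuousConstSMul 𝕜 (LpR 𝕜 p) where
  continuous_const_smul c := by
    refine (LipschitzWith.of_dist_le_mul (K := ‖c‖₊ ^ p) fun f g => ?_).continuous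
    have h : (c • (f - g) : LpR 𝕜 p).rep =ᵐ[volume] c • (f - g : LpR 𝕜 p).rep :=
      Lp.coeFn_smul c (show Lp 𝕜 (ENNReal.ofReal p) (volume : Measure ℝ) from f - g)
    rw [dist_eq_norm, dist_eq_norm, ← smul_sub, LpR.norm_eq_of_ae h, eLpNorm_const_smul,
      ENNReal.mul_rpow_of_nonneg _ _ hp.out.1.le, ENNReal.toReal_mul, LpR.norm_def,
      ← ENNReal.toReal_rpow, ← ENNReal.toReal_rpow]
    simp

theorem TestSpace.rep_toLpR (n : ℕ) (f : TestSpace 𝕜 p θ M) :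
    (f.toLpR n).rep =ᵐ[volume] iteratedDeriv n f.fn := MemLp.coeFn_toLp _

theorem TestSpace.toLpR_add (n : ℕ) (f g : TestSpace 𝕜 p θ M) :
    (f + g).toLpR n = f.toLpR n + g.toLpR n := by
  refine (MemLp.toLp_congr _ ((f.memLp n).add (g.memLp n)) (Eventually.of_forall fun x => ?_)).trans
    (MemLp.toLp_add (f.memLp n) (g.memLp n))
  exact congrFun (iteratedDeriv_add_of_smooth f.2.1 g.2.1 n) x

theorem TestSpace.toLpR_smul (n : ℕ) (c : 𝕜) (f : TestSpace 𝕜 p θ M) :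
    (c • f).toLpR n = c • f.toLpR n := by
  refine (MemLp.toLp_congr _ ((f.memLp n).const_smul c) (Eventually.of_forall fun x => ?_)).trans
    (MemLp.toLp_const_smul c (f.memLp n))
  exact congrFun (iteratedDeriv_smul_of_smooth c f.fn n) x

theorem TestSpace.derivIter_add (k : ℕ) (f g : TestSpace 𝕜 p θ M) :
    (f + g).derivIter k = f.derivIter k + g.derivIter k :=
  Subtype.ext (iteratedDeriv_add_of_smooth f.2.1 g.2.1 k)

theorem TestSpace.derivIter_smul (k : ℕ) (c : 𝕜) (f : TestSpace 𝕜 p θ M) :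
    (c • f).derivIter k = c • f.derivIter k :=
  Subtype.ext (iteratedDeriv_smul_of_smooth c f.fn k)

theorem TestSpace.norm_le_sum (hM : ∀ n, 0 < M n) (f : TestSpace 𝕜 p θ M) (k : ℕ) :
    ‖f‖ ≤ ∑ i ∈ Finset.range k, ((M i) ^ p)⁻¹ * ‖f.toLpR i‖ + ‖f.derivIter k‖ := by
  have hp0 := hp.out.1
  have h1 : ∀ i, (eLpNorm (iteratedDeriv i f.fn) (ENNReal.ofReal p) volume /
      ENNReal.ofReal (M i)) ^ p = ENNReal.ofReal (((M i) ^ p)⁻¹ * ‖f.toLpR i‖) := by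
    intro i
    rw [LpR.norm_eq_of_ae (f.rep_toLpR i), ENNReal.ofReal_mul
      (inv_nonneg.2 (Real.rpow_nonneg (hM i).le p)), ENNReal.ofReal_toReal
      (ENNReal.rpow_ne_top_of_nonneg hp0.le (f.memLp i).2.ne),
      ENNReal.div_rpow_of_nonneg _ _ hp0.le, ENNReal.ofReal_rpow_of_pos (hM i),
      ENNReal.ofReal_inv_of_pos (Real.rpow_pos_of_pos (hM i) p), mul_comm, div_eq_mul_inv]
  have h2 := carlemanNorm_rpow_le_sum hp0 M f.fn k
  have h3 : carlemanNorm p (shift k M) (iteratedDeriv k f.fn) ^ p =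
      ENNReal.ofReal ‖f.derivIter k‖ := by
    rw [TestSpace.norm_def, ENNReal.toReal_rpow, ENNReal.ofReal_toReal
      (ENNReal.rpow_ne_top_of_nonneg hp0.le
        (show carlemanNorm p (shift k M) (f.derivIter k).fn ≠ ⊤ from (f.derivIter k).2.2.1.ne))]
    rfl
  have h0 : ∀ i, 0 ≤ ((M i) ^ p)⁻¹ * ‖f.toLpR i‖ := fun i =>
    mul_nonneg (inv_nonneg.2 (Real.rpow_nonneg (hM i).le p)) (norm_nonneg _)
  rw [Finset.sum_congr rfl fun i _ => h1 i, h3,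
    ← ENNReal.ofReal_sum_of_nonneg fun i _ => h0 i, ← ENNReal.ofReal_add
      (Finset.sum_nonneg fun i _ => h0 i) (norm_nonneg _)] at h2
  rw [TestSpace.norm_def, ENNReal.toReal_rpow]
  exact ENNReal.toReal_le_of_le_ofReal
    (add_nonneg (Finset.sum_nonneg fun i _ => h0 i) (norm_nonneg _)) h2

theorem IsPRegular.exists_testSpace_approx (hM : IsPRegular p M) (hθ : 0 ≤ θ) (k : ℕ)
    (h : ℕ → LpR 𝕜 p) (g : TestSpace 𝕜 p (θ / (1 - p) ^ k) (shift k M)) {ε : ℝ} (hε : 0 < ε) :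
    ∃ f : TestSpace 𝕜 p θ M, (∀ i < k, ‖f.toLpR i - h i‖ ≤ ε) ∧ ‖f.derivIter k - g‖ ≤ ε := by
  obtain ⟨f, hf, hfi, hfW⟩ := hM.exists_test_approx_iterate hθ (fun i => Lp.memLp (show Lp 𝕜 (ENNReal.ofReal p) (volume : Measure ℝ) from h i)) k g.2
    (ENNReal.ofReal_pos.2 hε).ne'
  refine ⟨⟨f, hf⟩, fun i hi => ?_, ?_⟩
  · have h1 : (TestSpace.toLpR i (⟨f, hf⟩ : TestSpace 𝕜 p θ M) - h i : LpR 𝕜 p).rep =ᵐ[volume]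
        (TestSpace.toLpR i (⟨f, hf⟩ : TestSpace 𝕜 p θ M)).rep - (h i).rep := Lp.coeFn_sub _ _
    rw [LpR.norm_eq_of_ae (h1.trans ((TestSpace.rep_toLpR i _).sub EventuallyEq.rfl))]
    exact ENNReal.toReal_le_of_le_ofReal hε.le (hfi i hi)
  · rw [TestSpace.norm_def, ENNReal.toReal_rpow]
    exact ENNReal.toReal_le_of_le_ofReal hε.le hfW

theorem IsPRegular.exists_equiv_deltaIterMap (hM : IsPRegular p M) (hθ : 0 ≤ θ) (k : ℕ) :
    ∃ e : CarlemanSpace 𝕜 p θ M ≃L[𝕜]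
        (Fin k → LpR 𝕜 p) × CarlemanSpace 𝕜 p (θ / (1 - p) ^ k) (shift k M),
      ∀ x, e x = (fun i : Fin k => piMap 𝕜 p θ M i x, deltaIterMap 𝕜 p θ M k x) := by
  set C : ℝ := ∑ i ∈ Finset.range k, ((M i) ^ p)⁻¹ + 1 with hCdef
  have hinv : ∀ i, 0 ≤ ((M i) ^ p)⁻¹ := fun i =>
    inv_nonneg.2 (Real.rpow_nonneg (hM.logConvex.1 i).le p)
  have hC0 : 0 ≤ C := add_nonneg (Finset.sum_nonneg fun i _ => hinv i) zero_le_one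
  refine exists_completion_equiv (C := ⟨C, hC0⟩) ?_ (fun f g => ?_) (fun c f => ?_) (fun f => ?_)
    fun y ε hε => ?_
  · exact (uniformContinuous_pi.2 fun i => UniformSpace.Completion.uniformContinuous_extension
      ).prodMk UniformSpace.Completion.uniformContinuous_map
  · simp only [piMap_coe, deltaIterMap_coe]
    simp only [TestSpace.toLpR_add, TestSpace.derivIter_add,
      UniformSpace.Completion.coe_add]
    rfl
  · simp only [piMap_coe, deltaIterMap_coe]
    simp only [TestSpace.toLpR_smul, TestSpace.derivIter_smul,
      UniformSpace.Completion.coe_smul]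
    rfl
  · simp only [piMap_coe, deltaIterMap_coe]
    refine (f.norm_le_sum hM.logConvex.1 k).trans ?_
    change _ ≤ C * _
    rw [hCdef, add_mul, one_mul, Finset.sum_mul]
    refine add_le_add (Finset.sum_le_sum fun i hi => ?_) ?_
    · refine mul_le_mul_of_nonneg_left (le_trans ?_ (norm_fst_le _)) (hinv i)
      exact norm_le_pi_norm (fun i : Fin k => f.toLpR (i : ℕ)) ⟨i, Finset.mem_range.1 hi⟩
    · refine le_trans ?_ (norm_snd_le _)
      rw [UniformSpace.Completion.norm_coe]
  · obtain ⟨h, z⟩ := y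
    obtain ⟨g, hg⟩ := Metric.denseRange_iff.1
      (UniformSpace.Completion.denseRange_coe (α := TestSpace 𝕜 p (θ / (1 - p) ^ k) (shift k M)))
      z (ε / 3) (by linarith)
    obtain ⟨f, hfi, hfg⟩ := hM.exists_testSpace_approx hθ k
      (fun i => if hi : i < k then h ⟨i, hi⟩ else 0) g (show 0 < ε / 3 by linarith)
    refine ⟨f, ?_⟩
    simp only [piMap_coe, deltaIterMap_coe, Prod.mk_sub_mk]
    rw [Prod.norm_mk, max_lt_iff]
    constructor
    · refine ((pi_norm_le_iff_of_nonneg (show 0 ≤ ε / 3 by linarith)).2 fun i => ?_).trans_lt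
        (show ε / 3 < ε by linarith)
      have := hfi i i.2
      rwa [dif_pos i.2] at this
    · rw [← sub_add_sub_cancel _ (g : CarlemanSpace 𝕜 p (θ / (1 - p) ^ k) (shift k M)) z]
      refine (norm_add_le _ _).trans_lt ?_
      rw [dist_comm, dist_eq_norm] at hg
      rw [← UniformSpace.Completion.coe_sub, UniformSpace.Completion.norm_coe]
      linarith

/-- The argument of the $k$-fold case is repeated because $\theta/(1-p)^1$ and $\theta/(1-p)$ index
differently written spaces. -/
theorem IsPRegular.exists_equiv_deltaMap (hM : IsPRegular p M) (hθ : 0 ≤ θ) :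
    ∃ e : CarlemanSpace 𝕜 p θ M ≃L[𝕜] LpR 𝕜 p × CarlemanSpace 𝕜 p (θ / (1 - p)) (shift 1 M),
      ∀ x, e x = (piMap 𝕜 p θ M 0 x, deltaMap 𝕜 p θ M x) := by
  set C : ℝ := ((M 0) ^ p)⁻¹ + 1 with hCdef
  have hinv : 0 ≤ ((M 0) ^ p)⁻¹ := inv_nonneg.2 (Real.rpow_nonneg (hM.logConvex.1 0).le p)
  have hC0 : 0 ≤ C := add_nonneg hinv zero_le_one
  have hadd : ∀ f g : TestSpace 𝕜 p θ M, (f + g).deriv = f.deriv + g.deriv := fun f g =>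
    Subtype.ext (by
      have := iteratedDeriv_add_of_smooth f.2.1 g.2.1 1
      rwa [iteratedDeriv_one, iteratedDeriv_one, iteratedDeriv_one] at this)
  have hsmul : ∀ (c : 𝕜) (f : TestSpace 𝕜 p θ M), (c • f).deriv = c • f.deriv := fun c f =>
    Subtype.ext (by
      have := iteratedDeriv_smul_of_smooth c f.fn 1
      rwa [iteratedDeriv_one, iteratedDeriv_one] at this)
  have hnorm : ∀ f : TestSpace 𝕜 p θ M, ‖f.derivIter 1‖ = ‖f.deriv‖ := fun f => by
    rw [TestSpace.norm_def, TestSpace.norm_def,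
      show (f.derivIter 1).fn = f.deriv.fn from iteratedDeriv_one]
  refine exists_completion_equiv (C := ⟨C, hC0⟩) ?_ (fun f g => ?_) (fun c f => ?_) (fun f => ?_)
    fun y ε hε => ?_
  · exact UniformSpace.Completion.uniformContinuous_extension.prodMk
      UniformSpace.Completion.uniformContinuous_map
  · simp only [piMap_coe, deltaMap_coe]
    simp only [TestSpace.toLpR_add, hadd,
      UniformSpace.Completion.coe_add]
    rfl
  · simp only [piMap_coe, deltaMap_coe]
    simp only [TestSpace.toLpR_smul, hsmul,
      UniformSpace.Completion.coe_smul]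
    rfl
  · simp only [piMap_coe, deltaMap_coe]
    refine (f.norm_le_sum hM.logConvex.1 1).trans ?_
    change _ ≤ C * _
    rw [hCdef, add_mul, one_mul, Finset.sum_range_one, hnorm]
    refine add_le_add (mul_le_mul_of_nonneg_left ?_ hinv)
      (le_trans ?_ (norm_snd_le _))
    · exact norm_fst_le (f.toLpR 0, (f.deriv : CarlemanSpace 𝕜 p (θ / (1 - p)) (shift 1 M)))
    · rw [UniformSpace.Completion.norm_coe]
  · obtain ⟨h, z⟩ := y
    obtain ⟨g, hg⟩ := Metric.denseRange_iff.1
      (UniformSpace.Completion.denseRange_coe (α := TestSpace 𝕜 p (θ / (1 - p)) (shift 1 M)))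
      z (ε / 3) (by linarith)
    have hε3 : 0 < ε / 3 := by linarith
    obtain ⟨f, hf, hfh, hfg⟩ := hM.exists_test_approx hθ
      (Lp.memLp (show Lp 𝕜 (ENNReal.ofReal p) (volume : Measure ℝ) from h)) g.2
      (ENNReal.ofReal_pos.2 hε3).ne'
    let F : TestSpace 𝕜 p θ M := ⟨f, hf⟩
    have h1 : (F.toLpR 0 - h : LpR 𝕜 p).rep =ᵐ[volume] (F.toLpR 0).rep - h.rep := Lp.coeFn_sub _ _
    have h2 : ‖F.toLpR 0 - h‖ ≤ ε / 3 := by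
      rw [LpR.norm_eq_of_ae (h1.trans ((TestSpace.rep_toLpR 0 _).sub EventuallyEq.rfl)),
        iteratedDeriv_zero]
      exact ENNReal.toReal_le_of_le_ofReal hε3.le hfh
    have h3 : ‖F.deriv - g‖ ≤ ε / 3 := by
      rw [TestSpace.norm_def, ENNReal.toReal_rpow]
      exact ENNReal.toReal_le_of_le_ofReal hε3.le hfg
    refine ⟨F, ?_⟩
    simp only [piMap_coe, deltaMap_coe, Prod.mk_sub_mk]
    rw [Prod.norm_mk, max_lt_iff]
    constructor
    · linarith
    · rw [← sub_add_sub_cancel _ (g : CarlemanSpace 𝕜 p (θ / (1 - p)) (shift 1 M)) z]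
      refine (norm_add_le _ _).trans_lt ?_
      rw [dist_comm, dist_eq_norm] at hg
      rw [← UniformSpace.Completion.coe_sub, UniformSpace.Completion.norm_coe]
      linarith

end Isomorphism

end LpCarleman

theorem mainTheorem2 (𝕜 : Type*) [RCLike 𝕜] (p : ℝ) [Fact (p ∈ Set.Ioo (0 : ℝ) 1)]
    (θ : ℝ) (hθ : 0 ≤ θ) (M : ℕ → ℝ) (hM : LpCarleman.IsPRegular p M) :
    Function.Surjective (LpCarleman.piMap 𝕜 p θ M 0) ∧
    (∃ e : LpCarleman.CarlemanSpace 𝕜 p θ M ≃L[𝕜]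
        LpCarleman.LpR 𝕜 p × LpCarleman.CarlemanSpace 𝕜 p (θ / (1 - p)) (LpCarleman.shift 1 M),
      ∀ x, e x = (LpCarleman.piMap 𝕜 p θ M 0 x, LpCarleman.deltaMap 𝕜 p θ M x)) ∧
    LpCarleman.IsPRegular p (LpCarleman.shift 1 M) ∧
    (∀ k : ℕ, ∃ e : LpCarleman.CarlemanSpace 𝕜 p θ M ≃L[𝕜]
        (Fin k → LpCarleman.LpR 𝕜 p) ×
          LpCarleman.CarlemanSpace 𝕜 p (θ / (1 - p) ^ k) (LpCarleman.shift k M),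
      ∀ x, e x = (fun i : Fin k => LpCarleman.piMap 𝕜 p θ M i x,
        LpCarleman.deltaIterMap 𝕜 p θ M k x)) := by
  obtain ⟨hp0, hp1⟩ := Fact.out (p := p ∈ Set.Ioo (0 : ℝ) 1)
  obtain ⟨e, he⟩ := hM.exists_equiv_deltaMap (𝕜 := 𝕜) hθ
  refine ⟨fun h => ?_, ⟨e, he⟩, hM.shift_one hp0 hp1, fun k => hM.exists_equiv_deltaIterMap hθ k⟩
  refine ⟨e.symm (h, 0), ?_⟩
  have := he (e.symm (h, 0))
  rw [e.apply_symm_apply] at this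
  exact (congrArg Prod.fst this).symm
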